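/- **Proposition 1.9.** Let $(M,g)$ be a connected Riemannian manifold without boundary (finite-dimensional, smooth, Hausdorff), with Riemannian distance $d$, Levi-Civita covariant derivative $\nabla$, and space $\Gamma(TM)$ of smooth vector fields. Let $T>0$. Let $[0,T]\ni t\mapsto X_t\in\Gamma(TM)$ and $[0,T]\ni t\mapsto Z_t\in\Gamma(TM)$ be smoothly varying time-dependent vector fields, i.e. $(t,m)\mapsto X_t(m)$ and $(t,m)\mapsto Z_t(m)$ are smooth on $[0,T]\times M$. Suppose that $X$ is complete: for all $s\in[0,T]$ and $m\in M$ the equation $\dot\sigma(t)=X_t(\sigma(t))$, $\sigma(s)=m$, has a solution $\sigma$ on all of $[0,T]$ (with one-sided derivatives at $0$ and $T$); write $\mu^X_{t,s}(m):=\sigma(t)$. Suppose also that for each fixed $t\in[0,T]$ the vector field $Z_t$ is complete, with flow $(e^{sZ_t})_{s\in\mathbb R}$, and that $Z_0\equiv 0$. Let $\dot Z_t=\frac{d}{dt}Z_t$ and $$W^Z_t(m):=\int_0^1 \big(\mathrm{Ad}_{e^{sZ_t}}\dot Z_t\big)(m)\,ds,\qquad \big(\mathrm{Ad}_{e^{sZ_t}}\dot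 Z_t\big)(m):=(e^{sZ_t})_*\,\dot Z_t\big(e^{-sZ_t}(m)\big)\in T_mM .$$ Then $W^Z_t\in\Gamma(TM)$ for every $t\in[0,T]$, $$\frac{d}{dt}e^{Z_t}(m)=W^Z_t\big(e^{Z_t}(m)\big)\qquad (m\in M,\ t\in[0,T]),$$ and for all $t\in[0,T]$ and $m\in M$ $$d\big(\mu^X_{t,0}(m),e^{Z_t}(m)\big)\le\int_0^t \exp\Big(\int_s^t|\nabla X_\sigma|_{\mu^X_{\sigma,s}(e^{Z_s}(m))}\,d\sigma\Big)\cdot\big|W^Z_s-X_s\big|_{e^{Z_s}(m)}\,ds .$$ Here $|Y|_p=|Y(p)|_g$ and $|\nabla Y|_p=\sup\{|\nabla_vY|_g : v\in T_pM,\ |v|_g=1\}$ (read as $0$ if $T_pM=0$). -/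

import Mathlib

open Set Manifold Bundle MeasureTheory
open scoped ContDiff Topology

noncomputable section

section Flows

variable {E : Type*} [NormedAddCommGroup E] [NormedSpace ℝ E]
  {M : Type*} [TopologicalSpace M] [ChartedSpace E M]

/-- `Y` is a smooth vector field on `M`, that is, `Y ∈ Γ(TM)`. -/
def IsSmoothField [IsManifold 𝓘(ℝ, E) ∞ M] (Y : ∀ m : M, TangentSpace 𝓘(ℝ, E) m) : Prop :=
  ContMDiff 𝓘(ℝ, E) 𝓘(ℝ, E).tangent ∞ (fun m : M => (⟨m, Y m⟩ : TangentBundle 𝓘(ℝ, E) M))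

/-- `t ↦ Y t` is a time dependent vector field on `M`, smoothly varying for `t ∈ J`: the map
`(t, m) ↦ Y t m ∈ TM` is smooth on `J × M`. -/
def IsSmoothTimeField [IsManifold 𝓘(ℝ, E) ∞ M] (J : Set ℝ) (Y : ℝ → ∀ m : M, TangentSpace 𝓘(ℝ, E) m) : Prop :=
  ContMDiffOn (𝓘(ℝ, ℝ).prod 𝓘(ℝ, E)) 𝓘(ℝ, E).tangent ∞
    (fun p : ℝ × M => (⟨p.2, Y p.1 p.2⟩ : TangentBundle 𝓘(ℝ, E) M)) (J ×ˢ univ)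

/-- The curve `σ` has velocity `v ∈ T_{σ t} M` at time `t`, relative to the time set `J`
(so one-sided at an endpoint of an interval `J`). -/
def HasVelocityWithin (J : Set ℝ) (σ : ℝ → M) (t : ℝ) (v : TangentSpace 𝓘(ℝ, E) (σ t)) : Prop :=
  HasMFDerivWithinAt 𝓘(ℝ, ℝ) 𝓘(ℝ, E) σ J t ((1 : ℝ →L[ℝ] ℝ).smulRight v)

/-- `σ : J → M` solves `σ' t = Y t (σ t)` for all `t ∈ J`, with `σ s = m`. The values of `σ` outside
of `J` are irrelevant. -/
def IsFlowLine (J : Set ℝ) (Y : ℝ → ∀ m : M, TangentSpace 𝓘(ℝ, E) m) (s : ℝ) (m : M) (σ : ℝ → M) : Prop :=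
  σ s = m ∧ ∀ t ∈ J, HasVelocityWithin J σ t (Y t (σ t))

/-- The time dependent vector field `Y` is complete: through every `m` at every time `s ∈ J` there
is a solution defined on all of `J`. -/
def IsCompleteField (J : Set ℝ) (Y : ℝ → ∀ m : M, TangentSpace 𝓘(ℝ, E) m) : Prop :=
  ∀ s ∈ J, ∀ m : M, ∃ σ : ℝ → M, IsFlowLine J Y s m σ

open Classical in
/-- The flow `μ_{t,s}(m)` of `Y`: the value at time `t` of the solution on `J` starting at `m` at
time `s` (with the value `m` if there is no solution). -/
def flow (J : Set ℝ) (Y : ℝ → ∀ m : M, TangentSpace 𝓘(ℝ, E) m) (t s : ℝ) (m : M) : M :=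
  if h : ∃ σ : ℝ → M, IsFlowLine J Y s m σ then h.choose t else m

/-- The flow `e^{sY}` of a time independent vector field `Y`, with time set `ℝ`. -/
def expFlow (s : ℝ) (Y : ∀ m : M, TangentSpace 𝓘(ℝ, E) m) : M → M :=
  flow univ (fun _ => Y) s 0

/-- `(Ad_{e^{sZ}} Y)(m) = e^{sZ}_* Y(e^{-sZ}(m))`. The differential takes values in the tangent
space at `e^{sZ}(e^{-sZ}(m))`, which is `T_m M` because that point is `m`. -/
def adExp (s : ℝ) (Z Y : ∀ m : M, TangentSpace 𝓘(ℝ, E) m) (m : M) : TangentSpace 𝓘(ℝ, E) m :=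
  (mfderiv 𝓘(ℝ, E) 𝓘(ℝ, E) (expFlow s Z) (expFlow (-s) Z m) (Y (expFlow (-s) Z m)) : E)

/-- The time derivative `(dZ/dt)(m) ∈ T_m M`, one-sided at an endpoint of the interval `J`. -/
def timeDeriv (J : Set ℝ) (Z : ℝ → ∀ m : M, TangentSpace 𝓘(ℝ, E) m) (t : ℝ) (m : M) : TangentSpace 𝓘(ℝ, E) m :=
  derivWithin (fun τ => Z τ m) J t

end Flows

instance instFiniteDimensionalTangent {E : Type*} [NormedAddCommGroup E] [NormedSpace ℝ E]
    [FiniteDimensional ℝ E] {M : Type*} [TopologicalSpace M] [ChartedSpace E M] (m : M) :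
    FiniteDimensional ℝ (TangentSpace 𝓘(ℝ, E) m) :=
  inferInstanceAs (FiniteDimensional ℝ E)

section Riemannian

variable {E : Type*} [NormedAddCommGroup E] [NormedSpace ℝ E] [FiniteDimensional ℝ E]
  {M : Type*} [TopologicalSpace M] [ChartedSpace E M] [IsManifold 𝓘(ℝ, E) ∞ M]
  [RiemannianBundle (fun m : M => TangentSpace 𝓘(ℝ, E) m)]

/-- `W^Z_t = ∫₀¹ Ad_{e^{sZ_t}} (dZ/dt) ds`, a vector field on `M`. -/
def fieldW (J : Set ℝ) (Z : ℝ → ∀ m : M, TangentSpace 𝓘(ℝ, E) m) (t : ℝ) (m : M) : TangentSpace 𝓘(ℝ, E) m :=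
  ∫ s in (0 : ℝ)..1, adExp s (Z t) (timeDeriv J Z t) m

/-- The Koszul expression
`V⟨X,W⟩ + X⟨V,W⟩ - W⟨V,X⟩ + ⟨[V,X],W⟩ - ⟨[V,W],X⟩ - ⟨[X,W],V⟩`, which is `2⟨∇_V X, W⟩`. -/
def koszul (X V W : ∀ m : M, TangentSpace 𝓘(ℝ, E) m) (m : M) : ℝ :=
  mvfderiv 𝓘(ℝ, E) (fun p => inner ℝ (X p) (W p)) m (V m)
    + mvfderiv 𝓘(ℝ, E) (fun p => inner ℝ (V p) (W p)) m (X m)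
    - mvfderiv 𝓘(ℝ, E) (fun p => inner ℝ (V p) (X p)) m (W m)
    + inner ℝ (VectorField.mlieBracket 𝓘(ℝ, E) V X m) (W m)
    - inner ℝ (VectorField.mlieBracket 𝓘(ℝ, E) V W m) (X m)
    - inner ℝ (VectorField.mlieBracket 𝓘(ℝ, E) X W m) (V m)

/-- The Levi-Civita covariant derivative `∇_v X`, for `v ∈ T_m M`: the vector `u ∈ T_m M` with
`2⟨u, w⟩ = koszul X V W m` for all `w`, where `V` and `W` are fields with `V m = v` and `W m = w`.
It is written here in an orthonormal basis of `T_m M`. -/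
def leviCivita (X : ∀ m : M, TangentSpace 𝓘(ℝ, E) m) (m : M) (v : TangentSpace 𝓘(ℝ, E) m) : TangentSpace 𝓘(ℝ, E) m :=
  ∑ i, ((1 / 2 : ℝ) * koszul X (FiberBundle.extend E v)
      (FiberBundle.extend E (stdOrthonormalBasis ℝ (TangentSpace 𝓘(ℝ, E) m) i)) m) •
    stdOrthonormalBasis ℝ (TangentSpace 𝓘(ℝ, E) m) i

/-- `leviCivita` agrees with every torsion-free covariant derivative on `TM` that is compatible with
the metric. -/
theorem leviCivita_eq [IsContMDiffRiemannianBundle 𝓘(ℝ, E) ∞ E (fun m : M => TangentSpace 𝓘(ℝ, E) m)]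
    (cov : CovariantDerivative 𝓘(ℝ, E) E (fun m : M => TangentSpace 𝓘(ℝ, E) m)) (htor : cov.torsion = 0)
    (hmet : ∀ {m : M} {Y V : ∀ m : M, TangentSpace 𝓘(ℝ, E) m}, MDiffAt (T% Y) m → MDiffAt (T% V) m →
      ∀ v : TangentSpace 𝓘(ℝ, E) m, mvfderiv 𝓘(ℝ, E) (fun p => inner ℝ (Y p) (V p)) m v
        = inner ℝ (cov Y m v) (V m) + inner ℝ (Y m) (cov V m v))
    {X : ∀ m : M, TangentSpace 𝓘(ℝ, E) m} {m : M} (hX : MDiffAt (T% X) m) (v : TangentSpace 𝓘(ℝ, E) m) :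
    leviCivita X m v = cov X m v := by
  rw [CovariantDerivative.torsion_eq_zero_iff] at htor
  have key : ∀ w : TangentSpace 𝓘(ℝ, E) m, koszul X (FiberBundle.extend E v) (FiberBundle.extend E w) m
      = 2 * inner ℝ w (cov X m v) := by
    intro w
    have hV : MDiffAt (T% (FiberBundle.extend E v : ∀ m : M, TangentSpace 𝓘(ℝ, E) m)) m :=
      FiberBundle.mdifferentiableAt_extend ..
    have hW : MDiffAt (T% (FiberBundle.extend E w : ∀ m : M, TangentSpace 𝓘(ℝ, E) m)) m :=
      FiberBundle.mdifferentiableAt_extend ..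
    rw [koszul, hmet hX hW, hmet hV hW, hmet hV hX, ← htor hV hX, ← htor hV hW, ← htor hX hW]
    simp only [FiberBundle.extend_apply_self, inner_sub_left]
    simp only [real_inner_comm]
    ring
  simp only [leviCivita, key]
  conv_rhs => rw [← (stdOrthonormalBasis ℝ (TangentSpace 𝓘(ℝ, E) m)).sum_repr' (cov X m v)]
  refine Finset.sum_congr rfl fun i _ => ?_
  congr 1
  ring

/-- The pointwise norm `|∇X|_m = sup {|∇_v X| : v ∈ T_m M, |v| = 1}`. -/
def normNabla (X : ∀ m : M, TangentSpace 𝓘(ℝ, E) m) (m : M) : ℝ :=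
  ⨆ v : Metric.sphere (0 : TangentSpace 𝓘(ℝ, E) m) 1, ‖leviCivita X m v‖

end Riemannian

end

/-! The distance estimate compares two curves through a third one. Put `p(s) = e^{Z_s}(m)`, and fix
`t`. The curve `γ(s) = μ_{t,s}(p(s))`, `0 ≤ s ≤ t`, runs from `μ_{t,0}(m)` (because `Z_0 = 0`) to
`e^{Z_t}(m)`, so the distance is at most its length. As `r ↦ μ_{t,r}(μ_{r,s}(x))` is constant, the
velocity of `γ` at `s` is the image under the differential of `μ_{t,s}` of the defect
`p'(s) - X_s(p(s)) = (W_s - X_s)(p(s))` (`hasVelocityWithin_flow_curve`). It remains to bound this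
differential and to compute `p'`.

*The differential of the flow of `X`* (`norm_mfderiv_flow_le`). For a tangent vector `v`, the variation
field `V(σ) = D μ_{σ,s} v` satisfies `(|V|²)' = 2⟨∇_V X_σ, V⟩ ≤ 2 |∇X_σ| |V|²`, whence the exponential
factor. In a chart the first identity follows from the linearised equation `V' = Df V`
(`hasDerivAt_fderiv_of_flow`) and from the coordinate form of the Koszul expression
(`koszul_eq_koszulInChart`): its antisymmetric part drops out on the diagonal. This uses second
derivatives of the flow, so it is done for times in the open interval `(0, T)`; the endpoints do not
matter for the length of `γ`.

*The derivative of `t ↦ e^{Z_t}(m)`* (`hasVelocityWithin_expFlow_one`). For fixed `t` consider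
`κ(τ, s) = e^{-sZ_t}(e^{sZ_τ}(m))`. Its `s`-velocity is `τ - t` times the image under `e^{-sZ_t}_*` of the
difference quotient `(Z_τ - Z_t) / (τ - t)` at `e^{sZ_τ}(m)`. As `κ(t, s) = m`, integrating in `s` within
one chart and letting `τ → t` gives `∂_τ κ(t, 1) = ∫₀¹ Ad_{e^{-sZ_t}} Ż_t (m) ds`; applying `e^{Z_t}` and
substituting `1 - s` for `s` gives `W_t(e^{Z_t}(m))`. No mixed second derivatives of the flow are needed.

Both parts rest on the joint regularity of flows in time, starting time and point
(`contMDiffOn_flow`, `contMDiffOn_expFlow_family`). Locally it comes from the implicit function theorem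
in `C([0, 1], V)` (`exists_contDiffAt_localFlow`), and it is continued along a solution by connectedness
of the time interval (`contMDiffWithinAt_evolution`). At the endpoints of `[0, T]` a field that is smooth
on `[0, T] × M` is first extended, locally, to a `C^1` field for times outside of `[0, T]`
(`exists_contDiffOn_one_extension`); this gives a `C^1` flow up to the endpoints, which is enough. -/

noncomputable section


/-! ### Superposition operators on spaces of continuous functions -/

section Nemytskii
universe u
variable {K : Type*} [TopologicalSpace K] [CompactSpace K]
  {V W : Type u} [NormedAddCommGroup V] [NormedSpace ℝ V] [NormedAddCommGroup W] [NormedSpace ℝ W]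

/-- A shortcut: the general search for this instance is slow. -/
instance instNormedAddCommGroupContinuousMapCLM : NormedAddCommGroup C(K, V →L[ℝ] W) :=
  ContinuousMap.instNormedAddCommGroup

/-- Pointwise application of a continuous family of operators to a continuous function, as a
continuous bilinear map. -/
def pointwiseApply (K : Type*) [TopologicalSpace K] [CompactSpace K] (V W : Type u)
    [NormedAddCommGroup V] [NormedSpace ℝ V] [NormedAddCommGroup W] [NormedSpace ℝ W] :
    C(K, V →L[ℝ] W) →L[ℝ] C(K, V) →L[ℝ] C(K, W) :=
  LinearMap.mkContinuous₂
    (LinearMap.mk₂ ℝ (fun (A : C(K, V →L[ℝ] W)) (h : C(K, V)) =>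
        (⟨fun t => A t (h t), by fun_prop⟩ : C(K, W)))
      (fun _ _ _ => by ext; simp) (fun _ _ _ => by ext; simp)
      (fun _ _ _ => by ext; simp) (fun _ _ _ => by ext; simp)) 1
    (fun A h => by
      rw [ContinuousMap.norm_le _ (by positivity)]
      intro t
      simp only [LinearMap.mk₂_apply, ContinuousMap.coe_mk, one_mul]
      exact (A t).le_of_opNorm_le_of_le (A.norm_coe_le_norm t) (h.norm_coe_le_norm t))

@[simp] theorem pointwiseApply_apply (A : C(K, V →L[ℝ] W)) (h : C(K, V)) (t : K) :
    pointwiseApply K V W A h t = A t (h t) := rfl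

/-- The superposition operator `γ ↦ f ∘ γ` on spaces of continuous functions is differentiable.
The remainder is controlled by the mean value inequality, on a ball on which continuity of the
superposition operator of `fderiv ℝ f` makes `fderiv ℝ f` almost constant. -/
theorem hasFDerivAt_comp_continuousMap {f : V → W} (hf : ContDiff ℝ 1 f) (γ : C(K, V)) :
    HasFDerivAt (fun γ : C(K, V) => (⟨f, hf.continuous⟩ : C(V, W)).comp γ)
      (pointwiseApply K V W
        ((⟨fderiv ℝ f, hf.continuous_fderiv one_ne_zero⟩ : C(V, V →L[ℝ] W)).comp γ)) γ := by
  set F' : C(V, V →L[ℝ] W) := ⟨fderiv ℝ f, hf.continuous_fderiv one_ne_zero⟩ with hF'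
  rw [hasFDerivAt_iff_isLittleO_nhds_zero, Asymptotics.isLittleO_iff]
  intro c hc
  have hcont : Continuous fun η : C(K, V) => F'.comp η := F'.continuous_postcomp
  obtain ⟨δ, hδ, hball⟩ := Metric.continuousAt_iff.1 (hcont.continuousAt (x := γ)) c hc
  filter_upwards [Metric.ball_mem_nhds (0 : C(K, V)) hδ] with h hh
  rw [mem_ball_zero_iff] at hh
  rw [ContinuousMap.norm_le _ (by positivity)]
  intro t
  have hder : ∀ y ∈ Metric.ball (γ t) δ, ‖fderiv ℝ f y - fderiv ℝ f (γ t)‖ ≤ c := by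
    intro y hy
    have h1 := @hball (γ + ContinuousMap.const K (y - γ t)) (by
      rw [dist_eq_norm, add_sub_cancel_left]
      refine (ContinuousMap.norm_lt_iff _ hδ).2 fun s => ?_
      simpa [dist_eq_norm] using hy)
    have h2 := (ContinuousMap.dist_apply_le_dist t).trans h1.le
    simpa [hF', dist_eq_norm] using h2
  have hht : ‖h t‖ < δ := (h.norm_coe_le_norm t).trans_lt hh
  have key := (convex_ball (γ t) δ).norm_image_sub_le_of_norm_hasFDerivWithin_le'
    (f := f) (f' := fderiv ℝ f) (φ := fderiv ℝ f (γ t)) (C := c)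
    (fun y _ => ((hf.differentiable one_ne_zero) y).hasFDerivAt.hasFDerivWithinAt) hder
    (Metric.mem_ball_self hδ) (y := γ t + h t) (by simpa using hht)
  simp only [add_sub_cancel_left] at key
  refine le_trans ?_ (key.trans (mul_le_mul_of_nonneg_left (h.norm_coe_le_norm t) hc.le))
  simp [hF']

theorem contDiff_nat_comp_continuousMap (n : ℕ) : ∀ {W : Type u} [NormedAddCommGroup W]
    [NormedSpace ℝ W] {f : V → W} (hf : ContDiff ℝ n f),
    ContDiff ℝ n (fun γ : C(K, V) => (⟨f, hf.continuous⟩ : C(V, W)).comp γ) := by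
  induction n with
  | zero =>
    intro W _ _ f hf
    simp only [Nat.cast_zero, contDiff_zero]
    exact ContinuousMap.continuous_postcomp _
  | succ n ih =>
    intro W _ _ f hf
    have h1 : ContDiff ℝ 1 f := hf.of_le (by exact_mod_cast Nat.le_add_left 1 n)
    have hf' : ContDiff ℝ n (fderiv ℝ f) := hf.fderiv_right (by norm_cast)
    have := contDiff_succ_iff_hasFDerivAt (𝕜 := ℝ) (n := n)
      (f := fun γ : C(K, V) => (⟨f, hf.continuous⟩ : C(V, W)).comp γ)
    have hA : ContDiff ℝ n (pointwiseApply K V W) := by apply ContinuousLinearMap.contDiff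
    exact_mod_cast this.2 ⟨fun γ => pointwiseApply K V W
      ((⟨fderiv ℝ f, hf'.continuous⟩ : C(V, V →L[ℝ] W)).comp γ),
      hA.comp (ih hf'), fun γ => hasFDerivAt_comp_continuousMap h1 γ⟩

/-- The superposition operator of a `C^n` map is `C^n`. -/
theorem contDiff_comp_continuousMap {n : ℕ∞} {f : V → W} (hf : ContDiff ℝ n f) :
    ContDiff ℝ n (fun γ : C(K, V) => (⟨f, hf.continuous⟩ : C(V, W)).comp γ) :=
  contDiff_iff_forall_nat_le.2 fun m hm =>
    contDiff_nat_comp_continuousMap m (hf.of_le (by exact_mod_cast hm))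

end Nemytskii

/-! ### Local flows in a Banach space -/

section LocalFlow
universe u
variable {V W : Type u} [NormedAddCommGroup V] [NormedSpace ℝ V] [CompleteSpace V]

/-- The primitive `u ↦ ∫₀ᵘ γ`, as a continuous operator on `C([0, 1], V)`. -/
def primitiveCLM (V : Type u) [NormedAddCommGroup V] [NormedSpace ℝ V] [CompleteSpace V] :
    C(unitInterval, V) →L[ℝ] C(unitInterval, V) :=
  LinearMap.mkContinuous
    { toFun := fun γ => ⟨fun u => ∫ r in (0 : ℝ)..u, γ (projIcc 0 1 zero_le_one r), by
        have h : Continuous fun b : ℝ => ∫ r in (0 : ℝ)..b, γ (projIcc 0 1 zero_le_one r) :=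
          intervalIntegral.continuous_primitive
            (fun a b => (γ.continuous.comp continuous_projIcc).intervalIntegrable a b) 0
        exact h.comp continuous_subtype_val⟩
      map_add' := fun γ η => by
        ext u
        exact intervalIntegral.integral_add
          ((γ.continuous.comp continuous_projIcc).intervalIntegrable _ _)
          ((η.continuous.comp continuous_projIcc).intervalIntegrable _ _)
      map_smul' := fun c γ => by
        ext u
        exact intervalIntegral.integral_smul c _ } 1
    (fun γ => by
      rw [ContinuousMap.norm_le _ (by positivity)]
      intro u
      refine (intervalIntegral.norm_integral_le_of_norm_le_const
        (C := ‖γ‖) fun r _ => γ.norm_coe_le_norm _).trans ?_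
      rw [one_mul, sub_zero, abs_of_nonneg u.2.1]
      exact mul_le_of_le_one_right (norm_nonneg _) u.2.2)

theorem primitiveCLM_apply (γ : C(unitInterval, V)) (u : unitInterval) :
    primitiveCLM V γ u = ∫ r in (0 : ℝ)..u, γ (projIcc 0 1 zero_le_one r) := rfl

/-- **Smooth dependence on initial conditions**, local version in a Banach space. The solutions of
`ν' = s F(ν)` on `[0, 1]` are the zeros of `γ ↦ γ - v - s ∫₀ F(γ)` on `C([0, 1], V)`. At `s = 0` the
derivative of this map in `γ` is the identity, so that the implicit function theorem
gives a `C^n` family of solutions, and tells that there are no others nearby. -/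
theorem exists_contDiffAt_localFlow {n : ℕ} (hn : n ≠ 0) {F : V → V} (hF : ContDiff ℝ n F) (v₀ : V) :
    ∃ φ : ℝ × V → V, ContDiffAt ℝ n φ (0, v₀) ∧ ∃ ε > 0, ∀ s v, |s| < ε → ‖v - v₀‖ < ε →
      ∀ ν : ℝ → V, ν 0 = v →
        (∀ u ∈ Icc (0 : ℝ) 1, HasDerivWithinAt ν (s • F (ν u)) (Icc 0 1) u) →
        (∀ u ∈ Icc (0 : ℝ) 1, ‖ν u - v₀‖ < ε) → ν 1 = φ (s, v) := by
  let Fs : C(unitInterval, V) → C(unitInterval, V) := fun γ => (⟨F, hF.continuous⟩ : C(V, V)).comp γ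
  have hFs : ContDiff ℝ n Fs := contDiff_nat_comp_continuousMap n hF
  let c : V →L[ℝ] C(unitInterval, V) := LinearMap.mkContinuous
    { toFun := fun v => ContinuousMap.const _ v
      map_add' := fun _ _ => by ext; simp
      map_smul' := fun _ _ => by ext; simp } 1 (fun v => by
        rw [ContinuousMap.norm_le _ (by positivity)]
        simp)
  have hc : ∀ v t, c v t = v := fun _ _ => rfl
  let Φ : (ℝ × V) × C(unitInterval, V) → C(unitInterval, V) := fun p =>
    p.2 - c p.1.2 - p.1.1 • primitiveCLM V (Fs p.2)
  have hΦ : ContDiff ℝ n Φ := by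
    refine (contDiff_snd.sub (c.contDiff.comp (contDiff_snd.comp contDiff_fst))).sub ?_
    exact (contDiff_fst.comp contDiff_fst).smul ((primitiveCLM V).contDiff.comp (hFs.comp contDiff_snd))
  let p₀ : (ℝ × V) × C(unitInterval, V) := ((0, v₀), c v₀)
  have hn' : ((n : ℕ∞) : WithTop ℕ∞) ≠ 0 := by exact_mod_cast hn
  have hΦ0 : Φ p₀ = 0 := by simp [Φ, p₀]
  have hinr : fderiv ℝ Φ p₀ ∘L .inr ℝ (ℝ × V) C(unitInterval, V) = .id ℝ _ := by
    have h1 : HasFDerivAt (fun γ => Φ ((0, v₀), γ))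
        (fderiv ℝ Φ p₀ ∘L .inr ℝ (ℝ × V) C(unitInterval, V)) (c v₀) :=
      ((hΦ.differentiable hn') p₀).hasFDerivAt.comp (c v₀) (hasFDerivAt_prodMk_right (0, v₀) (c v₀))
    have h2 : HasFDerivAt (fun γ => Φ ((0, v₀), γ)) (.id ℝ _) (c v₀) := by
      simpa [Φ] using (hasFDerivAt_id (𝕜 := ℝ) (c v₀)).sub_const (c v₀)
    exact h1.unique h2
  have hinv : (fderiv ℝ Φ p₀ ∘L .inr ℝ (ℝ × V) C(unitInterval, V)).IsInvertible := by
    rw [hinr]; exact ContinuousLinearMap.isInvertible_equiv (f := ContinuousLinearEquiv.refl ℝ _)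
  have hat : ContDiffAt ℝ ((n : ℕ∞) : WithTop ℕ∞) Φ p₀ := hΦ.contDiffAt
  have hψ := hat.contDiffAt_implicitFunction hn' hinv
  have hev := hat.eventually_apply_eq_iff_implicitFunction hn' hinv
  set ψ := hat.implicitFunction hn' hinv
  let ev : C(unitInterval, V) →L[ℝ] V := ContinuousMap.evalCLM ℝ 1
  refine ⟨fun p => ev (ψ p), ev.contDiff.contDiffAt.comp _ hψ, ?_⟩
  obtain ⟨ε, hε, hball⟩ := Metric.eventually_nhds_iff.1 hev
  refine ⟨ε, hε, fun s v hs hv ν hν0 hν hνε => ?_⟩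
  have hνc : ContinuousOn ν (Icc 0 1) := fun u hu => (hν u hu).continuousWithinAt
  let γ : C(unitInterval, V) := ⟨fun u => ν u, by
    exact continuousOn_iff_continuous_domRestrict.1 hνc⟩
  have hγ : dist ((s, v), γ) p₀ < ε := by
    refine max_lt (max_lt ?_ ?_) ?_
    · simpa [p₀] using hs
    · simpa [p₀, dist_eq_norm] using hv
    · rw [dist_eq_norm]
      exact (ContinuousMap.norm_lt_iff _ hε).2 fun u => hνε u u.2
  have h0 : Φ ((s, v), γ) = Φ p₀ := by
    rw [hΦ0]
    ext u
    have hint : ∀ r ∈ Icc (0 : ℝ) 1, (projIcc (0 : ℝ) 1 zero_le_one r : ℝ) = r := fun r hr => by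
      rw [projIcc_of_mem _ hr]
    have hFν : ContinuousOn (fun r => F (ν r)) (Icc 0 1) := hF.continuous.comp_continuousOn hνc
    have hsub : Icc (0 : ℝ) u ⊆ Icc 0 1 := Icc_subset_Icc_right u.2.2
    have hFTC : ∫ r in (0 : ℝ)..u, s • F (ν r) = ν u - ν 0 := by
      refine intervalIntegral.integral_eq_sub_of_hasDerivAt_of_le u.2.1 (hνc.mono hsub)
        (fun r hr => (hν r ⟨hr.1.le, hr.2.le.trans u.2.2⟩).hasDerivAt
          (Icc_mem_nhds hr.1 (hr.2.trans_le u.2.2))) ?_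
      refine ContinuousOn.intervalIntegrable_of_Icc u.2.1 ?_
      exact continuousOn_const.smul (hFν.mono hsub)
    have hcongr : ∫ r in (0 : ℝ)..u, F (ν (projIcc (0 : ℝ) 1 zero_le_one r)) =
        ∫ r in (0 : ℝ)..u, F (ν r) := by
      refine intervalIntegral.integral_congr fun r hr => ?_
      rw [uIcc_of_le u.2.1] at hr
      simp only [hint r (hsub hr)]
    change ν u - v - s • (∫ r in (0 : ℝ)..u, F (ν (projIcc (0 : ℝ) 1 zero_le_one r))) = 0
    rw [hcongr, ← intervalIntegral.integral_smul, hFTC, hν0, sub_self]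
  have h1 := (hball hγ).1 h0
  change ν 1 = ev (ψ (s, v))
  rw [h1]
  rfl

/-- A map that is `C^n` at a point of a finite-dimensional space agrees near this point
with a map that is `C^n` everywhere. -/
theorem exists_contDiff_eventuallyEq {n : ℕ} {V W : Type*} [NormedAddCommGroup V] [NormedSpace ℝ V]
    [FiniteDimensional ℝ V] [NormedAddCommGroup W] [NormedSpace ℝ W] {f : V → W} {v : V}
    (hf : ContDiffAt ℝ n f v) : ∃ g : V → W, ContDiff ℝ n g ∧ g =ᶠ[𝓝 v] f := by
  obtain ⟨U, hU, hfU⟩ := hf.contDiffOn le_rfl (by simp)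
  obtain ⟨r, hr, hrU⟩ := Metric.mem_nhds_iff.1 hU
  let b : ContDiffBump v := ⟨r / 3, r / 2, by positivity, by linarith⟩
  refine ⟨fun x => b x • f x, contDiff_iff_contDiffAt.2 fun x => ?_, ?_⟩
  · by_cases hx : x ∈ Metric.ball v r
    · exact b.contDiffAt.smul (hfU.contDiffAt (Filter.mem_of_superset (Metric.isOpen_ball.mem_nhds hx) hrU))
    · have h0 : (fun x => b x • f x) =ᶠ[𝓝 x] fun _ => 0 := by
        have hx' : x ∈ (Metric.closedBall v (r / 2))ᶜ := fun h => hx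
          (Metric.closedBall_subset_ball (by linarith) h)
        filter_upwards [Metric.isClosed_closedBall.isOpen_compl.mem_nhds hx'] with y hy
        have hy' : r / 2 < dist y v := by simpa using hy
        rw [b.zero_of_le_dist hy'.le, zero_smul]
      exact contDiffAt_const.congr_of_eventuallyEq h0
  · filter_upwards [b.eventuallyEq_one] with x hx
    simp [hx]

end LocalFlow

/-! ### Local flows on a manifold -/

section FlowBox
universe u
variable {E : Type u} [NormedAddCommGroup E] [NormedSpace ℝ E]
  {M : Type*} [TopologicalSpace M] [ChartedSpace E M]

theorem HasVelocityWithin.continuousWithinAt {J : Set ℝ} {σ : ℝ → M} {t : ℝ}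
    {v : TangentSpace 𝓘(ℝ, E) (σ t)} (h : HasVelocityWithin J σ t v) : ContinuousWithinAt σ J t :=
  HasMFDerivWithinAt.continuousWithinAt h

theorem HasVelocityWithin.mono {J J' : Set ℝ} {σ : ℝ → M} {t : ℝ}
    {v : TangentSpace 𝓘(ℝ, E) (σ t)} (h : HasVelocityWithin J σ t v) (hJ : J' ⊆ J) :
    HasVelocityWithin J' σ t v :=
  HasMFDerivWithinAt.mono h hJ

/-- The velocity of a curve, read in a chart. -/
theorem HasVelocityWithin.hasDerivWithinAt_extChartAt [IsManifold 𝓘(ℝ, E) ∞ M] {J : Set ℝ}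
    {σ : ℝ → M} {t : ℝ} {v : TangentSpace 𝓘(ℝ, E) (σ t)} (h : HasVelocityWithin J σ t v) {x : M}
    (hx : σ t ∈ (chartAt E x).source) :
    HasDerivWithinAt (fun u => extChartAt 𝓘(ℝ, E) x (σ u))
      (mfderiv 𝓘(ℝ, E) 𝓘(ℝ, E) (extChartAt 𝓘(ℝ, E) x) (σ t) v : E) J t := by
  have h1 := (mdifferentiableAt_extChartAt (I := 𝓘(ℝ, E)) hx).hasMFDerivAt
  have h2 := HasMFDerivAt.comp_hasMFDerivWithinAt t h1 h
  let L : ℝ →L[ℝ] E := (mfderiv 𝓘(ℝ, E) 𝓘(ℝ, E) (extChartAt 𝓘(ℝ, E) x) (σ t)).comp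
    ((1 : ℝ →L[ℝ] ℝ).smulRight v)
  have h3 : HasFDerivWithinAt (fun u => extChartAt 𝓘(ℝ, E) x (σ u)) L J t := h2.hasFDerivWithinAt
  have h4 : L 1 = (mfderiv 𝓘(ℝ, E) 𝓘(ℝ, E) (extChartAt 𝓘(ℝ, E) x) (σ t)) v := by
    change (mfderiv 𝓘(ℝ, E) 𝓘(ℝ, E) (extChartAt 𝓘(ℝ, E) x) (σ t)) ((1 : ℝ) • v) = _
    rw [one_smul]
  rw [← h4]
  exact h3.hasDerivWithinAt

/-- Reparametrization of a curve by an affine map. -/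
theorem HasVelocityWithin.comp_affine {J J' : Set ℝ} {σ : ℝ → M} {a b u : ℝ}
    {v : TangentSpace 𝓘(ℝ, E) (σ (a + u * b))} (h : HasVelocityWithin J σ (a + u * b) v)
    (hJ : MapsTo (fun u => a + u * b) J' J) :
    HasVelocityWithin J' (fun u => σ (a + u * b)) u (b • v : TangentSpace 𝓘(ℝ, E) (σ (a + u * b))) := by
  have h1 : HasDerivWithinAt (fun u : ℝ => a + u * b) b J' u := by
    simpa using ((hasDerivAt_id u).mul_const b).const_add a |>.hasDerivWithinAt
  have h2 := HasMFDerivWithinAt.comp (f := fun u : ℝ => a + u * b) u h h1.hasFDerivWithinAt.hasMFDerivWithinAt hJ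
  refine HasMFDerivWithinAt.congr_mfderiv h2 ?_
  ext
  change ((1 : ℝ) • b) • v = (1 : ℝ) • (b • v)
  rw [one_smul, one_smul]

/-- Near every time in `D` and every point, the time dependent vector field `Y` agrees for times
in `D`, in coordinates, with a map that is `C^n` on a neighbourhood, also for times outside of `D`. This is
how regularity up to an endpoint of `D` enters the construction of flows. -/
def HasLocalExtensions (n : ℕ) (D : Set ℝ) (Y : ℝ → ∀ m : M, TangentSpace 𝓘(ℝ, E) m) : Prop :=
  ∀ t ∈ D, ∀ x : M, ∃ f : ℝ × E → E, ContDiffAt ℝ n f (t, extChartAt 𝓘(ℝ, E) x x) ∧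
    ∀ᶠ q : ℝ × M in 𝓝 (t, x), q.1 ∈ D →
      mfderiv 𝓘(ℝ, E) 𝓘(ℝ, E) (extChartAt 𝓘(ℝ, E) x) q.2 (Y q.1 q.2) =
        f (q.1, extChartAt 𝓘(ℝ, E) x q.2)

variable [FiniteDimensional ℝ E] [T2Space M] [IsManifold 𝓘(ℝ, E) ∞ M]

/-- Local flows on a manifold: there is a `C^n` map `Λ` such that short curves with velocity
`s Y_{t + c s u}` at time `u ∈ [0, 1]` end at `Λ (s, t, x)`, where `x` is their starting point.
The constant `c` covers evolution along `Y` (`c = 1`) as well as the flow of a single `Y t` (`c = 0`). -/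
theorem exists_flowBox {n : ℕ} (hn : n ≠ 0) {D : Set ℝ} {Y : ℝ → ∀ m : M, TangentSpace 𝓘(ℝ, E) m}
    (hY : HasLocalExtensions n D Y) (c : ℝ) {t₀ : ℝ} (ht₀ : t₀ ∈ D) (x₀ : M) :
    ∃ Λ : ℝ × (ℝ × M) → M, ∀ᶠ p : ℝ × (ℝ × M) in 𝓝 (0, (t₀, x₀)),
      ContMDiffAt (𝓘(ℝ, ℝ).prod (𝓘(ℝ, ℝ).prod 𝓘(ℝ, E))) 𝓘(ℝ, E) n Λ p ∧
      ∀ η : ℝ → M, η 0 = p.2.2 → (∀ u ∈ Icc (0 : ℝ) 1, p.2.1 + c * p.1 * u ∈ D) →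
        (∀ u ∈ Icc (0 : ℝ) 1, HasVelocityWithin (Icc 0 1) η u
          (p.1 • Y (p.2.1 + c * p.1 * u) (η u) : TangentSpace 𝓘(ℝ, E) (η u))) → η 1 = Λ p := by
  obtain ⟨f, hf, hfY⟩ := hY t₀ ht₀ x₀
  set χ := extChartAt 𝓘(ℝ, E) x₀ with hχ
  obtain ⟨F, hF, hFf⟩ := exists_contDiff_eventuallyEq
    (n := n) (f := fun w : ℝ × E => ((c, f w) : ℝ × E)) (contDiffAt_const.prodMk hf)
  obtain ⟨φ, hφ, ε, hε, hφu⟩ := exists_contDiffAt_localFlow hn hF (t₀, χ x₀)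
  have hχs : χ.source = (chartAt E x₀).source := extChartAt_source ..
  have hsymm : ContinuousAt χ.symm (χ x₀) := continuousAt_extChartAt_symm x₀
  -- all local conditions hold on a ball of radius `ρ` in `ℝ × E`
  have hev : ∀ᶠ w : ℝ × E in 𝓝 (t₀, χ x₀), (w.2 ∈ χ.target ∧ F w = (c, f w) ∧
      (w.1 ∈ D → mfderiv 𝓘(ℝ, E) 𝓘(ℝ, E) χ (χ.symm w.2) (Y w.1 (χ.symm w.2)) = f w)) ∧
      ‖F w‖ < ‖F (t₀, χ x₀)‖ + 1 := by
    have h1 : ∀ᶠ w : ℝ × E in 𝓝 (t₀, χ x₀), w.2 ∈ χ.target :=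
      continuousAt_snd.eventually (extChartAt_target_mem_nhds (I := 𝓘(ℝ, E)) x₀)
    have h2 : Filter.Tendsto (fun w : ℝ × E => (w.1, χ.symm w.2)) (𝓝 (t₀, χ x₀)) (𝓝 (t₀, x₀)) := by
      have h3 : ContinuousAt (fun w : ℝ × E => (w.1, χ.symm w.2)) (t₀, χ x₀) :=
        continuousAt_fst.prodMk (ContinuousAt.comp (f := Prod.snd) hsymm continuousAt_snd)
      simpa [ContinuousAt, hχ] using h3
    filter_upwards [h1, hFf, h2.eventually hfY,
      hF.continuous.norm.continuousAt.eventually_lt_const (lt_add_one _)] with w hw1 hw2 hw3 hw4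
    refine ⟨⟨hw1, hw2, fun hD => ?_⟩, hw4⟩
    have h5 := hw3 hD
    simp only [χ.right_inv hw1] at h5
    exact h5
  set C := ‖F (t₀, χ x₀)‖ + 1 with hC
  have hCpos : 0 < C := by positivity
  obtain ⟨ρ', hρ'pos, hρ'⟩ := Metric.eventually_nhds_iff_ball.1 hev
  set ρ := min ρ' ε with hρdef
  have hρ : 0 < ρ := lt_min hρ'pos hε
  have hball : ∀ w ∈ Metric.ball (t₀, χ x₀) ρ, _ :=
    fun w hw => hρ' w (Metric.ball_subset_ball (min_le_left _ _) hw)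
  refine ⟨fun p => χ.symm (φ (p.1, (p.2.1, χ p.2.2))).2, ?_⟩
  have hcurve : ContMDiffAt (𝓘(ℝ, ℝ).prod (𝓘(ℝ, ℝ).prod 𝓘(ℝ, E))) 𝓘(ℝ, ℝ × (ℝ × E)) n
      (fun p : ℝ × (ℝ × M) => (p.1, (p.2.1, χ p.2.2))) (0, (t₀, x₀)) := by
    refine contMDiffAt_fst.prodMk_space
      ((contMDiffAt_fst.comp _ contMDiffAt_snd).prodMk_space ?_)
    refine ContMDiffAt.comp (I' := 𝓘(ℝ, E)) _ ?_ (contMDiffAt_snd.comp _ contMDiffAt_snd)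
    exact contMDiffAt_extChartAt.of_le (by exact_mod_cast le_top)
  -- the value of the model flow at time zero, from a constant curve
  have hφ0 : φ (0, (t₀, χ x₀)) = (t₀, χ x₀) := by
    refine (hφu 0 (t₀, χ x₀) (by simpa) (by simpa) (fun _ => (t₀, χ x₀)) rfl (fun u _ => ?_)
      fun _ _ => by simpa).symm
    simpa using hasDerivWithinAt_const u (Icc (0 : ℝ) 1) (t₀, χ x₀)
  have hsm : ContMDiffAt (𝓘(ℝ, ℝ).prod (𝓘(ℝ, ℝ).prod 𝓘(ℝ, E))) 𝓘(ℝ, E) n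
      (fun p : ℝ × (ℝ × M) => χ.symm (φ (p.1, (p.2.1, χ p.2.2))).2) (0, (t₀, x₀)) := by
    have h1 : ContMDiffAt (𝓘(ℝ, ℝ).prod (𝓘(ℝ, ℝ).prod 𝓘(ℝ, E))) 𝓘(ℝ, E) n
        (fun p : ℝ × (ℝ × M) => (φ (p.1, (p.2.1, χ p.2.2))).2) (0, (t₀, x₀)) :=
      ContMDiffAt.comp (I' := 𝓘(ℝ, ℝ × (ℝ × E))) (g := fun w => (φ w).2) _
        (contDiffAt_snd.comp _ hφ).contMDiffAt hcurve
    refine ContMDiffAt.comp (I' := 𝓘(ℝ, E)) (g := χ.symm) _ ?_ h1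
    simp only [hφ0]
    exact ((contMDiffOn_extChartAt_symm (I := 𝓘(ℝ, E)) (n := ∞) x₀).contMDiffAt
      (extChartAt_target_mem_nhds x₀)).of_le (by exact_mod_cast le_top)
  have hsmall : ∀ᶠ p : ℝ × (ℝ × M) in 𝓝 (0, (t₀, x₀)), p.2.2 ∈ χ.source ∧
      |p.1| < min ε (ρ / 8 / C) ∧ ‖((p.2.1, χ p.2.2) : ℝ × E) - (t₀, χ x₀)‖ < ρ / 4 := by
    have hc1 : ContinuousAt (fun p : ℝ × (ℝ × M) => p.2.2) (0, (t₀, x₀)) := by fun_prop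
    have hc2 : ContinuousAt (fun p : ℝ × (ℝ × M) => ((p.2.1, χ p.2.2) : ℝ × E)) (0, (t₀, x₀)) :=
      ContinuousAt.prodMk (by fun_prop)
        (ContinuousAt.comp (g := χ) (continuousAt_extChartAt x₀) hc1)
    refine (hc1.eventually (extChartAt_source_mem_nhds (I := 𝓘(ℝ, E)) x₀)).and (Filter.Eventually.and ?_ ?_)
    · have : ContinuousAt (fun p : ℝ × (ℝ × M) => |p.1|) (0, (t₀, x₀)) := by fun_prop
      exact this.eventually_lt_const (show |(0 : ℝ)| < _ by
        rw [abs_zero]; exact lt_min hε (by positivity))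
    · have := hc2 (Metric.ball_mem_nhds _ (show 0 < ρ / 4 by positivity))
      filter_upwards [this] with p hp
      simpa [dist_eq_norm] using hp
  filter_upwards [(contMDiffAt_iff_contMDiffAt_nhds (by simp)).1 hsm, hsmall] with p hp1 ⟨hp2, hp3, hp4⟩
  refine ⟨hp1, fun η hη0 hD hη => ?_⟩
  obtain ⟨s, t, x⟩ := p
  simp only at hp2 hp3 hp4 hη0 hD hη ⊢
  have hηc : ContinuousOn η (Icc 0 1) := fun u hu => (hη u hu).continuousWithinAt
  set ν : ℝ → ℝ × E := fun u => (t + c * s * u, χ (η u)) with hν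
  have hν0 : ν 0 = (t, χ x) := by simp [hν, hη0]
  -- as long as the curve stays in the ball, it solves the equation of the model flow
  have hder : ∀ u ∈ Icc (0 : ℝ) 1, η u ∈ χ.source → ν u ∈ Metric.ball (t₀, χ x₀) ρ →
      HasDerivWithinAt ν (s • F (ν u)) (Icc 0 1) u := by
    intro u hu hus hub
    obtain ⟨⟨-, hFw, hYw⟩, -⟩ := hball _ hub
    rw [hFw, Prod.smul_mk]
    refine HasDerivWithinAt.prodMk ?_ ?_
    · simpa [mul_comm] using (((hasDerivAt_id u).const_mul (c * s)).const_add t).hasDerivWithinAt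
    · have h1 := (hη u hu).hasDerivWithinAt_extChartAt (x := x₀) (hχs ▸ hus)
      rw [map_smul] at h1
      have h2 := hYw (hD u hu)
      have h3 : χ.symm (ν u).2 = η u := χ.left_inv hus
      have h4 := (congrArg (fun z : M =>
        (mfderiv 𝓘(ℝ, E) 𝓘(ℝ, E) χ z (Y (t + c * s * u) z) : E)) h3).symm.trans h2
      rw [← h4]
      exact h1
  have hsC : |s| * C < ρ / 8 := by
    have := (lt_min_iff.1 hp3).2
    rwa [lt_div_iff₀ hCpos] at this
  have htime : ∀ u ∈ Icc (0 : ℝ) 1, |t + c * s * u - t₀| < ρ / 2 := by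
    intro u hu
    have hcC : |c| ≤ C := by
      have h1 := (hball (t₀, χ x₀) (Metric.mem_ball_self hρ)).1.2.1
      have h2 : ‖c‖ ≤ ‖F (t₀, χ x₀)‖ := by rw [h1]; exact norm_fst_le (c, f (t₀, χ x₀))
      rw [Real.norm_eq_abs] at h2
      linarith
    have h1 : |t - t₀| < ρ / 4 := (norm_fst_le (((t, χ x) : ℝ × E) - (t₀, χ x₀))).trans_lt hp4
    have h2 : |c * s * u| ≤ |s| * C := by
      rw [abs_mul, abs_mul, mul_comm |c|, abs_of_nonneg hu.1]
      calc |s| * |c| * u ≤ |s| * |c| * 1 := by gcongr; exact hu.2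
        _ ≤ |s| * C := by rw [mul_one]; gcongr
    calc |t + c * s * u - t₀| = |(t - t₀) + c * s * u| := by ring_nf
      _ ≤ |t - t₀| + |c * s * u| := abs_add_le _ _
      _ < ρ / 2 := by linarith
  -- the curve does not leave the ball: consider the first exit time
  set O : Set M := χ.symm '' Metric.ball (χ x₀) (ρ / 2) with hO
  have htarget : ∀ y ∈ Metric.ball (χ x₀) ρ, y ∈ χ.target := fun y hy =>
    (hball (t₀, y) (by
      rw [Metric.mem_ball]; exact max_lt (by simpa using hρ) hy)).1.1
  have hOopen : IsOpen O := by
    have : O = χ.source ∩ χ ⁻¹' Metric.ball (χ x₀) (ρ / 2) := by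
      rw [hO, χ.symm_image_eq_source_inter_preimage]
      exact fun y hy => htarget y (Metric.ball_subset_ball (by linarith) hy)
    rw [this]
    exact (continuousOn_extChartAt x₀).isOpen_inter_preimage (isOpen_extChartAt_source x₀)
      Metric.isOpen_ball
  have hOgood : ∀ u ∈ Icc (0 : ℝ) 1, η u ∈ O → η u ∈ χ.source ∧ ‖ν u - (t₀, χ x₀)‖ < ρ := by
    rintro u hu ⟨y, hy, hyu⟩
    have hyt := htarget y (Metric.ball_subset_ball (by linarith) hy)
    refine ⟨hyu ▸ χ.map_target hyt, ?_⟩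
    simp only [hν, ← hyu, χ.right_inv hyt, Prod.mk_sub_mk, Prod.norm_mk, Real.norm_eq_abs]
    exact max_lt ((htime u hu).trans (by linarith)) (by
      rw [← dist_eq_norm]; exact (Metric.mem_ball.1 hy).trans (by linarith))
  have hstay : ∀ u ∈ Icc (0 : ℝ) 1, η u ∈ O := by
    by_contra! hex
    set B := Icc (0 : ℝ) 1 ∩ η ⁻¹' Oᶜ with hB
    have hBc : IsClosed B := hηc.preimage_isClosed_of_isClosed isClosed_Icc hOopen.isClosed_compl
    have hBne : B.Nonempty := let ⟨u, hu, huO⟩ := hex; ⟨u, hu, huO⟩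
    have hBbd : BddBelow B := ⟨0, fun u hu => hu.1.1⟩
    have hu₀ : sInf B ∈ B := hBc.csInf_mem hBne hBbd
    set u₀ := sInf B
    have hbefore : ∀ u ∈ Icc (0 : ℝ) 1, u < u₀ → η u ∈ O := fun u hu hlt => by
      by_contra h
      exact absurd (csInf_le hBbd ⟨hu, h⟩) (not_le.2 hlt)
    have hx0 : ‖χ x - χ x₀‖ < ρ / 4 := (norm_snd_le (((t, χ x) : ℝ × E) - (t₀, χ x₀))).trans_lt hp4
    have hu₀pos : 0 < u₀ := by
      refine lt_of_le_of_ne hu₀.1.1 fun h0 => hu₀.2 ?_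
      rw [← h0, hη0]
      exact ⟨χ x, by rw [Metric.mem_ball, dist_eq_norm]; linarith, χ.left_inv hp2⟩
    have hclosed : IsClosed (χ.symm '' Metric.closedBall (χ x₀) (3 * ρ / 8)) := by
      refine IsCompact.isClosed ((isCompact_closedBall _ _).image_of_continuousOn ?_)
      exact (continuousOn_extChartAt_symm x₀).mono fun y hy =>
        htarget y (Metric.closedBall_subset_ball (by linarith) hy)
    have hlim : ∀ u ∈ Ico 0 u₀, η u ∈ χ.symm '' Metric.closedBall (χ x₀) (3 * ρ / 8) := by
      intro u hu
      have hu1 : u ∈ Icc (0 : ℝ) 1 := ⟨hu.1, hu.2.le.trans hu₀.1.2⟩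
      have hsub : Icc 0 u ⊆ Icc (0 : ℝ) 1 := Icc_subset_Icc_right hu1.2
      have hin : ∀ r ∈ Icc 0 u, η r ∈ χ.source ∧ ‖ν r - (t₀, χ x₀)‖ < ρ := fun r hr =>
        hOgood r (hsub hr) (hbefore r (hsub hr) (hr.2.trans_lt hu.2))
      have hmv := norm_image_sub_le_of_norm_deriv_le_segment' (f := ν) (a := 0) (b := u)
        (f' := fun r => s • F (ν r)) (C := |s| * C)
        (fun r hr => (hder r (hsub hr) (hin r hr).1
          (by rw [Metric.mem_ball, dist_eq_norm]; exact (hin r hr).2)).mono hsub)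
        (fun r hr => by
          rw [norm_smul, Real.norm_eq_abs]
          have h := (hball (ν r) (by
            rw [Metric.mem_ball, dist_eq_norm]; exact (hin r ⟨hr.1, hr.2.le⟩).2)).2.le
          gcongr)
        u ⟨hu.1, le_rfl⟩
      have h2 : ‖χ (η u) - χ x‖ ≤ |s| * C := by
        have h3 : ‖χ (η u) - χ x‖ ≤ ‖ν u - ν 0‖ := by
          rw [hν0]; exact norm_snd_le (ν u - (t, χ x))
        refine h3.trans (hmv.trans ?_)
        rw [sub_zero]
        exact mul_le_of_le_one_right (by positivity) hu1.2
      refine ⟨χ (η u), ?_, χ.left_inv (hin u ⟨hu.1, le_rfl⟩).1⟩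
      rw [Metric.mem_closedBall, dist_eq_norm]
      calc ‖χ (η u) - χ x₀‖ = ‖(χ (η u) - χ x) + (χ x - χ x₀)‖ := by rw [sub_add_sub_cancel]
        _ ≤ ‖χ (η u) - χ x‖ + ‖χ x - χ x₀‖ := norm_add_le _ _
        _ ≤ 3 * ρ / 8 := by linarith
    have hmem : η u₀ ∈ χ.symm '' Metric.closedBall (χ x₀) (3 * ρ / 8) := by
      have hcl : u₀ ∈ closure (Ico 0 u₀) := by
        rw [closure_Ico hu₀pos.ne]; exact ⟨hu₀pos.le, le_rfl⟩
      have h1 : ContinuousWithinAt η (Ico 0 u₀) u₀ := (hηc u₀ hu₀.1).mono fun u hu =>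
        ⟨hu.1, hu.2.le.trans hu₀.1.2⟩
      have h2 := h1.mem_closure hcl hlim
      rwa [hclosed.closure_eq] at h2
    refine hu₀.2 (image_mono ?_ hmem)
    exact Metric.closedBall_subset_ball (by linarith)
  have hfinal := hφu s (t, χ x) (lt_min_iff.1 hp3).1 (hp4.trans_le (by
      have : ρ ≤ ε := min_le_right _ _
      linarith)) ν hν0
    (fun u hu => hder u hu (hOgood u hu (hstay u hu)).1 (by
      rw [Metric.mem_ball, dist_eq_norm]; exact (hOgood u hu (hstay u hu)).2))
    (fun u hu => (hOgood u hu (hstay u hu)).2.trans_le (min_le_right _ _))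
  rw [← hfinal]
  exact (χ.left_inv (hOgood 1 (by simp) (hstay 1 (by simp))).1).symm

end FlowBox

/-! ### Dependence of solutions on parameters -/

section Evolution
universe u
variable {E : Type u} [NormedAddCommGroup E] [NormedSpace ℝ E] [FiniteDimensional ℝ E]
  {M : Type*} [TopologicalSpace M] [ChartedSpace E M] [T2Space M] [IsManifold 𝓘(ℝ, E) ∞ M]
  {EP : Type*} [NormedAddCommGroup EP] [NormedSpace ℝ EP] {HP : Type*} [TopologicalSpace HP]
  {IP : ModelWithCorners ℝ EP HP} {P : Type*} [TopologicalSpace P] [ChartedSpace HP P]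

omit [FiniteDimensional ℝ E] [T2Space M] [IsManifold 𝓘(ℝ, E) ∞ M] in
/-- A piece of an evolution curve, rescaled to `[0, 1]`, is an evolution curve. -/
theorem hasVelocityWithin_rescale {Y : ℝ → ∀ m : M, TangentSpace 𝓘(ℝ, E) m} {c a S : ℝ} {σ : ℝ → M}
    (hσ : ∀ u ∈ Icc (0 : ℝ) 1, HasVelocityWithin (Icc 0 1) σ u
      (S • Y (a + c * S * u) (σ u) : TangentSpace 𝓘(ℝ, E) (σ u)))
    {s' s : ℝ} (hs' : s' ∈ Icc (0 : ℝ) 1) (hs : s ∈ Icc (0 : ℝ) 1) {u : ℝ} (hu : u ∈ Icc (0 : ℝ) 1) :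
    HasVelocityWithin (Icc 0 1) (fun u => σ (s' + u * (s - s'))) u
      (((s - s') * S) • Y (a + c * S * s' + c * ((s - s') * S) * u) (σ (s' + u * (s - s'))) :
        TangentSpace 𝓘(ℝ, E) (σ (s' + u * (s - s')))) := by
  have hmaps : MapsTo (fun u => s' + u * (s - s')) (Icc (0 : ℝ) 1) (Icc 0 1) := fun u hu => by
    have : s' + u * (s - s') = (1 - u) • s' + u • s := by simp only [smul_eq_mul]; ring
    simp only [this]
    exact convex_Icc (0 : ℝ) 1 hs' hs (by linarith [hu.2]) hu.1 (by ring)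
  have h := (hσ _ (hmaps hu)).comp_affine hmaps
  have h1 : a + c * S * s' + c * ((s - s') * S) * u = a + c * S * (s' + u * (s - s')) := by ring
  rw [h1, mul_smul]
  exact h

/-- **Smooth dependence on parameters.** If the starting point, the starting time and the length of
evolution curves depend `C^n` on a parameter, then so does each later point. The set of good
times is relatively open and closed, by the local flows. -/
theorem contMDiffWithinAt_evolution {n : ℕ} (hn : n ≠ 0) {D : Set ℝ}
    {Y : ℝ → ∀ m : M, TangentSpace 𝓘(ℝ, E) m} (hY : HasLocalExtensions n D Y) (c : ℝ)
    {Q : Set P} {q₀ : P} (hq₀ : q₀ ∈ Q) {S a : P → ℝ} {G : ℝ → P → M}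
    (hS : ContMDiffWithinAt IP 𝓘(ℝ, ℝ) n S Q q₀) (ha : ContMDiffWithinAt IP 𝓘(ℝ, ℝ) n a Q q₀)
    (hG₀ : ContMDiffWithinAt IP 𝓘(ℝ, E) n (G 0) Q q₀)
    (hD : ∀ q ∈ Q, ∀ u ∈ Icc (0 : ℝ) 1, a q + c * S q * u ∈ D)
    (hG : ∀ q ∈ Q, ∀ u ∈ Icc (0 : ℝ) 1, HasVelocityWithin (Icc 0 1) (fun u => G u q) u
      (S q • Y (a q + c * S q * u) (G u q) : TangentSpace 𝓘(ℝ, E) (G u q)))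
    {u : ℝ} (hu : u ∈ Icc (0 : ℝ) 1) : ContMDiffWithinAt IP 𝓘(ℝ, E) n (G u) Q q₀ := by
  refine isPreconnected_Icc.induction₂' (s := Icc (0 : ℝ) 1)
    (fun s' s => ContMDiffWithinAt IP 𝓘(ℝ, E) n (G s') Q q₀ →
      ContMDiffWithinAt IP 𝓘(ℝ, E) n (G s) Q q₀) ?_ (fun _ _ _ _ _ _ h h' => h' ∘ h)
    (by simp) hu hG₀
  intro s₀ hs₀
  obtain ⟨Λ, hΛ⟩ := exists_flowBox hn hY c (hD q₀ hq₀ s₀ hs₀) (G s₀ q₀)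
  -- the data of the piece from `s'` to `s`, as a function of the parameter
  let p : ℝ → ℝ → P → ℝ × (ℝ × M) := fun s' s q =>
    ((s - s') * S q, (a q + c * S q * s', G s' q))
  have hcontG : ContinuousWithinAt (fun s => G s q₀) (Icc 0 1) s₀ :=
    (hG q₀ hq₀ s₀ hs₀).continuousWithinAt
  have hp₁ : Filter.Tendsto (fun s => p s₀ s q₀) (𝓝[Icc 0 1] s₀)
      (𝓝 (0, (a q₀ + c * S q₀ * s₀, G s₀ q₀))) := by
    have h1 : ContinuousWithinAt (fun s => p s₀ s q₀) (Icc 0 1) s₀ :=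
      ContinuousWithinAt.prodMk (by fun_prop) (ContinuousWithinAt.prodMk (by fun_prop)
        continuousWithinAt_const)
    simpa [ContinuousWithinAt, p] using h1
  have hp₂ : Filter.Tendsto (fun s => p s s₀ q₀) (𝓝[Icc 0 1] s₀)
      (𝓝 (0, (a q₀ + c * S q₀ * s₀, G s₀ q₀))) := by
    have h1 : ContinuousWithinAt (fun s => p s s₀ q₀) (Icc 0 1) s₀ :=
      ContinuousWithinAt.prodMk (by fun_prop) (ContinuousWithinAt.prodMk (by fun_prop) hcontG)
    simpa [ContinuousWithinAt, p] using h1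
  have step : ∀ s' ∈ Icc (0 : ℝ) 1, ∀ s ∈ Icc (0 : ℝ) 1,
      (∀ᶠ w in 𝓝 (p s' s q₀), ContMDiffAt (𝓘(ℝ, ℝ).prod (𝓘(ℝ, ℝ).prod 𝓘(ℝ, E))) 𝓘(ℝ, E) n Λ w ∧
        ∀ η : ℝ → M, η 0 = w.2.2 → (∀ u ∈ Icc (0 : ℝ) 1, w.2.1 + c * w.1 * u ∈ D) →
          (∀ u ∈ Icc (0 : ℝ) 1, HasVelocityWithin (Icc 0 1) η u
          (w.1 • Y (w.2.1 + c * w.1 * u) (η u) : TangentSpace 𝓘(ℝ, E) (η u))) → η 1 = Λ w) →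
      ContMDiffWithinAt IP 𝓘(ℝ, E) n (G s') Q q₀ → ContMDiffWithinAt IP 𝓘(ℝ, E) n (G s) Q q₀ := by
    intro s' hs' s hs hw hsm
    have hpsm : ContMDiffWithinAt IP (𝓘(ℝ, ℝ).prod (𝓘(ℝ, ℝ).prod 𝓘(ℝ, E))) n (p s' s) Q q₀ := by
      refine ContMDiffWithinAt.prodMk ?_ (ContMDiffWithinAt.prodMk ?_ hsm)
      · exact contMDiffWithinAt_const.mul hS
      · exact ha.add ((contMDiffWithinAt_const.mul hS).mul contMDiffWithinAt_const)
    have hΛsm := ContMDiffAt.comp_contMDiffWithinAt q₀ hw.self_of_nhds.1 hpsm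
    refine hΛsm.congr_of_eventuallyEq_of_mem ?_ hq₀
    filter_upwards [hpsm.continuousWithinAt.eventually hw, self_mem_nhdsWithin] with q hq hqQ
    have := hq.2 (fun u => G (s' + u * (s - s')) q) (by simp [p]) (fun u hu => ?_)
      (fun u hu => hasVelocityWithin_rescale (hG q hqQ) hs' hs hu)
    · simpa using this
    · have h1 : a q + c * S q * s' + c * ((s - s') * S q) * u =
          a q + c * S q * (s' + u * (s - s')) := by ring
      simp only [p, h1]
      refine hD q hqQ _ ?_
      have : s' + u * (s - s') = (1 - u) • s' + u • s := by simp only [smul_eq_mul]; ring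
      rw [this]
      exact convex_Icc (0 : ℝ) 1 hs' hs (by linarith [hu.2]) hu.1 (by ring)
  filter_upwards [hp₁.eventually hΛ.eventually_nhds, hp₂.eventually hΛ.eventually_nhds,
    self_mem_nhdsWithin] with s h1 h2 hs
  exact ⟨step s₀ hs₀ s hs h1, step s hs s₀ hs₀ h2⟩

/-- Evolution curves with the same starting point agree. -/
theorem evolution_unique {D : Set ℝ}
    {Y : ℝ → ∀ m : M, TangentSpace 𝓘(ℝ, E) m} (hY : HasLocalExtensions 1 D Y) (c : ℝ)
    {S a : ℝ} {σ τ : ℝ → M} (h0 : σ 0 = τ 0)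
    (hD : ∀ u ∈ Icc (0 : ℝ) 1, a + c * S * u ∈ D)
    (hσ : ∀ u ∈ Icc (0 : ℝ) 1, HasVelocityWithin (Icc 0 1) σ u
      (S • Y (a + c * S * u) (σ u) : TangentSpace 𝓘(ℝ, E) (σ u)))
    (hτ : ∀ u ∈ Icc (0 : ℝ) 1, HasVelocityWithin (Icc 0 1) τ u
      (S • Y (a + c * S * u) (τ u) : TangentSpace 𝓘(ℝ, E) (τ u)))
    {u : ℝ} (hu : u ∈ Icc (0 : ℝ) 1) : σ u = τ u := by
  refine isPreconnected_Icc.induction₂' (s := Icc (0 : ℝ) 1)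
    (fun s' s => σ s' = τ s' → σ s = τ s) ?_ (fun _ _ _ _ _ _ h h' => h' ∘ h) (by simp) hu h0
  intro s₀ hs₀
  obtain ⟨Λ, hΛ⟩ := exists_flowBox one_ne_zero hY c (hD s₀ hs₀) (σ s₀)
  let p : ℝ → ℝ → ℝ × (ℝ × M) := fun s' s => ((s - s') * S, (a + c * S * s', σ s'))
  have hp₁ : Filter.Tendsto (fun s => p s₀ s) (𝓝[Icc 0 1] s₀)
      (𝓝 (0, (a + c * S * s₀, σ s₀))) := by
    have h1 : ContinuousWithinAt (fun s => p s₀ s) (Icc 0 1) s₀ :=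
      ContinuousWithinAt.prodMk (by fun_prop) (ContinuousWithinAt.prodMk (by fun_prop)
        continuousWithinAt_const)
    simpa [ContinuousWithinAt, p] using h1
  have hp₂ : Filter.Tendsto (fun s => p s s₀) (𝓝[Icc 0 1] s₀)
      (𝓝 (0, (a + c * S * s₀, σ s₀))) := by
    have h1 : ContinuousWithinAt (fun s => p s s₀) (Icc 0 1) s₀ :=
      ContinuousWithinAt.prodMk (by fun_prop) (ContinuousWithinAt.prodMk (by fun_prop)
        (hσ s₀ hs₀).continuousWithinAt)
    simpa [ContinuousWithinAt, p] using h1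
  have step : ∀ s' ∈ Icc (0 : ℝ) 1, ∀ s ∈ Icc (0 : ℝ) 1,
      (∀ η : ℝ → M, η 0 = (p s' s).2.2 → (∀ u ∈ Icc (0 : ℝ) 1, (p s' s).2.1 + c * (p s' s).1 * u ∈ D) →
          (∀ u ∈ Icc (0 : ℝ) 1, HasVelocityWithin (Icc 0 1) η u
          ((p s' s).1 • Y ((p s' s).2.1 + c * (p s' s).1 * u) (η u) : TangentSpace 𝓘(ℝ, E) (η u))) →
          η 1 = Λ (p s' s)) → σ s' = τ s' → σ s = τ s := by
    intro s' hs' s hs hw heq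
    have hD' : ∀ u ∈ Icc (0 : ℝ) 1, (p s' s).2.1 + c * (p s' s).1 * u ∈ D := fun u hu => by
      have h1 : a + c * S * s' + c * ((s - s') * S) * u =
          a + c * S * (s' + u * (s - s')) := by ring
      simp only [p, h1]
      refine hD _ ?_
      have : s' + u * (s - s') = (1 - u) • s' + u • s := by simp only [smul_eq_mul]; ring
      rw [this]
      exact convex_Icc (0 : ℝ) 1 hs' hs (by linarith [hu.2]) hu.1 (by ring)
    have h1 := hw (fun u => σ (s' + u * (s - s'))) (by simp [p]) hD'
      (fun u hu => hasVelocityWithin_rescale hσ hs' hs hu)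
    have h2 := hw (fun u => τ (s' + u * (s - s'))) (by simp [p, heq]) hD'
      (fun u hu => hasVelocityWithin_rescale hτ hs' hs hu)
    simpa using h1.trans h2.symm
  filter_upwards [hp₁.eventually hΛ, hp₂.eventually hΛ, self_mem_nhdsWithin] with s h1 h2 hs
  exact ⟨step s₀ hs₀ s hs h1.2, step s hs s₀ hs₀ h2.2⟩

end Evolution

/-! ### Extension of time dependent fields beyond their time interval -/

section Extension
universe u

/-- A map that is smooth on `[0, T] × U` extends to a `C^1` map on `ℝ × U`, affine in time outside of
`[0, T]`. -/
theorem exists_contDiffOn_one_extension {E W : Type*} [NormedAddCommGroup E] [NormedSpace ℝ E]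
    [NormedAddCommGroup W] [NormedSpace ℝ W] {T : ℝ} (hT : 0 < T) {U : Set E} (hU : IsOpen U)
    {f : ℝ × E → W} (hf : ContDiffOn ℝ ∞ f (Icc 0 T ×ˢ U)) :
    ∃ g : ℝ × E → W, ContDiffOn ℝ 1 g (univ ×ˢ U) ∧ EqOn g f (Icc 0 T ×ˢ U) := by
  set s : Set (ℝ × E) := Icc 0 T ×ˢ U with hs
  have hsu : UniqueDiffOn ℝ s := (uniqueDiffOn_Icc hT).prod hU.uniqueDiffOn
  set k : ℝ → ℝ := fun t => projIcc 0 T hT.le t with hk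
  have hkc : Continuous k := continuous_subtype_val.comp continuous_projIcc
  have hks : ∀ t, k t ∈ Icc 0 T := fun t => (projIcc 0 T hT.le t).2
  set Df := fderivWithin ℝ f s with hDf
  have hDfs : ContDiffOn ℝ ∞ Df s := hf.fderivWithin hsu (by simp)
  set h : ℝ × E → W := fun w => Df w (1, 0) with hh
  have hhs : ContDiffOn ℝ ∞ h s := hDfs.clm_apply contDiffOn_const
  set Dh := fderivWithin ℝ h s with hDh
  have hDhs : ContDiffOn ℝ ∞ Dh s := hhs.fderivWithin hsu (by simp)
  have hdf : ∀ w ∈ s, HasFDerivWithinAt f (Df w) s w := fun w hw =>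
    (hf.differentiableOn (by simp) w hw).hasFDerivWithinAt
  have hdh : ∀ w ∈ s, HasFDerivWithinAt h (Dh w) s w := fun w hw =>
    (hhs.differentiableOn (by simp) w hw).hasFDerivWithinAt
  set g : ℝ × E → W := fun w => f (k w.1, w.2) + (w.1 - k w.1) • h (k w.1, w.2) with hg
  let ι : (ℝ × E) →L[ℝ] (ℝ × E) := (ContinuousLinearMap.inr ℝ ℝ E).comp (.snd ℝ ℝ E)
  set Dg : ℝ × E → (ℝ × E) →L[ℝ] W := fun w =>
    Df (k w.1, w.2) + (w.1 - k w.1) • (Dh (k w.1, w.2)).comp ι with hDg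
  have hkmap : MapsTo (fun w : ℝ × E => (k w.1, w.2)) (univ ×ˢ U) s := fun w hw => ⟨hks _, hw.2⟩
  have hkcont : Continuous fun w : ℝ × E => (k w.1, w.2) := by fun_prop
  have hDgc : ContinuousOn Dg (univ ×ˢ U) := by
    refine (hDfs.continuousOn.comp hkcont.continuousOn hkmap).add (ContinuousOn.smul
      (continuous_fst.sub (hkc.comp continuous_fst)).continuousOn ?_)
    exact (hDhs.continuousOn.comp hkcont.continuousOn hkmap).clm_comp continuousOn_const
  -- the affine pieces, with `r` an endpoint of `[0, T]`
  have haff : ∀ r ∈ Icc 0 T, ∀ C ⊆ {w : ℝ × E | k w.1 = r} ∩ univ ×ˢ U, ∀ w ∈ C,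
      HasFDerivWithinAt g (Dg w) C w := by
    intro r hr C hC w hw
    have hrw : (r, w.2) ∈ s := ⟨hr, (hC hw).2.2⟩
    have hι : HasFDerivWithinAt (fun w : ℝ × E => (r, w.2)) ι C w := by
      have := ((hasFDerivAt_const r w).prodMk (hasFDerivAt_snd (𝕜 := ℝ) (p := w))).hasFDerivWithinAt
        (s := C)
      exact this
    have hm : MapsTo (fun w : ℝ × E => (r, w.2)) C s := fun w hw => ⟨hr, (hC hw).2.2⟩
    have h1 := (hdf _ hrw).comp w hι hm
    have h2 := (hdh _ hrw).comp w hι hm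
    have h3 : HasFDerivWithinAt (fun w : ℝ × E => w.1 - r) (.fst ℝ ℝ E) C w :=
      (hasFDerivAt_fst.sub_const r).hasFDerivWithinAt
    have h4 := h1.add (h3.smul h2)
    have hkw : k w.1 = r := (hC hw).1
    refine (h4.congr_fderiv ?_).congr (fun w hw => ?_) ?_
    · refine ContinuousLinearMap.ext fun v => ?_
      have hv : Df (r, w.2) v = Df (r, w.2) (0, v.2) + v.1 • h (r, w.2) := by
        rw [hh, ← map_smul, ← map_add]; simp
      simp only [hDg, hkw, add_apply, ContinuousLinearMap.comp_apply, smul_apply, hv,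
        ContinuousLinearMap.smulRight_apply, Function.comp_apply]
      simp only [ι, ContinuousLinearMap.comp_apply, ContinuousLinearMap.coe_snd',
        ContinuousLinearMap.coe_fst', ContinuousLinearMap.inr_apply]
      abel
    · have : k w.1 = r := (hC hw).1
      simp [hg, this]
    · simp [hg, hkw]
  have hk1 : ∀ t ≤ 0, k t = 0 := fun t ht => by simp [hk, projIcc_of_le_left hT.le ht]
  have hk2 : ∀ t ∈ Icc 0 T, k t = t := fun t ht => by simp [hk, projIcc_of_mem hT.le ht]
  have hk3 : ∀ t ≥ T, k t = T := fun t ht => by simp [hk, projIcc_of_right_le hT.le ht]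
  have hgf : EqOn g f s := fun w hw => by
    simp [hg, hk2 w.1 hw.1]
  have hO : IsOpen ((univ : Set ℝ) ×ˢ U) := isOpen_univ.prod hU
  have hder : ∀ w ∈ (univ : Set ℝ) ×ˢ U, HasFDerivWithinAt g (Dg w) (univ ×ˢ U) w := by
    intro w hw
    have hcl : ∀ C : Set ℝ, IsClosed C → w.1 ∉ C → w ∉ closure (C ×ˢ U) := fun C hC hwC h => by
      rw [closure_prod_eq, hC.closure_eq] at h
      exact hwC h.1
    have h1 : HasFDerivWithinAt g (Dg w) (Iic 0 ×ˢ U) w := by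
      by_cases h : w.1 ∈ Iic (0 : ℝ)
      · exact haff 0 (by simp [hT.le]) _ (fun w hw => ⟨hk1 _ hw.1, mem_univ _, hw.2⟩) w ⟨h, hw.2⟩
      · exact HasFDerivWithinAt.of_notMem_closure (hcl _ isClosed_Iic h)
    have h2 : HasFDerivWithinAt g (Dg w) (Icc 0 T ×ˢ U) w := by
      by_cases h : w.1 ∈ Icc 0 T
      · have hws : w ∈ s := ⟨h, hw.2⟩
        refine ((hdf w hws).congr_fderiv ?_).congr hgf (hgf hws)
        simp [hDg, hk2 _ h]
      · exact HasFDerivWithinAt.of_notMem_closure (hcl _ isClosed_Icc h)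
    have h3 : HasFDerivWithinAt g (Dg w) (Ici T ×ˢ U) w := by
      by_cases h : w.1 ∈ Ici T
      · exact haff T (by simp [hT.le]) _ (fun w hw => ⟨hk3 _ hw.1, mem_univ _, hw.2⟩) w ⟨h, hw.2⟩
      · exact HasFDerivWithinAt.of_notMem_closure (hcl _ isClosed_Ici h)
    have h4 := (h1.union h2).union h3
    rwa [← union_prod, ← union_prod, Iic_union_Icc_eq_Iic hT.le, Iic_union_Ici] at h4
  refine ⟨g, ?_, hgf⟩
  have h := (contDiffOn_succ_iff_hasFDerivWithinAt_of_uniqueDiffOn (n := 0)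
    hO.uniqueDiffOn (f := g) (𝕜 := ℝ)).2
    ⟨by simp, Dg, contDiffOn_zero.2 hDgc, hder⟩
  simpa using h

variable {E : Type u} [NormedAddCommGroup E] [NormedSpace ℝ E]
  {M : Type*} [TopologicalSpace M] [ChartedSpace E M] [IsManifold 𝓘(ℝ, E) ∞ M]

/-- The trivialization of the tangent bundle at `x` is the derivative of the chart at `x`. -/
theorem trivializationAt_snd_eq_mfderiv {x m : M} (hm : m ∈ (chartAt E x).source)
    (v : TangentSpace 𝓘(ℝ, E) m) :
    (trivializationAt E (TangentSpace 𝓘(ℝ, E)) x (⟨m, v⟩ : TangentBundle 𝓘(ℝ, E) M)).2 =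
      mfderiv 𝓘(ℝ, E) 𝓘(ℝ, E) (extChartAt 𝓘(ℝ, E) x) m v := by
  have h := TangentBundle.continuousLinearMapAt_trivializationAt (I := 𝓘(ℝ, E)) (M := M) hm
  have h2 : (trivializationAt E (TangentSpace 𝓘(ℝ, E)) x).continuousLinearMapAt ℝ m v = _ :=
    congrFun (congrArg DFunLike.coe h) v
  refine Eq.trans ?_ h2
  rw [Trivialization.continuousLinearMapAt_apply,
    Trivialization.coe_linearMapAt_of_mem _ (by simpa using hm)]

/-- A time dependent vector field, read in the chart at `x`, as a function of time and of the
coordinates. It is meaningful on the target of the chart only. -/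
def fieldInChart (x : M) (Y : ℝ → ∀ m : M, TangentSpace 𝓘(ℝ, E) m) (w : ℝ × E) : E :=
  mfderiv 𝓘(ℝ, E) 𝓘(ℝ, E) (extChartAt 𝓘(ℝ, E) x) ((extChartAt 𝓘(ℝ, E) x).symm w.2)
    (Y w.1 ((extChartAt 𝓘(ℝ, E) x).symm w.2))

omit [IsManifold 𝓘(ℝ, E) ∞ M] in
theorem fieldInChart_extChartAt {x m : M} (hm : m ∈ (chartAt E x).source)
    (Y : ℝ → ∀ m : M, TangentSpace 𝓘(ℝ, E) m) (t : ℝ) :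
    fieldInChart x Y (t, extChartAt 𝓘(ℝ, E) x m) =
      mfderiv 𝓘(ℝ, E) 𝓘(ℝ, E) (extChartAt 𝓘(ℝ, E) x) m (Y t m) :=
  congrArg (fun z : M => (mfderiv 𝓘(ℝ, E) 𝓘(ℝ, E) (extChartAt 𝓘(ℝ, E) x) z (Y t z) : E))
    ((extChartAt 𝓘(ℝ, E) x).left_inv (by rwa [extChartAt_source]))

theorem IsSmoothTimeField.contDiffOn_fieldInChart {J : Set ℝ}
    {Y : ℝ → ∀ m : M, TangentSpace 𝓘(ℝ, E) m} (hY : IsSmoothTimeField J Y) (x : M) :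
    ContDiffOn ℝ ∞ (fieldInChart x Y) (J ×ˢ (extChartAt 𝓘(ℝ, E) x).target) := by
  set χ := extChartAt 𝓘(ℝ, E) x with hχ
  have h1 : ContMDiffOn 𝓘(ℝ, ℝ × E) (𝓘(ℝ, ℝ).prod 𝓘(ℝ, E)) ∞
      (fun w : ℝ × E => (w.1, χ.symm w.2)) (J ×ˢ χ.target) := by
    refine ContMDiffOn.prodMk contDiff_fst.contMDiff.contMDiffOn ?_
    exact (contMDiffOn_extChartAt_symm x).comp contDiff_snd.contMDiff.contMDiffOn fun w hw => hw.2
  have h2 := ContMDiffOn.comp hY h1 fun w hw => ⟨hw.1, mem_univ _⟩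
  have h3 := ((trivializationAt E (TangentSpace 𝓘(ℝ, E)) x).contMDiffOn_iff (IB := 𝓘(ℝ, E)) (n := ∞)
    (IM := 𝓘(ℝ, ℝ × E)) (s := J ×ˢ χ.target)
    (f := (fun p : ℝ × M => (⟨p.2, Y p.1 p.2⟩ : TangentBundle 𝓘(ℝ, E) M)) ∘
      fun w : ℝ × E => (w.1, χ.symm w.2)) (fun w hw => by
      simpa [hχ] using χ.map_target hw.2)).1 h2
  refine (contMDiffOn_iff_contDiffOn.1 h3.2).congr fun w hw => ?_
  refine (trivializationAt_snd_eq_mfderiv ?_ _).symm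
  rw [← extChartAt_source 𝓘(ℝ, E)]
  exact χ.map_target hw.2

omit [IsManifold 𝓘(ℝ, E) ∞ M] in
theorem hasLocalExtensions_of_contDiffAt {n : ℕ} {D : Set ℝ}
    {Y : ℝ → ∀ m : M, TangentSpace 𝓘(ℝ, E) m}
    (h : ∀ t ∈ D, ∀ x : M, ∃ f : ℝ × E → E, ContDiffAt ℝ n f (t, extChartAt 𝓘(ℝ, E) x x) ∧
      EqOn f (fieldInChart x Y) (D ×ˢ (extChartAt 𝓘(ℝ, E) x).target)) :
    HasLocalExtensions n D Y := by
  intro t ht x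
  obtain ⟨f, hf, hfY⟩ := h t ht x
  refine ⟨f, hf, ?_⟩
  have h1 : ∀ᶠ q : ℝ × M in 𝓝 (t, x), q.2 ∈ (chartAt E x).source :=
    continuousAt_snd.eventually ((chartAt E x).open_source.mem_nhds (mem_chart_source E x))
  filter_upwards [h1] with q hq hqD
  rw [← fieldInChart_extChartAt hq]
  exact (hfY ⟨hqD, (extChartAt 𝓘(ℝ, E) x).map_source (by rwa [extChartAt_source])⟩).symm

/-- On `[0, T]` only `C^1` extensions are provided, which suffices for `C^1` flows up to the endpoints. -/
theorem IsSmoothTimeField.hasLocalExtensions_Icc {T : ℝ} (hT : 0 < T)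
    {Y : ℝ → ∀ m : M, TangentSpace 𝓘(ℝ, E) m} (hY : IsSmoothTimeField (Icc 0 T) Y) :
    HasLocalExtensions 1 (Icc 0 T) Y := by
  refine hasLocalExtensions_of_contDiffAt fun t ht x => ?_
  obtain ⟨g, hg, hgf⟩ := exists_contDiffOn_one_extension hT
    (isOpen_extChartAt_target x) (hY.contDiffOn_fieldInChart x)
  refine ⟨g, ?_, hgf⟩
  exact_mod_cast hg.contDiffAt ((isOpen_univ.prod (isOpen_extChartAt_target x)).mem_nhds
    ⟨mem_univ _, mem_extChartAt_target x⟩)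

theorem IsSmoothTimeField.hasLocalExtensions_of_isOpen (n : ℕ) {D : Set ℝ} (hD : IsOpen D)
    {Y : ℝ → ∀ m : M, TangentSpace 𝓘(ℝ, E) m} (hY : IsSmoothTimeField D Y) :
    HasLocalExtensions n D Y := by
  refine hasLocalExtensions_of_contDiffAt fun t ht x => ⟨fieldInChart x Y, ?_, fun _ _ => rfl⟩
  exact ((hY.contDiffOn_fieldInChart x).contDiffAt ((hD.prod (isOpen_extChartAt_target x)).mem_nhds
    ⟨ht, mem_extChartAt_target x⟩)).of_le (by exact_mod_cast le_top)

theorem IsSmoothTimeField.mono {J J' : Set ℝ} {Y : ℝ → ∀ m : M, TangentSpace 𝓘(ℝ, E) m}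
    (hY : IsSmoothTimeField J Y) (h : J' ⊆ J) : IsSmoothTimeField J' Y :=
  ContMDiffOn.mono hY (prod_mono_left h)

/-- The members of a smoothly varying family of vector fields are smooth. -/
theorem IsSmoothTimeField.isSmoothField {J : Set ℝ} {Y : ℝ → ∀ m : M, TangentSpace 𝓘(ℝ, E) m}
    (hY : IsSmoothTimeField J Y) {t : ℝ} (ht : t ∈ J) : IsSmoothField (Y t) := by
  have h : ContMDiff 𝓘(ℝ, E) (𝓘(ℝ, ℝ).prod 𝓘(ℝ, E)) ∞ (fun m : M => (t, m)) :=
    contMDiff_const.prodMk contMDiff_id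
  exact contMDiffOn_univ.1 (ContMDiffOn.comp hY h.contMDiffOn fun m _ => ⟨ht, mem_univ _⟩)

/-- A smooth vector field is smooth as a constant family. -/
theorem IsSmoothField.isSmoothTimeField {Y : ∀ m : M, TangentSpace 𝓘(ℝ, E) m}
    (hY : IsSmoothField Y) (J : Set ℝ) : IsSmoothTimeField J fun _ => Y :=
  (ContMDiff.comp (I := 𝓘(ℝ, ℝ).prod 𝓘(ℝ, E)) hY contMDiff_snd).contMDiffOn

end Extension

/-! ### Flows of complete fields -/

section FlowProperties
universe u
variable {E : Type u} [NormedAddCommGroup E] [NormedSpace ℝ E]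
  {M : Type*} [TopologicalSpace M] [ChartedSpace E M]
  {J : Set ℝ} {Y : ℝ → ∀ m : M, TangentSpace 𝓘(ℝ, E) m}

theorem IsCompleteField.isFlowLine_flow (h : IsCompleteField J Y) {s : ℝ} (hs : s ∈ J) (m : M) :
    IsFlowLine J Y s m fun t => flow J Y t s m := by
  have hex := h s hs m
  have : (fun t => flow J Y t s m) = hex.choose := by
    funext t
    simp only [flow, dif_pos hex]
  rw [this]
  exact hex.choose_spec

theorem flow_self (h : IsCompleteField J Y) {s : ℝ} (hs : s ∈ J) (m : M) : flow J Y s s m = m :=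
  (h.isFlowLine_flow hs m).1

theorem IsFlowLine.hasVelocityWithin_rescale {s : ℝ} {m : M} {σ : ℝ → M}
    (hσ : IsFlowLine J Y s m σ) (hJ : Convex ℝ J) {r t : ℝ} (hr : r ∈ J) (ht : t ∈ J) {u : ℝ}
    (hu : u ∈ Icc (0 : ℝ) 1) :
    HasVelocityWithin (Icc 0 1) (fun u => σ (r + u * (t - r))) u
      ((t - r) • Y (r + 1 * (t - r) * u) (σ (r + u * (t - r))) :
        TangentSpace 𝓘(ℝ, E) (σ (r + u * (t - r)))) := by
  have hmaps : MapsTo (fun u => r + u * (t - r)) (Icc (0 : ℝ) 1) J := fun u hu => by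
    have : r + u * (t - r) = (1 - u) • r + u • t := by simp only [smul_eq_mul]; ring
    simp only [this]
    exact hJ hr ht (by linarith [hu.2]) hu.1 (by ring)
  have h := (hσ.2 _ (hmaps hu)).comp_affine hmaps
  have h1 : r + 1 * (t - r) * u = r + u * (t - r) := by ring
  rw [h1]
  exact h

theorem convex_rescale_mem (hJ : Convex ℝ J) {r t : ℝ} (hr : r ∈ J) (ht : t ∈ J) {u : ℝ}
    (hu : u ∈ Icc (0 : ℝ) 1) : r + 1 * (t - r) * u ∈ J := by
  have : r + 1 * (t - r) * u = (1 - u) • r + u • t := by simp only [smul_eq_mul]; ring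
  rw [this]
  exact hJ hr ht (by linarith [hu.2]) hu.1 (by ring)

theorem HasVelocityWithin.comp_of_eq_affine {J' : Set ℝ} {σ : ℝ → M} {g : ℝ → ℝ} {a b u : ℝ}
    {v : TangentSpace 𝓘(ℝ, E) (σ (g u))} (h : HasVelocityWithin J σ (g u) v)
    (hJ : MapsTo g J' J) (hg : g = fun u => a + u * b) :
    HasVelocityWithin J' (fun u => σ (g u)) u (b • v : TangentSpace 𝓘(ℝ, E) (σ (g u))) := by
  subst hg
  exact h.comp_affine hJ

theorem IsFlowLine.shift {Y : ∀ m : M, TangentSpace 𝓘(ℝ, E) m} {r : ℝ} {m : M} {σ : ℝ → M}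
    (hσ : IsFlowLine univ (fun _ => Y) r m σ) (s : ℝ) :
    IsFlowLine univ (fun _ => Y) 0 (σ s) fun t => σ (s + t) := by
  refine ⟨by simp, fun t _ => ?_⟩
  have h := HasVelocityWithin.comp_of_eq_affine (g := fun t => s + t) (a := s) (b := 1) (u := t)
    (J' := univ) (hσ.2 (s + t) (mem_univ _)) (mapsTo_univ _ _) (by simp)
  rwa [one_smul] at h

variable [FiniteDimensional ℝ E] [T2Space M] [IsManifold 𝓘(ℝ, E) ∞ M]

/-- Two solutions that agree at one time agree at all times. -/
theorem IsFlowLine.eq_of_mem (hJ : Convex ℝ J) (hY : HasLocalExtensions 1 J Y) {s : ℝ} (hs : s ∈ J)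
    {m : M} {σ τ : ℝ → M} (hσ : IsFlowLine J Y s m σ) (hτ : IsFlowLine J Y s m τ) {t : ℝ}
    (ht : t ∈ J) : σ t = τ t := by
  have h := evolution_unique hY 1 (S := t - s) (a := s) (σ := fun u => σ (s + u * (t - s)))
    (τ := fun u => τ (s + u * (t - s))) (by simp [hσ.1, hτ.1])
    (fun u hu => convex_rescale_mem hJ hs ht hu)
    (fun u hu => hσ.hasVelocityWithin_rescale hJ hs ht hu)
    (fun u hu => hτ.hasVelocityWithin_rescale hJ hs ht hu) (u := 1) (by simp)
  simpa using h

theorem IsFlowLine.eq_flow (hJ : Convex ℝ J) (hY : HasLocalExtensions 1 J Y)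
    (hc : IsCompleteField J Y) {s : ℝ} (hs : s ∈ J)
    {m : M} {σ : ℝ → M} (hσ : IsFlowLine J Y s m σ) {t : ℝ} (ht : t ∈ J) :
    σ t = flow J Y t s m :=
  hσ.eq_of_mem hJ hY hs (hc.isFlowLine_flow hs m) ht

/-- The cocycle identity `μ_{t,r} ∘ μ_{r,s} = μ_{t,s}`. -/
theorem flow_flow (hJ : Convex ℝ J) (hY : HasLocalExtensions 1 J Y)
    (hc : IsCompleteField J Y) {t r s : ℝ} (ht : t ∈ J) (hr : r ∈ J) (hs : s ∈ J) (m : M) :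
    flow J Y t r (flow J Y r s m) = flow J Y t s m := by
  have h := hc.isFlowLine_flow hs m
  exact (IsFlowLine.eq_flow hJ hY hc hr (σ := fun t => flow J Y t s m) ⟨rfl, h.2⟩ ht).symm

/-- Joint smoothness of the flow `(t, s, m) ↦ μ_{t,s}(m)` over a time interval `D` on which the field
has `C^n` local extensions. -/
theorem contMDiffOn_flow {n : ℕ} (hn : n ≠ 0) (hc : IsCompleteField J Y) (hJ : Convex ℝ J) {D : Set ℝ}
    (hD : Convex ℝ D) (hDJ : D ⊆ J) (hY : HasLocalExtensions n D Y) :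
    ContMDiffOn (𝓘(ℝ, ℝ).prod (𝓘(ℝ, ℝ).prod 𝓘(ℝ, E))) 𝓘(ℝ, E) n
      (fun q : ℝ × (ℝ × M) => flow J Y q.1 q.2.1 q.2.2) (D ×ˢ (D ×ˢ univ)) := by
  intro q₀ hq₀
  have h := contMDiffWithinAt_evolution (IP := 𝓘(ℝ, ℝ).prod (𝓘(ℝ, ℝ).prod 𝓘(ℝ, E))) hn hY 1 hq₀
    (S := fun q : ℝ × (ℝ × M) => q.1 - q.2.1) (a := fun q => q.2.1)
    (G := fun u q => flow J Y (q.2.1 + u * (q.1 - q.2.1)) q.2.1 q.2.2)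
    (contMDiffWithinAt_fst.sub (contMDiffWithinAt_fst.comp q₀ contMDiffWithinAt_snd (mapsTo_univ _ _)))
    (contMDiffWithinAt_fst.comp q₀ contMDiffWithinAt_snd (mapsTo_univ _ _)) ?_
    (fun q hq u hu => convex_rescale_mem hD hq.2.1 hq.1 hu) ?_ (u := 1) (by simp)
  · simpa using h
  · refine ContMDiffWithinAt.congr_of_mem (f := fun q : ℝ × (ℝ × M) => q.2.2)
      (contMDiffWithinAt_snd.comp q₀ contMDiffWithinAt_snd (mapsTo_univ _ _)) (fun q hq => ?_) hq₀
    simp [flow_self hc (hDJ hq.2.1)]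
  · intro q hq u hu
    exact (hc.isFlowLine_flow (hDJ hq.2.1) q.2.2).hasVelocityWithin_rescale hJ (hDJ hq.2.1)
      (hDJ hq.1) hu

section Autonomous
variable {Z : ∀ m : M, TangentSpace 𝓘(ℝ, E) m}

omit [FiniteDimensional ℝ E] [T2Space M] in
theorem IsSmoothField.hasLocalExtensions (hZ : IsSmoothField Z) (n : ℕ) :
    HasLocalExtensions n univ fun _ => Z :=
  (hZ.isSmoothTimeField univ).hasLocalExtensions_of_isOpen n isOpen_univ

omit [FiniteDimensional ℝ E] [T2Space M] [IsManifold 𝓘(ℝ, E) ∞ M] in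
theorem isFlowLine_expFlow (hc : IsCompleteField univ fun _ => Z) (m : M) :
    IsFlowLine univ (fun _ => Z) 0 m fun t => expFlow t Z m :=
  hc.isFlowLine_flow (mem_univ 0) m

omit [FiniteDimensional ℝ E] [T2Space M] [IsManifold 𝓘(ℝ, E) ∞ M] in
@[simp] theorem expFlow_zero (hc : IsCompleteField univ fun _ => Z) (m : M) : expFlow 0 Z m = m :=
  (isFlowLine_expFlow hc m).1

/-- The group law of the flow of a complete vector field. -/
theorem expFlow_expFlow (hZ : IsSmoothField Z) (hc : IsCompleteField univ fun _ => Z) (s r : ℝ)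
    (m : M) : expFlow s Z (expFlow r Z m) = expFlow (r + s) Z m :=
  (((isFlowLine_expFlow hc m).shift r).eq_flow convex_univ (hZ.hasLocalExtensions 1) hc (mem_univ 0)
    (mem_univ s)).symm

theorem contMDiff_expFlow (hZ : IsSmoothField Z) (hc : IsCompleteField univ fun _ => Z) :
    ContMDiff (𝓘(ℝ, ℝ).prod 𝓘(ℝ, E)) 𝓘(ℝ, E) ∞ (fun q : ℝ × M => expFlow q.1 Z q.2) := by
  rw [contMDiff_infty]
  intro n
  have h : ContMDiff (𝓘(ℝ, ℝ).prod 𝓘(ℝ, E)) 𝓘(ℝ, E) ((n + 1 : ℕ) : ℕ∞)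
      (fun q : ℝ × M => expFlow q.1 Z q.2) := by
    have h1 := contMDiffOn_flow n.succ_ne_zero hc convex_univ convex_univ (subset_refl _)
      (hZ.hasLocalExtensions (n + 1))
    simp only [univ_prod_univ, contMDiffOn_univ] at h1
    exact h1.comp (contMDiff_fst.prodMk (contMDiff_const.prodMk contMDiff_snd))
  exact h.of_le (by exact_mod_cast Nat.le_succ n)

/-- Joint smoothness of `(t, s, m) ↦ e^{s Z_t}(m)` for a family of complete vector fields. -/
theorem contMDiffOn_expFlow_family {n : ℕ} (hn : n ≠ 0) {D : Set ℝ}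
    {Z : ℝ → ∀ m : M, TangentSpace 𝓘(ℝ, E) m} (hZ : HasLocalExtensions n D Z)
    (hc : ∀ t ∈ D, IsCompleteField univ fun _ => Z t) :
    ContMDiffOn (𝓘(ℝ, ℝ).prod (𝓘(ℝ, ℝ).prod 𝓘(ℝ, E))) 𝓘(ℝ, E) n
      (fun q : ℝ × (ℝ × M) => expFlow q.2.1 (Z q.1) q.2.2) (D ×ˢ univ) := by
  intro q₀ hq₀
  have h := contMDiffWithinAt_evolution (IP := 𝓘(ℝ, ℝ).prod (𝓘(ℝ, ℝ).prod 𝓘(ℝ, E))) hn hZ 0 hq₀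
    (S := fun q : ℝ × (ℝ × M) => q.2.1) (a := fun q => q.1)
    (G := fun u q => expFlow (u * q.2.1) (Z q.1) q.2.2)
    (contMDiffWithinAt_fst.comp q₀ contMDiffWithinAt_snd (mapsTo_univ _ _))
    contMDiffWithinAt_fst ?_
    (fun q hq u hu => by simpa using hq.1) ?_ (u := 1) (by simp)
  · simpa using h
  · refine ContMDiffWithinAt.congr_of_mem (f := fun q : ℝ × (ℝ × M) => q.2.2)
      (contMDiffWithinAt_snd.comp q₀ contMDiffWithinAt_snd (mapsTo_univ _ _)) (fun q hq => ?_) hq₀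
    simp [expFlow_zero (hc q.1 hq.1)]
  · intro q hq u hu
    have h := HasVelocityWithin.comp_of_eq_affine (g := fun u => u * q.2.1) (a := 0) (b := q.2.1)
      (u := u) (J' := Icc (0 : ℝ) 1)
      ((isFlowLine_expFlow (hc q.1 hq.1) q.2.2).2 (u * q.2.1) (mem_univ _)) (mapsTo_univ _ _)
      (by simp)
    simpa using h

end Autonomous
end FlowProperties

/-! ### Tangent maps of families -/

section TangentMaps
universe u
variable {E : Type u} [NormedAddCommGroup E] [NormedSpace ℝ E]
  {M : Type*} [TopologicalSpace M] [ChartedSpace E M] [IsManifold 𝓘(ℝ, E) ∞ M]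
  {F : Type*} [NormedAddCommGroup F] [NormedSpace ℝ F]

/-- The derivative in the manifold variable of a map that depends on a parameter is jointly regular
in the parameter and the tangent vector. -/
theorem contMDiffOn_tangentMap_slice {k n : WithTop ℕ∞} {D : Set F} (hD : UniqueDiffOn ℝ D)
    {Φ : F × M → M} (hΦ : ContMDiffOn (𝓘(ℝ, F).prod 𝓘(ℝ, E)) 𝓘(ℝ, E) n Φ (D ×ˢ univ))
    (hkn : k + 1 ≤ n) :
    ContMDiffOn (𝓘(ℝ, F).prod 𝓘(ℝ, E).tangent) 𝓘(ℝ, E).tangent k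
      (fun q : F × TangentBundle 𝓘(ℝ, E) M =>
        (⟨Φ (q.1, q.2.1), mfderiv 𝓘(ℝ, E) 𝓘(ℝ, E) (fun x => Φ (q.1, x)) q.2.1 q.2.2⟩ :
          TangentBundle 𝓘(ℝ, E) M)) (D ×ˢ univ) := by
  have : IsManifold 𝓘(ℝ, E) 1 M := .of_le (n := ∞) (by simp)
  have hun : UniqueMDiffOn (𝓘(ℝ, F).prod 𝓘(ℝ, E)) (D ×ˢ (univ : Set M)) :=
    hD.uniqueMDiffOn.prod uniqueMDiffOn_univ
  have h1 := hΦ.contMDiffOn_tangentMapWithin hkn hun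
  have h2 : ContMDiff (𝓘(ℝ, F).prod 𝓘(ℝ, E).tangent) (𝓘(ℝ, F).prod 𝓘(ℝ, E)).tangent k
      (fun q : F × TangentBundle 𝓘(ℝ, E) M => (equivTangentBundleProd 𝓘(ℝ, F) F 𝓘(ℝ, E) M).symm
        (zeroSection F (TangentSpace 𝓘(ℝ, F)) q.1, q.2)) := by
    refine contMDiff_equivTangentBundleProd_symm.comp ?_
    exact ((contMDiff_zeroSection ℝ (TangentSpace 𝓘(ℝ, F))).comp contMDiff_fst).prodMk contMDiff_snd
  refine (h1.comp h2.contMDiffOn (fun q hq => ⟨hq.1, mem_univ _⟩)).congr fun q hq => ?_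
  have hq' : ((q.1, q.2.1) : F × M) ∈ D ×ˢ (univ : Set M) := ⟨hq.1, mem_univ _⟩
  have hd : MDifferentiableWithinAt (𝓘(ℝ, F).prod 𝓘(ℝ, E)) 𝓘(ℝ, E) Φ (D ×ˢ univ) (q.1, q.2.1) :=
    (hΦ _ hq').mdifferentiableWithinAt (fun h => by rw [h] at hkn; simp at hkn)
  have hs : HasMFDerivAt 𝓘(ℝ, E) (𝓘(ℝ, F).prod 𝓘(ℝ, E)) (fun x : M => (q.1, x)) q.2.1
      ((0 : E →L[ℝ] F).prod (ContinuousLinearMap.id ℝ E)) :=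
    (hasMFDerivAt_const q.1 q.2.1).prodMk (hasMFDerivAt_id q.2.1)
  have h3 := (hd.hasMFDerivWithinAt.comp q.2.1 (hs.hasMFDerivWithinAt (s := univ))
    (fun x _ => ⟨hq.1, mem_univ _⟩)).hasMFDerivAt Filter.univ_mem
  have h4 := h3.mfderiv
  refine congrArg (fun v : E => (⟨Φ (q.1, q.2.1), v⟩ : TangentBundle 𝓘(ℝ, E) M)) ?_
  exact congrFun (congrArg DFunLike.coe h4) q.2.2

end TangentMaps

/-! ### Integrals and time derivatives of families of fields -/

section AveragedFields
universe u
variable {E : Type u} [NormedAddCommGroup E] [NormedSpace ℝ E]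
  {M : Type*} [TopologicalSpace M] [ChartedSpace E M]

/-- Integrals over `[0, 1]` of maps that depend smoothly on a parameter are smooth in the parameter:
the integral is a continuous operator applied to a superposition operator. -/
theorem ContDiff.integral_zero_one [FiniteDimensional ℝ E] {W : Type u} [NormedAddCommGroup W]
    [NormedSpace ℝ W] [CompleteSpace W] {n : ℕ∞} {f : ℝ × E → W} (hf : ContDiff ℝ n f) :
    ContDiff ℝ n (fun y => ∫ s in (0 : ℝ)..1, f (s, y)) := by
  let ι : C(unitInterval, ℝ × E) := ⟨fun u => (u, 0), by fun_prop⟩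
  let A : E →ₗ[ℝ] C(unitInterval, ℝ × E) :=
    { toFun := fun y => ContinuousMap.const _ (0, y)
      map_add' := fun _ _ => by ext <;> simp
      map_smul' := fun _ _ => by ext <;> simp }
  have hA : ContDiff ℝ n A := (LinearMap.toContinuousLinearMap A).contDiff
  have h1 : ContDiff ℝ n fun y => primitiveCLM W
      ((⟨f, hf.continuous⟩ : C(ℝ × E, W)).comp (ι + A y)) :=
    (primitiveCLM W).contDiff.comp
      ((contDiff_comp_continuousMap (K := unitInterval) hf).comp (contDiff_const.add hA))
  have h2 := (ContinuousMap.evalCLM ℝ (1 : unitInterval) (M := W)).contDiff.comp h1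
  have h3 : (fun y => ∫ s in (0 : ℝ)..1, f (s, y)) = fun y => primitiveCLM W
      ((⟨f, hf.continuous⟩ : C(ℝ × E, W)).comp (ι + A y)) 1 := by
    funext y
    rw [primitiveCLM_apply]
    refine intervalIntegral.integral_congr fun s hs => ?_
    rw [uIcc_of_le zero_le_one] at hs
    simp [ι, A, projIcc_of_mem zero_le_one hs]
  rw [h3]
  exact h2

theorem ContDiffOn.integral_zero_one [FiniteDimensional ℝ E] {W : Type u} [NormedAddCommGroup W]
    [NormedSpace ℝ W] [CompleteSpace W] {n : ℕ∞} {f : ℝ × E → W} {U : Set E} (hU : IsOpen U)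
    (hf : ContDiffOn ℝ n f (univ ×ˢ U)) :
    ContDiffOn ℝ n (fun y => ∫ s in (0 : ℝ)..1, f (s, y)) U := by
  intro y hy
  obtain ⟨ρ, hρ, hρU⟩ := Metric.nhds_basis_closedBall.mem_iff.1 (hU.mem_nhds hy)
  let φ : ContDiffBump y := ⟨ρ / 2, ρ, by positivity, by linarith⟩
  have hg : ContDiff ℝ n fun w : ℝ × E => φ w.2 • f w := by
    refine contDiff_iff_contDiffAt.2 fun w => ?_
    by_cases hw : w.2 ∈ U
    · exact (φ.contDiff.contDiffAt.comp w contDiffAt_snd).smul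
        (hf.contDiffAt ((isOpen_univ.prod hU).mem_nhds ⟨mem_univ _, hw⟩))
    · have h1 : ∀ᶠ z : ℝ × E in 𝓝 w, z.2 ∈ (tsupport φ)ᶜ := by
        refine continuousAt_snd.eventually ((isClosed_tsupport φ).isOpen_compl.mem_nhds fun h => hw ?_)
        rw [φ.tsupport_eq] at h
        exact hρU h
      refine (contDiffAt_const (c := (0 : W))).congr_of_eventuallyEq ?_
      filter_upwards [h1] with z hz
      rw [image_eq_zero_of_notMem_tsupport hz, zero_smul]
  refine (hg.integral_zero_one.contDiffAt.congr_of_eventuallyEq ?_).contDiffWithinAt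
  filter_upwards [φ.eventuallyEq_one] with z hz
  simp [hz]

variable [IsManifold 𝓘(ℝ, E) ∞ M]

/-- A time dependent field is smooth if it is smooth in all charts. -/
theorem isSmoothTimeField_of_fieldInChart {J : Set ℝ} {Y : ℝ → ∀ m : M, TangentSpace 𝓘(ℝ, E) m}
    (h : ∀ x : M, ContDiffOn ℝ ∞ (fieldInChart x Y) (J ×ˢ (extChartAt 𝓘(ℝ, E) x).target)) :
    IsSmoothTimeField J Y := by
  intro p hp
  refine Bundle.contMDiffWithinAt_totalSpace.2 ⟨contMDiffWithinAt_snd, ?_⟩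
  set χ := extChartAt 𝓘(ℝ, E) p.2 with hχ
  have hs : ∀ᶠ q : ℝ × M in 𝓝[J ×ˢ univ] p, q.2 ∈ (chartAt E p.2).source :=
    nhdsWithin_le_nhds (continuousAt_snd.eventually
      ((chartAt E p.2).open_source.mem_nhds (mem_chart_source E p.2)))
  have h1 : ContMDiffWithinAt 𝓘(ℝ, ℝ × E) 𝓘(ℝ, E) ∞ (fieldInChart p.2 Y) (J ×ˢ χ.target)
      (p.1, χ p.2) :=
    (h p.2 _ ⟨hp.1, mem_extChartAt_target p.2⟩).contMDiffWithinAt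
  have h2 : ContMDiffWithinAt (𝓘(ℝ, ℝ).prod 𝓘(ℝ, E)) 𝓘(ℝ, ℝ × E) ∞
      (fun q : ℝ × M => (q.1, χ q.2)) (J ×ˢ univ) p :=
    contMDiffWithinAt_fst.prodMk_space
      ((contMDiffAt_extChartAt (I := 𝓘(ℝ, E)) (x := p.2)).comp p contMDiffAt_snd).contMDiffWithinAt
  have h3 : Filter.Tendsto (fun q : ℝ × M => (q.1, χ q.2)) (𝓝[J ×ˢ univ] p)
      (𝓝[J ×ˢ χ.target] (p.1, χ p.2)) := by
    refine tendsto_nhdsWithin_iff.2 ⟨h2.continuousWithinAt, ?_⟩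
    filter_upwards [hs, self_mem_nhdsWithin] with q hq hqJ
    exact ⟨hqJ.1, χ.map_source (by rwa [hχ, extChartAt_source])⟩
  refine (ContMDiffWithinAt.mono_of_mem_nhdsWithin (ContMDiffWithinAt.comp' p h1 h2)
    (Filter.inter_mem self_mem_nhdsWithin
      (h3 self_mem_nhdsWithin))).congr_of_eventuallyEq_of_mem ?_ hp
  filter_upwards [hs] with q hq
  rw [Function.comp_apply, fieldInChart_extChartAt hq]
  exact trivializationAt_snd_eq_mfderiv hq _

/-- The derivative at `m` of the chart at `x`, as an endomorphism of the model space `E`, to which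
`T_m M` reduces by definition. -/
def chartDeriv (E : Type u) [NormedAddCommGroup E] [NormedSpace ℝ E] {M : Type*}
    [TopologicalSpace M] [ChartedSpace E M] (x m : M) : E →L[ℝ] E :=
  mfderiv 𝓘(ℝ, E) 𝓘(ℝ, E) (extChartAt 𝓘(ℝ, E) x) m

theorem isInvertible_chartDeriv {x m : M} (hm : m ∈ (chartAt E x).source) :
    (chartDeriv E x m).IsInvertible := by
  have : IsManifold 𝓘(ℝ, E) 1 M := .of_le (n := ∞) (by simp)
  exact isInvertible_mfderiv_extChartAt (I := 𝓘(ℝ, E)) (x := x) (y := m)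
    (by rwa [extChartAt_source])

theorem inverse_chartDeriv_apply {x m : M} (hm : m ∈ (chartAt E x).source) (v : E) :
    (chartDeriv E x m).inverse (chartDeriv E x m v) = v := by
  rw [← ContinuousLinearMap.comp_apply, (isInvertible_chartDeriv hm).inverse_comp_self]
  rfl

theorem chartDeriv_inverse_apply {x m : M} (hm : m ∈ (chartAt E x).source) (v : E) :
    chartDeriv E x m ((chartDeriv E x m).inverse v) = v := by
  rw [← ContinuousLinearMap.comp_apply, (isInvertible_chartDeriv hm).self_comp_inverse]
  rfl

/-- The value of a field at a point, recovered from its representation in a chart. -/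
theorem inverse_fieldInChart {x m : M} (hm : m ∈ (chartAt E x).source)
    (Y : ℝ → ∀ m : M, TangentSpace 𝓘(ℝ, E) m) (t : ℝ) :
    (chartDeriv E x m).inverse (fieldInChart x Y (t, extChartAt 𝓘(ℝ, E) x m)) = Y t m := by
  rw [fieldInChart_extChartAt hm]
  exact inverse_chartDeriv_apply hm (Y t m)

theorem IsSmoothTimeField.continuousOn_apply {J : Set ℝ} {Y : ℝ → ∀ m : M, TangentSpace 𝓘(ℝ, E) m}
    (hY : IsSmoothTimeField J Y) (m : M) : ContinuousOn (Y := E) (fun t => Y t m) J := by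
  have h : ContinuousOn (fun t => (chartDeriv E m m).inverse (fieldInChart m Y (t, extChartAt 𝓘(ℝ, E) m m))) J :=
    (chartDeriv E m m).inverse.continuous.comp_continuousOn ((hY.contDiffOn_fieldInChart m).continuousOn.comp (by fun_prop)
      fun t ht => ⟨ht, mem_extChartAt_target m⟩)
  exact h.congr fun t _ => (inverse_fieldInChart (mem_chart_source E m) Y t).symm

theorem IsSmoothTimeField.isSmoothField_integral [FiniteDimensional ℝ E]
    {Y : ℝ → ∀ m : M, TangentSpace 𝓘(ℝ, E) m} (hY : IsSmoothTimeField univ Y) :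
    IsSmoothField (E := E) (M := M) fun m =>
      (intervalIntegral (E := E) (fun s => Y s m) 0 1 volume : E) := by
  suffices h : IsSmoothTimeField (E := E) (M := M) univ fun _ m =>
      (intervalIntegral (E := E) (fun s => Y s m) 0 1 volume : E) from h.isSmoothField (mem_univ 0)
  refine isSmoothTimeField_of_fieldInChart fun x => ?_
  have h1 := (hY.contDiffOn_fieldInChart x).integral_zero_one (n := (⊤ : ℕ∞)) (isOpen_extChartAt_target x)
  refine (h1.comp (s := univ ×ˢ (extChartAt 𝓘(ℝ, E) x).target) (f := Prod.snd)
    contDiff_snd.contDiffOn fun w hw => hw.2).congr fun w hw => ?_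
  let L : E →L[ℝ] E := mfderiv 𝓘(ℝ, E) 𝓘(ℝ, E) (extChartAt 𝓘(ℝ, E) x)
    ((extChartAt 𝓘(ℝ, E) x).symm w.2)
  have hc : Continuous (Y := E) fun s => Y s ((extChartAt 𝓘(ℝ, E) x).symm w.2) :=
    continuousOn_univ.1 (hY.continuousOn_apply _)
  exact (L.intervalIntegral_comp_comm (hc.intervalIntegrable 0 1)).symm

/-- The time derivative of a smoothly varying field, in a chart. -/
theorem IsSmoothTimeField.hasDerivWithinAt {J : Set ℝ} {Y : ℝ → ∀ m : M, TangentSpace 𝓘(ℝ, E) m}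
    (hY : IsSmoothTimeField J Y) (hJ : UniqueDiffOn ℝ J) {t : ℝ} (ht : t ∈ J) {x m : M}
    (hm : m ∈ (chartAt E x).source) :
    chartDeriv E x m (timeDeriv J Y t m) =
      fderivWithin ℝ (fieldInChart x Y) (J ×ˢ (extChartAt 𝓘(ℝ, E) x).target)
        (t, extChartAt 𝓘(ℝ, E) x m) (1, 0) := by
  set χ := extChartAt 𝓘(ℝ, E) x with hχ
  have hms : m ∈ χ.source := by rwa [hχ, extChartAt_source]
  have h1 : HasFDerivWithinAt (fieldInChart x Y) (fderivWithin ℝ (fieldInChart x Y) (J ×ˢ χ.target)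
      (t, χ m)) (J ×ˢ χ.target) (t, χ m) :=
    ((hY.contDiffOn_fieldInChart x).differentiableOn (by simp) _
      ⟨ht, χ.map_source hms⟩).hasFDerivWithinAt
  have h2 : HasDerivWithinAt (fun τ : ℝ => ((τ, χ m) : ℝ × E)) (1, 0) J t :=
    (hasDerivWithinAt_id t J).prodMk (hasDerivWithinAt_const t J (χ m))
  have hmaps : MapsTo (fun τ : ℝ => ((τ, χ m) : ℝ × E)) J (J ×ˢ χ.target) :=
    fun τ hτ => ⟨hτ, χ.map_source hms⟩
  have h3 := h1.comp_hasDerivWithinAt t h2 hmaps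
  have h4 := (chartDeriv E x m).inverse.hasFDerivAt.comp_hasDerivWithinAt t h3
  have h5 := HasDerivWithinAt.congr_of_mem (F := E) (f₁ := fun τ => Y τ m) h4
    (fun τ _ => (inverse_fieldInChart hm Y τ).symm) ht
  have h6 := h5.derivWithin (hJ t ht)
  refine (congrArg (chartDeriv E x m) h6).trans ?_
  exact chartDeriv_inverse_apply hm _

theorem IsSmoothTimeField.timeDeriv {J : Set ℝ} {Y : ℝ → ∀ m : M, TangentSpace 𝓘(ℝ, E) m}
    (hY : IsSmoothTimeField J Y) (hJ : UniqueDiffOn ℝ J) : IsSmoothTimeField J (timeDeriv J Y) := by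
  refine isSmoothTimeField_of_fieldInChart fun x => ?_
  have h1 : ContDiffOn ℝ ∞ (fun w => fderivWithin ℝ (fieldInChart x Y)
      (J ×ˢ (extChartAt 𝓘(ℝ, E) x).target) w (1, 0)) (J ×ˢ (extChartAt 𝓘(ℝ, E) x).target) :=
    ((hY.contDiffOn_fieldInChart x).fderivWithin
      (hJ.prod (isOpen_extChartAt_target x).uniqueDiffOn) (by simp)).clm_apply contDiffOn_const
  refine h1.congr fun w hw => ?_
  have h2 := (extChartAt 𝓘(ℝ, E) x).map_target hw.2
  refine (hY.hasDerivWithinAt hJ hw.1 (by rwa [extChartAt_source] at h2)).trans ?_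
  rw [(extChartAt 𝓘(ℝ, E) x).right_inv hw.2]

end AveragedFields

/-! ### The adjoint action and the averaged field -/

section Adjoint
universe u
variable {E : Type u} [NormedAddCommGroup E] [NormedSpace ℝ E] [FiniteDimensional ℝ E]
  {M : Type*} [TopologicalSpace M] [ChartedSpace E M] [IsManifold 𝓘(ℝ, E) ∞ M] [T2Space M]
  {Z : ∀ m : M, TangentSpace 𝓘(ℝ, E) m}

/-- The push-forward of tangent vectors under the flow of `Z` is smooth in time and vector. -/
theorem contMDiff_mfderiv_expFlow (hZ : IsSmoothField Z) (hc : IsCompleteField univ fun _ => Z) :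
    ContMDiff (𝓘(ℝ, ℝ).prod 𝓘(ℝ, E).tangent) 𝓘(ℝ, E).tangent ∞
      (fun q : ℝ × TangentBundle 𝓘(ℝ, E) M =>
        (⟨expFlow q.1 Z q.2.1, mfderiv 𝓘(ℝ, E) 𝓘(ℝ, E) (expFlow q.1 Z) q.2.1 q.2.2⟩ :
          TangentBundle 𝓘(ℝ, E) M)) := by
  have h := contMDiffOn_tangentMap_slice (D := univ) uniqueDiffOn_univ
    (contMDiff_expFlow hZ hc).contMDiffOn (k := ∞) (by simp)
  simpa only [univ_prod_univ, contMDiffOn_univ] using h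

theorem adExp_total (hZ : IsSmoothField Z) (hc : IsCompleteField univ fun _ => Z)
    (Y : ∀ m : M, TangentSpace 𝓘(ℝ, E) m) (s : ℝ) (m : M) :
    (⟨expFlow s Z (expFlow (-s) Z m), mfderiv 𝓘(ℝ, E) 𝓘(ℝ, E) (expFlow s Z) (expFlow (-s) Z m)
      (Y (expFlow (-s) Z m))⟩ : TangentBundle 𝓘(ℝ, E) M) = ⟨m, adExp s Z Y m⟩ := by
  have aux : ∀ (p : M) (v : E), p = m →
      (⟨p, v⟩ : TangentBundle 𝓘(ℝ, E) M) = ⟨m, v⟩ := by rintro p v rfl; rfl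
  refine aux _ _ ?_
  rw [expFlow_expFlow hZ hc, neg_add_cancel, expFlow_zero hc]

theorem isSmoothTimeField_adExp (hZ : IsSmoothField Z) (hc : IsCompleteField univ fun _ => Z)
    {Y : ∀ m : M, TangentSpace 𝓘(ℝ, E) m} (hY : IsSmoothField Y) :
    IsSmoothTimeField univ fun s => adExp s Z Y := by
  have h : ContMDiff (𝓘(ℝ, ℝ).prod 𝓘(ℝ, E)) 𝓘(ℝ, E).tangent ∞ (fun q : ℝ × M =>
      (⟨expFlow q.1 Z (expFlow (-q.1) Z q.2), mfderiv 𝓘(ℝ, E) 𝓘(ℝ, E) (expFlow q.1 Z)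
        (expFlow (-q.1) Z q.2) (Y (expFlow (-q.1) Z q.2))⟩ : TangentBundle 𝓘(ℝ, E) M)) := by
    have h1 : ContMDiff (𝓘(ℝ, ℝ).prod 𝓘(ℝ, E)) 𝓘(ℝ, E) ∞ (fun q : ℝ × M => expFlow (-q.1) Z q.2) :=
      (contMDiff_expFlow hZ hc).comp
        ((contDiff_neg.contMDiff.comp contMDiff_fst).prodMk contMDiff_snd)
    exact (contMDiff_mfderiv_expFlow hZ hc).comp
      (contMDiff_fst.prodMk (ContMDiff.comp (I' := 𝓘(ℝ, E)) hY h1))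
  simp only [adExp_total hZ hc] at h
  exact h.contMDiffOn

omit [IsManifold 𝓘(ℝ, E) ∞ M] [T2Space M] in
/-- Integrals of continuous curves in a tangent space do not depend on whether the norm is that of
the model space or that of the Riemannian metric. -/
theorem intervalIntegral_tangentSpace [RiemannianBundle (fun m : M => TangentSpace 𝓘(ℝ, E) m)]
    (m : M) {f : ℝ → E} (hf : Continuous f) (a b : ℝ) :
    intervalIntegral (E := TangentSpace 𝓘(ℝ, E) m) f a b volume =
      intervalIntegral (E := E) f a b volume := by
  let L : E →L[ℝ] TangentSpace 𝓘(ℝ, E) m := ContinuousLinearMap.id ℝ E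
  exact L.intervalIntegral_comp_comm (hf.intervalIntegrable a b)

theorem fieldW_eq [RiemannianBundle (fun m : M => TangentSpace 𝓘(ℝ, E) m)] {J : Set ℝ}
    (hJ : UniqueDiffOn ℝ J) {Z : ℝ → ∀ m : M, TangentSpace 𝓘(ℝ, E) m} (hZ : IsSmoothTimeField J Z)
    {t : ℝ} (ht : t ∈ J) (hc : IsCompleteField univ fun _ => Z t) (m : M) :
    fieldW J Z t m =
      intervalIntegral (E := E) (fun s => adExp s (Z t) (timeDeriv J Z t) m) 0 1 volume :=
  intervalIntegral_tangentSpace m (continuousOn_univ.1 ((isSmoothTimeField_adExp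
    (hZ.isSmoothField ht) hc ((hZ.timeDeriv hJ).isSmoothField ht)).continuousOn_apply m)) 0 1

/-- The averaged field `W` is smooth. -/
theorem isSmoothField_fieldW {J : Set ℝ} (hJ : UniqueDiffOn ℝ J)
    {Z : ℝ → ∀ m : M, TangentSpace 𝓘(ℝ, E) m} (hZ : IsSmoothTimeField J Z)
    [RiemannianBundle (fun m : M => TangentSpace 𝓘(ℝ, E) m)] {t : ℝ} (ht : t ∈ J)
    (hc : IsCompleteField univ fun _ => Z t) : IsSmoothField (fieldW J Z t) := by
  rw [show fieldW J Z t = _ from funext (fieldW_eq hJ hZ ht hc)]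
  exact (isSmoothTimeField_adExp (hZ.isSmoothField ht) hc
    ((hZ.timeDeriv hJ).isSmoothField ht)).isSmoothField_integral

end Adjoint

/-! ### Difference quotients of families of fields -/

section DifferenceQuotients
universe u
variable {E : Type u} [NormedAddCommGroup E] [NormedSpace ℝ E]

/-- If `∂c/∂s (τ, s) = (τ - t) H(τ, s)` and `c(τ, 0)` is constant, then `c(τ, 1)` has derivative
`∫₀¹ H(t, s) ds` at `τ = t`. -/
theorem hasDerivWithinAt_integral_of_deriv_eq_smul [CompleteSpace E] {J : Set ℝ} {t : ℝ}
    {c : ℝ → ℝ → E} {c₀ : E} {H : ℝ × ℝ → E} (ht : t ∈ J)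
    (hH : ∀ s, ContinuousWithinAt H (J ×ˢ univ) (t, s)) (hc₀ : ∀ τ ∈ J, c τ 0 = c₀) (hct : c t 1 = c₀)
    (hd : ∀ᶠ τ in 𝓝[J] t, ∀ s ∈ Icc (0 : ℝ) 1,
      HasDerivWithinAt (c τ) ((τ - t) • H (τ, s)) (Icc 0 1) s) :
    HasDerivWithinAt (fun τ => c τ 1) (∫ s in (0 : ℝ)..1, H (t, s)) J t := by
  have hcont : Continuous fun s => H (t, s) := by
    refine continuous_iff_continuousAt.2 fun s => ?_
    have h1 := (hH s).comp (f := fun s : ℝ => ((t, s) : ℝ × ℝ)) (s := univ)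
      (x := s) (by fun_prop) (fun r _ => ⟨ht, mem_univ _⟩)
    exact h1.continuousAt Filter.univ_mem
  rw [hasDerivWithinAt_iff_isLittleO, Asymptotics.isLittleO_iff]
  intro ε hε
  have huni : ∀ᶠ τ in 𝓝 t, ∀ s ∈ Icc (0 : ℝ) 1, τ ∈ J → ‖H (τ, s) - H (t, s)‖ ≤ ε := by
    refine isCompact_Icc.eventually_forall_of_forall_eventually fun s _ => ?_
    have h1 : ∀ᶠ p : ℝ × ℝ in 𝓝 (t, s), p ∈ J ×ˢ univ → dist (H p) (H (t, s)) < ε / 2 :=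
      eventually_nhdsWithin_iff.1 ((hH s) (Metric.ball_mem_nhds _ (half_pos hε)))
    have h2 : ∀ᶠ p : ℝ × ℝ in 𝓝 (t, s), dist (H (t, p.2)) (H (t, s)) < ε / 2 :=
      (hcont.comp continuous_snd).continuousAt (Metric.ball_mem_nhds _ (half_pos hε))
    filter_upwards [h1, h2] with p hp1 hp2 hpJ
    rw [← dist_eq_norm]
    calc dist (H p) (H (t, p.2)) ≤ dist (H p) (H (t, s)) + dist (H (t, p.2)) (H (t, s)) :=
          dist_triangle_right _ _ _
      _ ≤ ε := by linarith [hp1 ⟨hpJ, mem_univ _⟩]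
  filter_upwards [hd, nhdsWithin_le_nhds huni, self_mem_nhdsWithin] with τ h1 h2 hτ
  let ψ : ℝ → E := fun s => c τ s - (τ - t) • ∫ r in (0 : ℝ)..s, H (t, r)
  have hψ : ∀ s ∈ Icc (0 : ℝ) 1,
      HasDerivWithinAt ψ ((τ - t) • H (τ, s) - (τ - t) • H (t, s)) (Icc 0 1) s := fun s hs =>
    (h1 s hs).sub ((hcont.integral_hasStrictDerivAt 0 s).hasDerivAt.hasDerivWithinAt.const_smul _)
  have h3 := norm_image_sub_le_of_norm_deriv_le_segment' (C := |τ - t| * ε) hψ (fun s hs => by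
    rw [← smul_sub, norm_smul, Real.norm_eq_abs]
    exact mul_le_mul_of_nonneg_left (h2 s ⟨hs.1, hs.2.le⟩ hτ) (abs_nonneg _)) 1 (by simp)
  simp only [ψ, hc₀ τ hτ, intervalIntegral.integral_same, smul_zero, sub_zero, mul_one] at h3
  rw [hct, Real.norm_eq_abs, mul_comm ε]
  convert h3 using 2
  abel

variable {M : Type*} [TopologicalSpace M] [ChartedSpace E M]

/-- The difference quotients `(Z_τ - Z_t) / (τ - t)`, with the derivative at `τ = t`. -/
def quotientField (J : Set ℝ) (Z : ℝ → ∀ m : M, TangentSpace 𝓘(ℝ, E) m) (t τ : ℝ) (m : M) :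
    TangentSpace 𝓘(ℝ, E) m :=
  open Classical in if τ = t then timeDeriv J Z t m else (τ - t)⁻¹ • (Z τ m - Z t m)

theorem smul_quotientField (J : Set ℝ) (Z : ℝ → ∀ m : M, TangentSpace 𝓘(ℝ, E) m) (t τ : ℝ) (m : M) :
    (τ - t) • quotientField J Z t τ m = Z τ m - Z t m := by
  by_cases h : τ = t
  · subst h
    simp
  · rw [quotientField, if_neg h, smul_inv_smul₀ (sub_ne_zero.2 h)]

variable [IsManifold 𝓘(ℝ, E) ∞ M]

/-- The difference quotients of a smoothly varying field are continuous, also at `τ = t`. -/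
theorem continuousWithinAt_quotientField {J : Set ℝ} (hJ : Convex ℝ J) (hJu : UniqueDiffOn ℝ J)
    {Z : ℝ → ∀ m : M, TangentSpace 𝓘(ℝ, E) m} (hZ : IsSmoothTimeField J Z) {t : ℝ} (ht : t ∈ J)
    (x : M) :
    ContinuousWithinAt (fun p : ℝ × M =>
      (⟨p.2, quotientField J Z t p.1 p.2⟩ : TangentBundle 𝓘(ℝ, E) M)) (J ×ˢ univ) (t, x) := by
  set χ := extChartAt 𝓘(ℝ, E) x with hχ
  set f := fieldInChart x Z with hf
  set d := fieldInChart x (timeDeriv J Z) with hd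
  have hfd : ∀ τ ∈ J, ∀ p ∈ χ.source, HasDerivWithinAt (fun τ => f (τ, χ p)) (d (τ, χ p)) J τ := by
    intro τ hτ p hp
    have hp' : p ∈ (chartAt E x).source := by rwa [hχ, extChartAt_source] at hp
    have h1 := ((hZ.contDiffOn_fieldInChart x).differentiableOn (by simp) (τ, χ p)
      ⟨hτ, χ.map_source hp⟩).hasFDerivWithinAt
    have h2 : HasDerivWithinAt (fun τ : ℝ => ((τ, χ p) : ℝ × E)) (1, 0) J τ :=
      (hasDerivWithinAt_id τ J).prodMk (hasDerivWithinAt_const τ J (χ p))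
    have hmaps : MapsTo (fun τ : ℝ => ((τ, χ p) : ℝ × E)) J (J ×ˢ χ.target) :=
      fun τ hτ => ⟨hτ, χ.map_source hp⟩
    have h3 := h1.comp_hasDerivWithinAt τ h2 hmaps
    have h4 := hZ.hasDerivWithinAt hJu hτ hp'
    rw [hd, fieldInChart_extChartAt hp']
    rw [← h4] at h3
    exact h3
  have hdc : ContinuousWithinAt (fun p : ℝ × M => d (p.1, χ p.2)) (J ×ˢ univ) (t, x) := by
    have h1 := ((hZ.timeDeriv hJu).contDiffOn_fieldInChart x).continuousOn (t, χ x)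
      ⟨ht, mem_extChartAt_target x⟩
    have h2 : ContinuousWithinAt (fun p : ℝ × M => ((p.1, χ p.2) : ℝ × E)) (J ×ˢ χ.source) (t, x) :=
      continuousWithinAt_fst.prodMk ((ContinuousAt.comp (g := χ) (continuousAt_extChartAt x)
        continuousAt_snd).continuousWithinAt)
    have hmaps : MapsTo (fun p : ℝ × M => ((p.1, χ p.2) : ℝ × E)) (J ×ˢ χ.source)
        (J ×ˢ χ.target) := fun p hp => ⟨hp.1, χ.map_source hp.2⟩
    have h3 := ContinuousWithinAt.comp (f := fun p : ℝ × M => ((p.1, χ p.2) : ℝ × E))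
      (x := (t, x)) h1 h2 hmaps
    refine h3.mono_of_mem_nhdsWithin ?_
    filter_upwards [self_mem_nhdsWithin, nhdsWithin_le_nhds (continuousAt_snd.eventually
      (extChartAt_source_mem_nhds (I := 𝓘(ℝ, E)) x))] with p hp1 hp2
    exact ⟨hp1.1, hp2⟩
  refine (FiberBundle.continuousWithinAt_totalSpace E _).2 ⟨continuousWithinAt_snd, ?_⟩
  rw [Metric.continuousWithinAt_iff']
  intro ε hε
  have h1 : ∀ᶠ p : ℝ × M in 𝓝 (t, x), p ∈ J ×ˢ univ → ‖d (p.1, χ p.2) - d (t, χ x)‖ < ε / 2 := by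
    have := eventually_nhdsWithin_iff.1 (hdc (Metric.ball_mem_nhds _ (half_pos hε)))
    simpa only [mem_preimage, mem_ball_iff_norm] using this
  rw [nhds_prod_eq] at h1
  obtain ⟨P, hP, Q, hQ, hPQ⟩ := Filter.eventually_prod_iff.1 h1
  obtain ⟨δ, hδ, hδP⟩ := Metric.eventually_nhds_iff_ball.1 hP
  have h2 : ∀ᶠ p : ℝ × M in 𝓝[J ×ˢ univ] (t, x), p.1 ∈ Metric.ball t δ ∧ Q p.2 ∧ p.2 ∈ χ.source :=
    nhdsWithin_le_nhds (Filter.Eventually.and (continuousAt_fst (Metric.ball_mem_nhds t hδ))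
      ((continuousAt_snd.eventually hQ).and
        (continuousAt_snd.eventually (extChartAt_source_mem_nhds (I := 𝓘(ℝ, E)) x))))
  filter_upwards [h2, self_mem_nhdsWithin] with ⟨τ, p⟩ ⟨hτδ, hQp, hps⟩ hτ
  have hp' : p ∈ (chartAt E x).source := by rwa [hχ, extChartAt_source] at hps
  rw [trivializationAt_snd_eq_mfderiv hp', trivializationAt_snd_eq_mfderiv (mem_chart_source E x)]
  have hx : chartDeriv E x x (quotientField J Z t t x) = d (t, χ x) := by
    rw [quotientField, if_pos rfl, hd, fieldInChart_extChartAt (mem_chart_source E x)]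
    rfl
  change dist (chartDeriv E x p (quotientField J Z t τ p))
    (chartDeriv E x x (quotientField J Z t t x)) < ε
  rw [hx]
  by_cases hτt : τ = t
  · subst hτt
    have h3 := hPQ (hδP _ hτδ) hQp ⟨hτ.1, mem_univ _⟩
    rw [hd, fieldInChart_extChartAt hp'] at h3
    rw [quotientField, if_pos rfl, dist_eq_norm]
    exact h3.trans (by linarith)
  · have hconv : Convex ℝ (J ∩ Metric.ball t δ) := hJ.inter (convex_ball t δ)
    have h3 := hconv.norm_image_sub_le_of_norm_hasDerivWithin_le (C := ε / 2)
      (f := fun τ => f (τ, χ p) - τ • d (t, χ x)) (f' := fun τ => d (τ, χ p) - d (t, χ x))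
      (x := t) (y := τ)
      (fun r hr => by
        have h4 := ((hfd r hr.1 p hps).mono (inter_subset_left (t := Metric.ball t δ))).sub
          ((hasDerivWithinAt_id r _).smul_const (d (t, χ x)))
        rwa [one_smul] at h4)
      (fun r hr => (hPQ (hδP _ hr.2) hQp ⟨hr.1, mem_univ _⟩).le)
      ⟨ht, Metric.mem_ball_self hδ⟩ ⟨hτ.1, hτδ⟩
    have h5 : chartDeriv E x p (quotientField J Z t τ p) =
        (τ - t)⁻¹ • (f (τ, χ p) - f (t, χ p)) := by
      rw [hf, fieldInChart_extChartAt hp', fieldInChart_extChartAt hp', quotientField, if_neg hτt]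
      exact ((chartDeriv E x p).map_smul _ _).trans (congrArg _ ((chartDeriv E x p).map_sub _ _))
    have h6 : (τ - t)⁻¹ • (f (τ, χ p) - f (t, χ p)) - d (t, χ x) =
        (τ - t)⁻¹ • (f (τ, χ p) - τ • d (t, χ x) - (f (t, χ p) - t • d (t, χ x))) := by
      have h7 : f (τ, χ p) - τ • d (t, χ x) - (f (t, χ p) - t • d (t, χ x)) =
        (f (τ, χ p) - f (t, χ p)) - (τ - t) • d (t, χ x) := by rw [sub_smul]; abel
      rw [h7, smul_sub _ (f (τ, χ p) - f (t, χ p)), inv_smul_smul₀ (sub_ne_zero.2 hτt)]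
    have h8 : 0 < |τ - t| := abs_pos.2 (sub_ne_zero.2 hτt)
    rw [h5, dist_eq_norm, h6, norm_smul, norm_inv, Real.norm_eq_abs, inv_mul_lt_iff₀ h8]
    refine h3.trans_lt ?_
    rw [Real.norm_eq_abs, mul_comm]
    gcongr
    linarith

end DifferenceQuotients

/-! ### The derivative of the exponential map -/

section ExponentialDerivative
universe u
variable {E : Type u} [NormedAddCommGroup E] [NormedSpace ℝ E]
  {M : Type*} [TopologicalSpace M] [ChartedSpace E M]

/-- Total spaces: two vectors in the same tangent space agree if they agree in the total space. -/
theorem tangent_eq_of_total_eq {m : M} {v w : TangentSpace 𝓘(ℝ, E) m}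
    (h : (⟨m, v⟩ : TangentBundle 𝓘(ℝ, E) M) = ⟨m, w⟩) : v = w := by
  cases h
  rfl

theorem HasVelocityWithin.cast {J : Set ℝ} {σ σ' : ℝ → M} {t : ℝ} {v w : E}
    (h : HasVelocityWithin (E := E) J σ t v) (hσ : σ = σ') (hvw : v = w) :
    HasVelocityWithin (E := E) J σ' t w := by
  subst hσ hvw
  exact h

theorem HasVelocityWithin.comp_mfderiv {J : Set ℝ} {σ : ℝ → M} {t : ℝ}
    {v : TangentSpace 𝓘(ℝ, E) (σ t)} (h : HasVelocityWithin J σ t v) {φ : M → M}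
    (hφ : MDifferentiableAt 𝓘(ℝ, E) 𝓘(ℝ, E) φ (σ t)) :
    HasVelocityWithin J (fun u => φ (σ u)) t
      (mfderiv 𝓘(ℝ, E) 𝓘(ℝ, E) φ (σ t) v : TangentSpace 𝓘(ℝ, E) (φ (σ t))) := by
  refine HasMFDerivWithinAt.congr_mfderiv (HasMFDerivAt.comp_hasMFDerivWithinAt t hφ.hasMFDerivAt h) ?_
  ext
  change mfderiv 𝓘(ℝ, E) 𝓘(ℝ, E) φ (σ t) ((1 : ℝ) • v) = (1 : ℝ) • mfderiv 𝓘(ℝ, E) 𝓘(ℝ, E) φ (σ t) v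
  rw [map_smul]

/-- The velocity of a curve whose chart representation has a known derivative. -/
theorem hasVelocityWithin_of_chart [IsManifold 𝓘(ℝ, E) ∞ M] {J : Set ℝ} {σ : ℝ → M} {t : ℝ} {m : M}
    (hm : σ t = m) (hσ : MDifferentiableWithinAt 𝓘(ℝ, ℝ) 𝓘(ℝ, E) σ J t)
    (hJ : UniqueDiffWithinAt ℝ J t) {k : E}
    (h : HasDerivWithinAt (fun u => extChartAt 𝓘(ℝ, E) m (σ u)) (chartDeriv E m m k) J t) :
    HasVelocityWithin (E := E) J σ t k := by
  subst hm
  let v : E := mfderivWithin 𝓘(ℝ, ℝ) 𝓘(ℝ, E) σ J t (1 : ℝ)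
  have hv : HasVelocityWithin (E := E) J σ t v := by
    refine HasMFDerivWithinAt.congr_mfderiv hσ.hasMFDerivWithinAt ?_
    ext
    change _ = (1 : ℝ) • v
    rw [one_smul]
    rfl
  have h1 : chartDeriv E (σ t) (σ t) v = chartDeriv E (σ t) (σ t) k :=
    hJ.eq_deriv _ (hv.hasDerivWithinAt_extChartAt (mem_chart_source E (σ t))) h
  have h2 : v = k := by
    rw [← inverse_chartDeriv_apply (mem_chart_source E (σ t)) v, h1,
      inverse_chartDeriv_apply (mem_chart_source E (σ t))]
  rwa [← h2]

/-- The chain rule for `u ↦ Φ (g u, σ u)`. -/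
theorem HasVelocityWithin.comp_prod {Φ : ℝ × M → M} {g : ℝ → ℝ} {σ : ℝ → M} {J : Set ℝ} {t a : ℝ}
    {v : TangentSpace 𝓘(ℝ, E) (σ t)}
    (hΦ : MDifferentiableAt (𝓘(ℝ, ℝ).prod 𝓘(ℝ, E)) 𝓘(ℝ, E) Φ (g t, σ t))
    (hg : HasDerivWithinAt g a J t) (hσ : HasVelocityWithin J σ t v) :
    HasVelocityWithin (E := E) J (fun u => Φ (g u, σ u)) t
      (mfderiv (𝓘(ℝ, ℝ).prod 𝓘(ℝ, E)) 𝓘(ℝ, E) Φ (g t, σ t) ((a, v) : ℝ × E)) := by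
  have h1 := hg.hasFDerivWithinAt.hasMFDerivWithinAt.prodMk hσ
  have h2 := HasMFDerivAt.comp_hasMFDerivWithinAt (f := fun u => (g u, σ u)) t hΦ.hasMFDerivAt h1
  refine HasMFDerivWithinAt.congr_mfderiv h2 ?_
  ext
  let A : ℝ × E →L[ℝ] E := mfderiv (𝓘(ℝ, ℝ).prod 𝓘(ℝ, E)) 𝓘(ℝ, E) Φ (g t, σ t)
  change A ((1 : ℝ) • a, (1 : ℝ) • v) = (1 : ℝ) • A (a, v)
  simp only [one_smul]

theorem HasVelocityWithin.unique {σ : ℝ → M} {J : Set ℝ} {t : ℝ} {v w : TangentSpace 𝓘(ℝ, E) (σ t)}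
    (hJ : UniqueDiffWithinAt ℝ J t) (hv : HasVelocityWithin J σ t v) (hw : HasVelocityWithin J σ t w) :
    v = w := by
  have h := UniqueMDiffWithinAt.eq (I := 𝓘(ℝ, ℝ)) (I' := 𝓘(ℝ, E)) hJ.uniqueMDiffWithinAt hv hw
  have h1 := congrArg (fun A : ℝ →L[ℝ] E => A 1) h
  change (1 : ℝ) • v = (1 : ℝ) • w at h1
  rwa [one_smul, one_smul] at h1

/-- The partial derivative in the manifold variable, as a value of the full derivative. -/
theorem mfderiv_zero_prod {Φ : ℝ × M → M} {s : ℝ} {x : M}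
    (hΦ : MDifferentiableAt (𝓘(ℝ, ℝ).prod 𝓘(ℝ, E)) 𝓘(ℝ, E) Φ (s, x)) (v : TangentSpace 𝓘(ℝ, E) x) :
    mfderiv (𝓘(ℝ, ℝ).prod 𝓘(ℝ, E)) 𝓘(ℝ, E) Φ (s, x) ((0, v) : ℝ × E) =
      mfderiv 𝓘(ℝ, E) 𝓘(ℝ, E) (fun y => Φ (s, y)) x v := by
  have hs : HasMFDerivAt 𝓘(ℝ, E) (𝓘(ℝ, ℝ).prod 𝓘(ℝ, E)) (fun y : M => (s, y)) x
      ((0 : E →L[ℝ] ℝ).prod (ContinuousLinearMap.id ℝ E)) :=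
    (hasMFDerivAt_const s x).prodMk (hasMFDerivAt_id x)
  exact (congrFun (congrArg DFunLike.coe (hΦ.hasMFDerivAt.comp x hs).mfderiv) v).symm

/-- If `Φ` is constant along `r ↦ (g r, η r)`, then the derivative of `Φ` along another curve with the
same derivative of the first coordinate is the partial derivative in the direction of the difference
of the velocities. -/
theorem HasVelocityWithin.comp_prod_of_const {Φ : ℝ × M → M} {g h : ℝ → ℝ} {σ η : ℝ → M}
    {J : Set ℝ} {t t' a : ℝ} {v w : E}
    (hΦ : MDifferentiableAt (𝓘(ℝ, ℝ).prod 𝓘(ℝ, E)) 𝓘(ℝ, E) Φ (g t, σ t))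
    (hg : HasDerivWithinAt g a J t) (hσ : HasVelocityWithin (E := E) J σ t v)
    (hh : HasDerivAt h a t') (hη : HasVelocityWithin (E := E) univ η t' w)
    (hgh : h t' = g t) (hησ : η t' = σ t) (hconst : ∀ᶠ r in 𝓝 t', Φ (h r, η r) = Φ (h t', η t')) :
    HasVelocityWithin (E := E) J (fun u => Φ (g u, σ u)) t
      (mfderiv 𝓘(ℝ, E) 𝓘(ℝ, E) (fun y => Φ (g t, y)) (σ t) (v - w : E)) := by
  have h1 := HasVelocityWithin.comp_prod hΦ hg hσ
  have hΦ' : MDifferentiableAt (𝓘(ℝ, ℝ).prod 𝓘(ℝ, E)) 𝓘(ℝ, E) Φ (h t', η t') := by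
    rwa [hgh, hησ]
  have h2 := HasVelocityWithin.comp_prod hΦ' hh.hasDerivWithinAt hη
  have h3 : HasVelocityWithin (E := E) univ (fun r => Φ (h r, η r)) t' (0 : E) := by
    have h4 : HasMFDerivAt 𝓘(ℝ, ℝ) 𝓘(ℝ, E) (fun r => Φ (h r, η r)) t' (0 : ℝ →L[ℝ] E) :=
      (hasMFDerivAt_const (I := 𝓘(ℝ, ℝ)) (I' := 𝓘(ℝ, E)) (Φ (h t', η t')) t').congr_of_eventuallyEq
        hconst
    refine HasMFDerivWithinAt.congr_mfderiv h4.hasMFDerivWithinAt ?_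
    ext
    change (0 : E) = (1 : ℝ) • (0 : E)
    simp
  have h5 := h2.unique uniqueDiffWithinAt_univ h3
  have h6 : mfderiv (𝓘(ℝ, ℝ).prod 𝓘(ℝ, E)) 𝓘(ℝ, E) Φ (g t, σ t) ((a, w) : ℝ × E) = (0 : E) := by
    have aux : ∀ (r : ℝ) (p : M), h t' = r → η t' = p →
        (mfderiv (𝓘(ℝ, ℝ).prod 𝓘(ℝ, E)) 𝓘(ℝ, E) Φ (r, p) ((a, w) : ℝ × E) : E) = 0 := by
      rintro r p rfl rfl
      exact h5
    exact aux _ _ hgh hησ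
  convert h1 using 1
  refine (mfderiv_zero_prod hΦ _).symm.trans ?_
  let A : ℝ × E →L[ℝ] E := mfderiv (𝓘(ℝ, ℝ).prod 𝓘(ℝ, E)) 𝓘(ℝ, E) Φ (g t, σ t)
  have h7 : A (a, w) = 0 := h6
  change A (0, v - w) = A (a, v)
  have h8 : ((0, v - w) : ℝ × E) = (a, v) - (a, w) := by simp
  rw [h8, map_sub, h7, sub_zero]

variable [FiniteDimensional ℝ E] [T2Space M] [IsManifold 𝓘(ℝ, E) ∞ M]

section Autonomous
variable {Z : ∀ m : M, TangentSpace 𝓘(ℝ, E) m}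

theorem mdifferentiableAt_expFlow (hZ : IsSmoothField Z) (hc : IsCompleteField univ fun _ => Z)
    (s : ℝ) (m : M) : MDifferentiableAt 𝓘(ℝ, E) 𝓘(ℝ, E) (expFlow s Z) m := by
  have h : ContMDiff 𝓘(ℝ, E) 𝓘(ℝ, E) ∞ (expFlow s Z) :=
    (contMDiff_expFlow hZ hc).comp (contMDiff_const.prodMk contMDiff_id)
  exact h.mdifferentiable (by simp) m

/-- A curve moved by the inverse flow of `Z`. -/
theorem HasVelocityWithin.expFlow_neg (hZ : IsSmoothField Z) (hc : IsCompleteField univ fun _ => Z)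
    {J : Set ℝ} {σ : ℝ → M} {s : ℝ} {v : TangentSpace 𝓘(ℝ, E) (σ s)} (hσ : HasVelocityWithin J σ s v) :
    HasVelocityWithin (E := E) J (fun u => expFlow (-u) Z (σ u)) s
      (mfderiv 𝓘(ℝ, E) 𝓘(ℝ, E) (expFlow (-s) Z) (σ s) (v - Z (σ s))) := by
  have hη := (isFlowLine_expFlow hc (σ s)).2 0 (mem_univ 0)
  have hη' : HasVelocityWithin (E := E) univ (fun r => expFlow r Z (σ s)) 0 (Z (σ s)) := by
    exact hη.cast rfl (congrArg (β := E) (fun p => Z p) (expFlow_zero hc (σ s)))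
  refine HasVelocityWithin.comp_prod_of_const (Φ := fun q : ℝ × M => expFlow q.1 Z q.2)
    (g := fun u => -u) (h := fun r => -s - r) (η := fun r => expFlow r Z (σ s)) (t' := 0)
    ((contMDiff_expFlow hZ hc).mdifferentiable (by simp) _) (hasDerivAt_neg s).hasDerivWithinAt hσ
    ((hasDerivAt_id (0 : ℝ)).const_sub (-s)) hη' (by simp) (expFlow_zero hc _)
    (Filter.Eventually.of_forall fun r => ?_)
  simp only [expFlow_expFlow hZ hc]
  congr 1
  ring

/-- Equivariance of the adjoint action under the flow. -/
theorem adExp_add (hZ : IsSmoothField Z) (hc : IsCompleteField univ fun _ => Z)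
    (Y : ∀ m : M, TangentSpace 𝓘(ℝ, E) m) (r s : ℝ) (m : M) :
    adExp (r + s) Z Y (expFlow r Z m) = mfderiv 𝓘(ℝ, E) 𝓘(ℝ, E) (expFlow r Z) m (adExp s Z Y m) := by
  refine tangent_eq_of_total_eq ?_
  have h1 := adExp_total hZ hc Y (r + s) (expFlow r Z m)
  have h2 := congrArg (tangentMap 𝓘(ℝ, E) 𝓘(ℝ, E) (expFlow r Z)) (adExp_total hZ hc Y s m)
  have h3 : (fun x => expFlow r Z (expFlow s Z x)) = expFlow (r + s) Z := by
    funext x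
    rw [expFlow_expFlow hZ hc, add_comm]
  have h4 := tangentMap_comp_at (I := 𝓘(ℝ, E)) (I' := 𝓘(ℝ, E)) (I'' := 𝓘(ℝ, E))
    (f := expFlow s Z) (g := expFlow r Z) ⟨expFlow (-s) Z m, Y (expFlow (-s) Z m)⟩
    (mdifferentiableAt_expFlow hZ hc r _) (mdifferentiableAt_expFlow hZ hc s _)
  have h5 : expFlow (-(r + s)) Z (expFlow r Z m) = expFlow (-s) Z m := by
    rw [expFlow_expFlow hZ hc]
    congr 1
    ring
  rw [h5] at h1
  refine h1.symm.trans ?_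
  refine Eq.trans ?_ h2
  refine Eq.trans ?_ h4
  change tangentMap 𝓘(ℝ, E) 𝓘(ℝ, E) (expFlow (r + s) Z) ⟨expFlow (-s) Z m, Y (expFlow (-s) Z m)⟩ = _
  rw [← h3]
  rfl

end Autonomous

/-- The curve `κ(τ, s) = e^{-s Z_t}(e^{s Z_τ}(m))` has `s`-velocity
`(τ - t) e^{-s Z_t}_* V_τ`, where `V_τ` is the difference quotient of `Z`. -/
theorem hasVelocityWithin_conjugate {J : Set ℝ} {Z : ℝ → ∀ m : M, TangentSpace 𝓘(ℝ, E) m}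
    (hZ : IsSmoothTimeField J Z) (hc : ∀ t ∈ J, IsCompleteField univ fun _ => Z t) {t τ : ℝ}
    (ht : t ∈ J) (hτ : τ ∈ J) (m : M) (s : ℝ) :
    HasVelocityWithin (E := E) univ (fun u => expFlow (-u) (Z t) (expFlow u (Z τ) m)) s
      ((τ - t) • mfderiv 𝓘(ℝ, E) 𝓘(ℝ, E) (expFlow (-s) (Z t)) (expFlow s (Z τ) m)
        (quotientField J Z t τ (expFlow s (Z τ) m)) : E) := by
  have h := HasVelocityWithin.expFlow_neg (hZ.isSmoothField ht) (hc t ht)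
    ((isFlowLine_expFlow (hc τ hτ) m).2 s (mem_univ s))
  have h1 := smul_quotientField J Z t τ (expFlow s (Z τ) m)
  refine h.cast rfl ?_
  let A : E →L[ℝ] E := mfderiv 𝓘(ℝ, E) 𝓘(ℝ, E) (expFlow (-s) (Z t)) (expFlow s (Z τ) m)
  exact (congrArg A h1).symm.trans (A.map_smul _ _)

/-- The derivative of `τ ↦ e^{Z_τ}(m)` is `W_t(e^{Z_t}(m))`. With `κ` as in
`hasVelocityWithin_conjugate`, `e^{Z_τ}(m) = e^{Z_t}(κ(τ, 1))` and `κ(t, s) = m` for all `s`, so that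
`κ(·, s)` stays near `m` and can be differentiated in a single chart. -/
theorem hasVelocityWithin_expFlow_one {J : Set ℝ} (hJ : Convex ℝ J) (hJu : UniqueDiffOn ℝ J)
    [RiemannianBundle (fun m : M => TangentSpace 𝓘(ℝ, E) m)]
    {Z : ℝ → ∀ m : M, TangentSpace 𝓘(ℝ, E) m} (hZ : IsSmoothTimeField J Z)
    (hZ' : HasLocalExtensions 1 J Z) (hc : ∀ t ∈ J, IsCompleteField univ fun _ => Z t) {t : ℝ}
    (ht : t ∈ J) (m : M) :
    HasVelocityWithin J (fun τ => expFlow 1 (Z τ) m) t (fieldW J Z t (expFlow 1 (Z t) m)) := by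
  have hZt := hZ.isSmoothField ht
  have hct := hc t ht
  set V := timeDeriv J Z t with hV
  let κ : ℝ → ℝ → M := fun τ s => expFlow (-s) (Z t) (expFlow s (Z τ) m)
  let q : ℝ → ℝ → TangentBundle 𝓘(ℝ, E) M := fun τ s => ⟨κ τ s,
    mfderiv 𝓘(ℝ, E) 𝓘(ℝ, E) (expFlow (-s) (Z t)) (expFlow s (Z τ) m)
      (quotientField J Z t τ (expFlow s (Z τ) m))⟩
  have hqt : ∀ s, q t s = ⟨m, adExp (-s) (Z t) V m⟩ := by
    intro s
    have h := adExp_total hZt hct V (-s) m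
    rw [neg_neg] at h
    rw [← h]
    simp only [q, κ, quotientField]
    rfl
  have hfam : ContMDiffOn (𝓘(ℝ, ℝ).prod 𝓘(ℝ, ℝ)) 𝓘(ℝ, E) 1
      (fun p : ℝ × ℝ => expFlow p.2 (Z p.1) m) (J ×ˢ univ) := by
    have h1 := contMDiffOn_expFlow_family one_ne_zero hZ' hc
    have h2 : ContMDiff (𝓘(ℝ, ℝ).prod 𝓘(ℝ, ℝ)) (𝓘(ℝ, ℝ).prod (𝓘(ℝ, ℝ).prod 𝓘(ℝ, E))) 1
        (fun p : ℝ × ℝ => (p.1, (p.2, m))) :=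
      contMDiff_fst.prodMk (contMDiff_snd.prodMk contMDiff_const)
    have h3 : MapsTo (fun p : ℝ × ℝ => (p.1, (p.2, m))) (J ×ˢ univ) (J ×ˢ univ) :=
      fun p hp => ⟨hp.1, mem_univ _⟩
    exact_mod_cast h1.comp h2.contMDiffOn h3
  have hq : ∀ s, ContinuousWithinAt (fun p : ℝ × ℝ => q p.1 p.2) (J ×ˢ univ) (t, s) := by
    intro s
    have h1 := continuousWithinAt_quotientField hJ hJu hZ ht (expFlow s (Z t) m)
    have h2 : ContinuousWithinAt (fun p : ℝ × ℝ => (p.1, expFlow p.2 (Z p.1) m)) (J ×ˢ univ) (t, s) :=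
      continuousWithinAt_fst.prodMk (hfam.continuousOn (t, s) ⟨ht, mem_univ _⟩)
    have h3 := ContinuousWithinAt.comp (f := fun p : ℝ × ℝ => (p.1, expFlow p.2 (Z p.1) m))
      (x := (t, s)) h1 h2 fun p hp => ⟨hp.1, mem_univ _⟩
    have h4 : ContinuousWithinAt (fun p : ℝ × ℝ => -p.2) (J ×ˢ univ) (t, s) := by fun_prop
    exact (contMDiff_mfderiv_expFlow hZt hct).continuous.continuousAt.comp_continuousWithinAt
      (h4.prodMk h3)
  let H : ℝ × ℝ → E := fun p => (trivializationAt E (TangentSpace 𝓘(ℝ, E)) m (q p.1 p.2)).2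
  have hH : ∀ s, ContinuousWithinAt H (J ×ˢ univ) (t, s) := by
    intro s
    have h1 := ((FiberBundle.continuousWithinAt_totalSpace E _).1 (hq s)).2
    simp only [hqt] at h1
    exact h1
  have hκ : ∀ s, ContinuousWithinAt (fun p : ℝ × ℝ => κ p.1 p.2) (J ×ˢ univ) (t, s) := fun s =>
    ((FiberBundle.continuousWithinAt_totalSpace E _).1 (hq s)).1
  have hκt : ∀ s, κ t s = m := fun s => congrArg TotalSpace.proj (hqt s)
  have hsource : ∀ᶠ τ in 𝓝[J] t, ∀ s ∈ Icc (0 : ℝ) 1, κ τ s ∈ (chartAt E m).source := by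
    have h1 : ∀ᶠ τ in 𝓝 t, ∀ s ∈ Icc (0 : ℝ) 1, τ ∈ J → κ τ s ∈ (chartAt E m).source := by
      refine isCompact_Icc.eventually_forall_of_forall_eventually fun s _ => ?_
      have h2 := (hκ s) ((chartAt E m).open_source.mem_nhds
        ((hκt s).symm ▸ mem_chart_source E m))
      filter_upwards [eventually_nhdsWithin_iff.1 h2] with p hp hpJ
      exact hp ⟨hpJ, mem_univ _⟩
    filter_upwards [nhdsWithin_le_nhds h1, self_mem_nhdsWithin] with τ hτ hτJ s hs
    exact hτ s hs hτJ
  have hder := hasDerivWithinAt_integral_of_deriv_eq_smul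
    (c := fun τ s => extChartAt 𝓘(ℝ, E) m (κ τ s)) (c₀ := extChartAt 𝓘(ℝ, E) m m) (H := H) ht hH
    (fun τ hτ => by
      simp [κ, expFlow_zero hct, expFlow_zero (hc τ hτ)]) (by simp only [hκt]) (by
      filter_upwards [hsource, self_mem_nhdsWithin] with τ hτ hτJ s hs
      have h1 := ((hasVelocityWithin_conjugate hZ hc ht hτJ m s).mono
        (subset_univ (Icc 0 1))).hasDerivWithinAt_extChartAt (hτ s hs)
      have h2 : H (τ, s) = _ := trivializationAt_snd_eq_mfderiv (hτ s hs) _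
      rw [h2]
      exact (ContinuousLinearMap.map_smul (chartDeriv E m (κ τ s)) (τ - t) _) ▸ h1)
  have hAd : Continuous (Y := E) fun s => adExp s (Z t) V m :=
    continuousOn_univ.1 ((isSmoothTimeField_adExp hZt hct
      ((hZ.timeDeriv hJu).isSmoothField ht)).continuousOn_apply m)
  let k : E := intervalIntegral (E := E) (fun s => adExp (-s) (Z t) V m) 0 1 volume
  have hint : ∫ s in (0 : ℝ)..1, H (t, s) = chartDeriv E m m k := by
    refine Eq.trans ?_ ((chartDeriv E m m).intervalIntegral_comp_comm
      ((hAd.comp continuous_neg).intervalIntegrable 0 1))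
    refine intervalIntegral.integral_congr fun s _ => ?_
    simp only [H, hqt]
    exact trivializationAt_snd_eq_mfderiv (mem_chart_source E m) _
  rw [hint] at hder
  have hmd : MDifferentiableWithinAt 𝓘(ℝ, ℝ) 𝓘(ℝ, E) (fun τ => κ τ 1) J t := by
    have h1 : ContMDiffOn 𝓘(ℝ, ℝ) 𝓘(ℝ, E) 1 (fun τ => expFlow 1 (Z τ) m) J :=
      hfam.comp (contMDiff_id.prodMk contMDiff_const).contMDiffOn fun τ hτ => ⟨hτ, mem_univ (1 : ℝ)⟩
    exact (mdifferentiableAt_expFlow hZt hct (-1) _).comp_mdifferentiableWithinAt t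
      ((h1 t ht).mdifferentiableWithinAt one_ne_zero)
  have hvel := hasVelocityWithin_of_chart (σ := fun τ => κ τ 1) (hκt 1) hmd (hJu t ht) hder
  refine (hvel.comp_mfderiv (mdifferentiableAt_expFlow hZt hct 1 _)).cast ?_ ?_
  · funext τ
    simp only [κ]
    rw [expFlow_expFlow hZt hct, neg_add_cancel, expFlow_zero hct]
  · have h1 : mfderiv 𝓘(ℝ, E) 𝓘(ℝ, E) (expFlow 1 (Z t)) (κ t 1) = (mfderiv 𝓘(ℝ, E) 𝓘(ℝ, E)
        (expFlow 1 (Z t)) m : E →L[ℝ] E) :=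
      congrArg (β := E →L[ℝ] E) (fun x => mfderiv 𝓘(ℝ, E) 𝓘(ℝ, E) (expFlow 1 (Z t)) x) (hκt 1)
    let A : E →L[ℝ] E := mfderiv 𝓘(ℝ, E) 𝓘(ℝ, E) (expFlow 1 (Z t)) m
    have h2 : A k = fieldW J Z t (expFlow 1 (Z t) m) := by
      rw [fieldW_eq hJu hZ ht hct]
      have h3 : k = intervalIntegral (E := E) (fun s => adExp (s - 1) (Z t) V m) 0 1 volume := by
        have h4 := intervalIntegral.integral_comp_sub_left (E := E) (a := 0) (b := 1)
          (fun s => adExp (-s) (Z t) V m) 1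
        simp only [sub_self, sub_zero, neg_sub] at h4
        exact h4.symm
      have h6 : Continuous fun s : ℝ => s - 1 := by fun_prop
      refine (congrArg A h3).trans ((A.intervalIntegral_comp_comm
        ((hAd.comp h6).intervalIntegrable 0 1)).symm.trans ?_)
      refine intervalIntegral.integral_congr fun s _ => ?_
      have h5 := adExp_add hZt hct V 1 (s - 1) m
      rw [add_sub_cancel] at h5
      exact h5.symm
    exact (congrArg (fun B : E →L[ℝ] E => B k) h1).trans h2

end ExponentialDerivative

/-! ### The metric and the Koszul expression in a chart -/

section MetricInChart
universe u
variable {E : Type u} [NormedAddCommGroup E] [NormedSpace ℝ E]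
  {M : Type*} [TopologicalSpace M] [ChartedSpace E M]

/-- The tangent vector at `p` with given coordinates in the chart at `x`. -/
def chartInv (x p : M) : E →L[ℝ] TangentSpace 𝓘(ℝ, E) p := (chartDeriv E x p).inverse

/-- The Riemannian metric, read in the chart at `x`, as a function of the coordinates. It is meaningful
on the target of the chart only. -/
def metricInChart [RiemannianBundle (fun m : M => TangentSpace 𝓘(ℝ, E) m)] (x : M) (y : E) :
    E →L[ℝ] E →L[ℝ] ℝ :=
  let p := (extChartAt 𝓘(ℝ, E) x).symm y
  (innerSL ℝ : TangentSpace 𝓘(ℝ, E) p →L[ℝ] TangentSpace 𝓘(ℝ, E) p →L[ℝ] ℝ).bilinearComp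
    (chartInv x p) (chartInv x p)

theorem metricInChart_apply [RiemannianBundle (fun m : M => TangentSpace 𝓘(ℝ, E) m)] (x : M)
    (y u w : E) : metricInChart x y u w =
      inner ℝ (chartInv x ((extChartAt 𝓘(ℝ, E) x).symm y) u)
        (chartInv x ((extChartAt 𝓘(ℝ, E) x).symm y) w) := rfl

/-- A vector field, read in the chart at `x`, as a function of the coordinates; `fieldInChart` without
the time. -/
def chartRep (x : M) (V : ∀ m : M, TangentSpace 𝓘(ℝ, E) m) (y : E) : E :=
  chartDeriv E x ((extChartAt 𝓘(ℝ, E) x).symm y) (V ((extChartAt 𝓘(ℝ, E) x).symm y))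

theorem chartRep_extChartAt {x m : M} (hm : m ∈ (chartAt E x).source)
    (V : ∀ m : M, TangentSpace 𝓘(ℝ, E) m) :
    chartRep x V (extChartAt 𝓘(ℝ, E) x m) = chartDeriv E x m (V m) :=
  fieldInChart_extChartAt hm (fun _ => V) 0

variable [IsManifold 𝓘(ℝ, E) ∞ M]

theorem metricInChart_extChartAt [RiemannianBundle (fun m : M => TangentSpace 𝓘(ℝ, E) m)] {x m : M}
    (hm : m ∈ (chartAt E x).source) (v w : TangentSpace 𝓘(ℝ, E) m) :
    metricInChart x (extChartAt 𝓘(ℝ, E) x m) (chartDeriv E x m v) (chartDeriv E x m w) =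
      inner ℝ v w := by
  have h : (extChartAt 𝓘(ℝ, E) x).symm (extChartAt 𝓘(ℝ, E) x m) = m :=
    (extChartAt 𝓘(ℝ, E) x).left_inv (by rwa [extChartAt_source])
  have aux : ∀ p : M, p = m → inner ℝ (chartInv x p (chartDeriv E x m v))
      (chartInv x p (chartDeriv E x m w)) = inner ℝ v w := by
    rintro p rfl
    have h1 := inverse_chartDeriv_apply hm v
    have h2 := inverse_chartDeriv_apply hm w
    exact congrArg₂ (fun a b : TangentSpace 𝓘(ℝ, E) p => inner ℝ a b) h1 h2
  exact aux _ h

theorem contDiffOn_metricInChart [FiniteDimensional ℝ E]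
    [RiemannianBundle (fun m : M => TangentSpace 𝓘(ℝ, E) m)]
    [IsContMDiffRiemannianBundle 𝓘(ℝ, E) ∞ E (fun m : M => TangentSpace 𝓘(ℝ, E) m)] (x : M) :
    ContDiffOn ℝ ∞ (metricInChart (E := E) x) (extChartAt 𝓘(ℝ, E) x).target := by
  set χ := extChartAt 𝓘(ℝ, E) x with hχ
  have hsec : ∀ u : E, ContMDiffOn 𝓘(ℝ, E) 𝓘(ℝ, E).tangent ∞ (fun y : E =>
      (⟨χ.symm y, chartInv x (χ.symm y) u⟩ : TangentBundle 𝓘(ℝ, E) M)) χ.target := by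
    intro u
    have hs : ∀ y ∈ χ.target, χ.symm y ∈ (chartAt E x).source := fun y hy => by
      rw [← extChartAt_source 𝓘(ℝ, E)]
      exact χ.map_target hy
    refine ((trivializationAt E (TangentSpace 𝓘(ℝ, E)) x).contMDiffOn_iff (IB := 𝓘(ℝ, E)) (n := ∞)
      (IM := 𝓘(ℝ, E)) (s := χ.target) (fun y hy => by
        simpa using hs y hy)).2 ⟨contMDiffOn_extChartAt_symm x, ?_⟩
    refine (contMDiffOn_const (c := u)).congr fun y hy => ?_
    exact (trivializationAt_snd_eq_mfderiv (hs y hy) _).trans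
      (chartDeriv_inverse_apply (hs y hy) u)
  refine contDiffOn_clm_apply.2 fun u => contDiffOn_clm_apply.2 fun w => ?_
  exact contMDiffOn_iff_contDiffOn.1 (ContMDiffOn.inner_bundle (IB := 𝓘(ℝ, E))
    (E := fun m : M => TangentSpace 𝓘(ℝ, E) m) (b := χ.symm)
    (v := fun y => chartInv x (χ.symm y) u) (w := fun y => chartInv x (χ.symm y) w)
    (hsec u) (hsec w))

theorem contDiffAt_metricInChart [FiniteDimensional ℝ E]
    [RiemannianBundle (fun m : M => TangentSpace 𝓘(ℝ, E) m)]
    [IsContMDiffRiemannianBundle 𝓘(ℝ, E) ∞ E (fun m : M => TangentSpace 𝓘(ℝ, E) m)] {x m : M}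
    (hm : m ∈ (chartAt E x).source) :
    ContDiffAt ℝ ∞ (metricInChart (E := E) x) (extChartAt 𝓘(ℝ, E) x m) :=
  (contDiffOn_metricInChart x).contDiffAt ((isOpen_extChartAt_target x).mem_nhds
    ((extChartAt 𝓘(ℝ, E) x).map_source (by rwa [extChartAt_source])))

theorem differentiableAt_chartRep {x m : M} (hm : m ∈ (chartAt E x).source)
    {V : ∀ m : M, TangentSpace 𝓘(ℝ, E) m}
    (hV : MDifferentiableAt 𝓘(ℝ, E) 𝓘(ℝ, E).tangent
      (fun m : M => (⟨m, V m⟩ : TangentBundle 𝓘(ℝ, E) M)) m) :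
    DifferentiableAt ℝ (chartRep x V) (extChartAt 𝓘(ℝ, E) x m) := by
  set χ := extChartAt 𝓘(ℝ, E) x with hχ
  have hms : m ∈ χ.source := by rwa [hχ, extChartAt_source]
  have htn : χ.target ∈ 𝓝 (χ m) := (isOpen_extChartAt_target x).mem_nhds (χ.map_source hms)
  have h1 : MDifferentiableAt 𝓘(ℝ, E) 𝓘(ℝ, E) χ.symm (χ m) :=
    ((contMDiffOn_extChartAt_symm (n := ∞) x).contMDiffAt htn).mdifferentiableAt (by simp)
  have hV' : MDifferentiableAt 𝓘(ℝ, E) 𝓘(ℝ, E).tangent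
      (fun m : M => (⟨m, V m⟩ : TangentBundle 𝓘(ℝ, E) M)) (χ.symm (χ m)) := by
    rwa [χ.left_inv hms]
  have h2 := hV'.comp (χ m) h1
  have h3 := (((trivializationAt E (TangentSpace 𝓘(ℝ, E)) x).mdifferentiableAt_totalSpace_iff
    𝓘(ℝ, E) _ (by simpa [χ.left_inv hms] using hm)).1 h2).2
  refine (mdifferentiableAt_iff_differentiableAt.1 h3).congr_of_eventuallyEq ?_
  filter_upwards [htn] with y hy
  refine (trivializationAt_snd_eq_mfderiv ?_ _).symm
  rw [← extChartAt_source 𝓘(ℝ, E)]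
  exact χ.map_target hy

/-- Derivatives of functions on the manifold, computed in a chart. -/
theorem mvfderiv_eq_fderiv {x m : M} (hm : m ∈ (chartAt E x).source) {φ : M → ℝ} {h : E → ℝ}
    (hφ : ∀ p ∈ (chartAt E x).source, φ p = h (extChartAt 𝓘(ℝ, E) x p))
    (hh : DifferentiableAt ℝ h (extChartAt 𝓘(ℝ, E) x m)) (v : TangentSpace 𝓘(ℝ, E) m) :
    mvfderiv 𝓘(ℝ, E) φ m v = fderiv ℝ h (extChartAt 𝓘(ℝ, E) x m) (chartDeriv E x m v) := by
  have h1 := hh.hasFDerivAt.hasMFDerivAt.comp m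
    (mdifferentiableAt_extChartAt (I := 𝓘(ℝ, E)) hm).hasMFDerivAt
  have h2 := h1.congr_of_eventuallyEq (f₁ := φ) (by
    filter_upwards [(chartAt E x).open_source.mem_nhds hm] with p hp using hφ p hp)
  exact congrFun (congrArg DFunLike.coe h2.mfderiv) v

theorem inverse_mfderiv_extChartAt_symm {x : M} {y : E} (hy : y ∈ (extChartAt 𝓘(ℝ, E) x).target) :
    (mfderiv 𝓘(ℝ, E) 𝓘(ℝ, E) (extChartAt 𝓘(ℝ, E) x).symm y).inverse =
      mfderiv 𝓘(ℝ, E) 𝓘(ℝ, E) (extChartAt 𝓘(ℝ, E) x) ((extChartAt 𝓘(ℝ, E) x).symm y) := by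
  have : IsManifold 𝓘(ℝ, E) 1 M := .of_le (n := ∞) (by simp)
  have h1 := mfderiv_extChartAt_comp_mfderivWithin_extChartAt_symm (I := 𝓘(ℝ, E)) hy
  have h2 := mfderivWithin_extChartAt_symm_comp_mfderiv_extChartAt (I := 𝓘(ℝ, E)) hy
  rw [ModelWithCorners.range_eq_univ, mfderivWithin_univ] at h1 h2
  exact ContinuousLinearMap.inverse_eq h2 h1

omit [IsManifold 𝓘(ℝ, E) ∞ M] in
theorem mlieBracket_modelSpace (V W : ∀ y : E, TangentSpace 𝓘(ℝ, E) y) (y : E) :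
    VectorField.mlieBracket (M := E) 𝓘(ℝ, E) V W y = VectorField.lieBracket (E := E) ℝ V W y := by
  have h := congrFun (VectorField.mlieBracketWithin_eq_lieBracketWithin (𝕜 := ℝ) (V := V) (W := W)
    (s := univ)) y
  rw [VectorField.mlieBracketWithin_univ] at h
  exact h.trans (congrFun (VectorField.lieBracketWithin_univ (𝕜 := ℝ) (E := E) (V := V) (W := W)) y)

/-- Lie brackets, computed in a chart. -/
theorem chartDeriv_mlieBracket [CompleteSpace E] {x m : M} (hm : m ∈ (chartAt E x).source)
    {V W : ∀ m : M, TangentSpace 𝓘(ℝ, E) m}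
    (hV : MDifferentiableAt 𝓘(ℝ, E) 𝓘(ℝ, E).tangent
      (fun m : M => (⟨m, V m⟩ : TangentBundle 𝓘(ℝ, E) M)) m)
    (hW : MDifferentiableAt 𝓘(ℝ, E) 𝓘(ℝ, E).tangent
      (fun m : M => (⟨m, W m⟩ : TangentBundle 𝓘(ℝ, E) M)) m) :
    chartDeriv E x m (VectorField.mlieBracket 𝓘(ℝ, E) V W m) =
      fderiv ℝ (chartRep x W) (extChartAt 𝓘(ℝ, E) x m) (chartDeriv E x m (V m)) -
        fderiv ℝ (chartRep x V) (extChartAt 𝓘(ℝ, E) x m) (chartDeriv E x m (W m)) := by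
  set χ := extChartAt 𝓘(ℝ, E) x with hχ
  have hms : m ∈ χ.source := by rwa [hχ, extChartAt_source]
  have hmt := χ.map_source hms
  have htn : χ.target ∈ 𝓝 (χ m) := (isOpen_extChartAt_target x).mem_nhds hmt
  have h1 : ContMDiffAt 𝓘(ℝ, E) 𝓘(ℝ, E) ∞ χ.symm (χ m) :=
    (contMDiffOn_extChartAt_symm (n := ∞) x).contMDiffAt htn
  have hi : χ.symm (χ m) = m := χ.left_inv hms
  have h2le : minSmoothness ℝ 2 ≤ ∞ := by
    rw [minSmoothness_of_isRCLikeNormedField]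
    exact ENat.LEInfty.out
  have : IsManifold 𝓘(ℝ, E) (minSmoothness ℝ 2) M := .of_le (n := ∞) h2le
  have h2 := VectorField.mpullback_mlieBracket (I := 𝓘(ℝ, E)) (I' := 𝓘(ℝ, E)) (n := ∞)
    (f := χ.symm) (x₀ := χ m) (V := V) (W := W) (by rwa [hi]) (by rwa [hi]) h1 h2le
  have hpull : ∀ U : ∀ m : M, TangentSpace 𝓘(ℝ, E) m,
      VectorField.mpullback 𝓘(ℝ, E) 𝓘(ℝ, E) χ.symm U =ᶠ[𝓝 (χ m)] chartRep x U := by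
    intro U
    filter_upwards [htn] with y hy
    rw [VectorField.mpullback_apply, inverse_mfderiv_extChartAt_symm hy]
    rfl
  have h3 : VectorField.mpullback 𝓘(ℝ, E) 𝓘(ℝ, E) χ.symm (VectorField.mlieBracket 𝓘(ℝ, E) V W) (χ m) =
      chartDeriv E x m (VectorField.mlieBracket 𝓘(ℝ, E) V W m) :=
    ((hpull _).eq_of_nhds).trans (chartRep_extChartAt hm _)
  have h4 := (hpull V).mlieBracket_vectorField_eq (hpull W)
  refine h3.symm.trans (h2.trans (h4.trans ((mlieBracket_modelSpace _ _ _).trans ?_)))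
  rw [VectorField.lieBracket, chartRep_extChartAt hm, chartRep_extChartAt hm]

/-- The Koszul expression in coordinates, as a bilinear form in its last two arguments, for a field
with value `f` and derivative `Df` at the given point. The derivatives of the other two fields cancel. -/
def koszulInChart [RiemannianBundle (fun m : M => TangentSpace 𝓘(ℝ, E) m)] (x : M) (y f : E)
    (Df : E →L[ℝ] E) : E →L[ℝ] E →L[ℝ] ℝ :=
  (fderiv ℝ (metricInChart (E := E) x) y).flip f + fderiv ℝ (metricInChart (E := E) x) y f
    - ((fderiv ℝ (metricInChart (E := E) x) y).flip f).flip + (2 : ℝ) • (metricInChart x y).comp Df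

omit [IsManifold 𝓘(ℝ, E) ∞ M] in
theorem koszulInChart_apply [RiemannianBundle (fun m : M => TangentSpace 𝓘(ℝ, E) m)] (x : M)
    (y f : E) (Df : E →L[ℝ] E) (v w : E) : koszulInChart x y f Df v w =
      fderiv ℝ (metricInChart (E := E) x) y v f w + fderiv ℝ (metricInChart (E := E) x) y f v w
        - fderiv ℝ (metricInChart (E := E) x) y w f v + 2 * metricInChart x y (Df v) w := rfl

/-- The Koszul expression depends only on the values at `m` of its last two arguments. -/
theorem koszul_eq_koszulInChart [FiniteDimensional ℝ E]
    [RiemannianBundle (fun m : M => TangentSpace 𝓘(ℝ, E) m)]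
    [IsContMDiffRiemannianBundle 𝓘(ℝ, E) ∞ E (fun m : M => TangentSpace 𝓘(ℝ, E) m)] {x m : M}
    (hm : m ∈ (chartAt E x).source) {X V W : ∀ m : M, TangentSpace 𝓘(ℝ, E) m}
    (hX : MDifferentiableAt 𝓘(ℝ, E) 𝓘(ℝ, E).tangent
      (fun m : M => (⟨m, X m⟩ : TangentBundle 𝓘(ℝ, E) M)) m)
    (hV : MDifferentiableAt 𝓘(ℝ, E) 𝓘(ℝ, E).tangent
      (fun m : M => (⟨m, V m⟩ : TangentBundle 𝓘(ℝ, E) M)) m)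
    (hW : MDifferentiableAt 𝓘(ℝ, E) 𝓘(ℝ, E).tangent
      (fun m : M => (⟨m, W m⟩ : TangentBundle 𝓘(ℝ, E) M)) m) :
    koszul X V W m = koszulInChart x (extChartAt 𝓘(ℝ, E) x m) (chartDeriv E x m (X m))
      (fderiv ℝ (chartRep x X) (extChartAt 𝓘(ℝ, E) x m)) (chartDeriv E x m (V m))
      (chartDeriv E x m (W m)) := by
  have hcomm : (fun p => inner ℝ (V p) (X p)) = fun p => inner ℝ (X p) (V p) := by
    funext p
    rw [real_inner_comm]
  set χ := extChartAt 𝓘(ℝ, E) x with hχ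
  have hG := ((contDiffAt_metricInChart (E := E) hm).differentiableAt (by simp)).hasFDerivAt
  have hinner : ∀ {Y U : ∀ m : M, TangentSpace 𝓘(ℝ, E) m},
      MDifferentiableAt 𝓘(ℝ, E) 𝓘(ℝ, E).tangent
        (fun m : M => (⟨m, Y m⟩ : TangentBundle 𝓘(ℝ, E) M)) m →
      MDifferentiableAt 𝓘(ℝ, E) 𝓘(ℝ, E).tangent
        (fun m : M => (⟨m, U m⟩ : TangentBundle 𝓘(ℝ, E) M)) m → ∀ v : TangentSpace 𝓘(ℝ, E) m,
      mvfderiv 𝓘(ℝ, E) (fun p => inner ℝ (Y p) (U p)) m v =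
        fderiv ℝ (metricInChart (E := E) x) (χ m) (chartDeriv E x m v) (chartDeriv E x m (Y m))
          (chartDeriv E x m (U m)) +
        metricInChart x (χ m) (fderiv ℝ (chartRep x Y) (χ m) (chartDeriv E x m v))
          (chartDeriv E x m (U m)) +
        metricInChart x (χ m) (chartDeriv E x m (Y m))
          (fderiv ℝ (chartRep x U) (χ m) (chartDeriv E x m v)) := by
    intro Y U hY hU v
    have h1 := (hG.clm_apply (differentiableAt_chartRep hm hY).hasFDerivAt).clm_apply
      (differentiableAt_chartRep hm hU).hasFDerivAt
    rw [mvfderiv_eq_fderiv hm (fun p hp => ?_) h1.differentiableAt v, h1.fderiv]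
    · simp only [chartRep_extChartAt hm, add_apply,
        ContinuousLinearMap.comp_apply, ContinuousLinearMap.flip_apply]
      ring
    · rw [chartRep_extChartAt hp, chartRep_extChartAt hp, metricInChart_extChartAt hp]
  rw [koszul, hcomm, hinner hX hW, hinner hV hW, hinner hX hV, ← metricInChart_extChartAt hm,
    ← metricInChart_extChartAt hm, ← metricInChart_extChartAt hm, chartDeriv_mlieBracket hm hV hX,
    chartDeriv_mlieBracket hm hV hW, chartDeriv_mlieBracket hm hX hW, koszulInChart_apply]
  have hsymm : ∀ u w : E, metricInChart x (χ m) u w = metricInChart x (χ m) w u := fun u w => by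
    rw [metricInChart_apply, metricInChart_apply, real_inner_comm]
  simp only [map_sub, sub_apply]
  rw [hsymm (chartDeriv E x m (X m)) (fderiv ℝ (chartRep x W) (χ m) (chartDeriv E x m (V m))),
    hsymm (chartDeriv E x m (V m)) (fderiv ℝ (chartRep x W) (χ m) (chartDeriv E x m (X m))),
    hsymm (chartDeriv E x m (X m)) (fderiv ℝ (chartRep x V) (χ m) (chartDeriv E x m (W m)))]
  ring

end MetricInChart

/-! ### The norm of the covariant derivative -/

section NormNabla
universe u
variable {E : Type u} [NormedAddCommGroup E] [NormedSpace ℝ E] [FiniteDimensional ℝ E]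
  {M : Type*} [TopologicalSpace M] [ChartedSpace E M] [IsManifold 𝓘(ℝ, E) ∞ M]
  [RiemannianBundle (fun m : M => TangentSpace 𝓘(ℝ, E) m)]
  [IsContMDiffRiemannianBundle 𝓘(ℝ, E) ∞ E (fun m : M => TangentSpace 𝓘(ℝ, E) m)]
  {x m : M} {X : ∀ m : M, TangentSpace 𝓘(ℝ, E) m}

/-- The Koszul form of `X` at `m`, in the chart at `x`. -/
def koszulFormAt (x : M) (X : ∀ m : M, TangentSpace 𝓘(ℝ, E) m) (m : M) : E →L[ℝ] E →L[ℝ] ℝ :=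
  koszulInChart x (extChartAt 𝓘(ℝ, E) x m) (chartDeriv E x m (X m))
    (fderiv ℝ (chartRep x X) (extChartAt 𝓘(ℝ, E) x m))

/-- The Levi-Civita derivative is characterised by the Koszul form: its defining sum in an orthonormal
basis gives the right inner product with every vector, as the Koszul form is linear in it. -/
theorem inner_leviCivita (hm : m ∈ (chartAt E x).source)
    (hX : MDifferentiableAt 𝓘(ℝ, E) 𝓘(ℝ, E).tangent
      (fun m : M => (⟨m, X m⟩ : TangentBundle 𝓘(ℝ, E) M)) m) (v w : TangentSpace 𝓘(ℝ, E) m) :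
    inner ℝ (leviCivita X m v) w =
      1 / 2 * koszulFormAt x X m (chartDeriv E x m v) (chartDeriv E x m w) := by
  have : IsManifold 𝓘(ℝ, E) 1 M := .of_le (n := ∞) (by simp)
  have hk : ∀ w : TangentSpace 𝓘(ℝ, E) m,
      koszul X (FiberBundle.extend E v) (FiberBundle.extend E w) m =
        koszulFormAt x X m (chartDeriv E x m v) (chartDeriv E x m w) := by
    intro w
    have h := koszul_eq_koszulInChart hm hX
      (V := (FiberBundle.extend E v : ∀ m : M, TangentSpace 𝓘(ℝ, E) m))
      (W := (FiberBundle.extend E w : ∀ m : M, TangentSpace 𝓘(ℝ, E) m))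
      (FiberBundle.mdifferentiableAt_extend ..) (FiberBundle.mdifferentiableAt_extend ..)
    rw [FiberBundle.extend_apply_self, FiberBundle.extend_apply_self] at h
    exact h
  let e := stdOrthonormalBasis ℝ (TangentSpace 𝓘(ℝ, E) m)
  let Λ : TangentSpace 𝓘(ℝ, E) m →ₗ[ℝ] ℝ :=
    { toFun := fun w => koszulFormAt x X m (chartDeriv E x m v) (chartDeriv E x m w)
      map_add' := fun a b => by
        exact ((koszulFormAt x X m (chartDeriv E x m v)).comp (chartDeriv E x m)).map_add a b
      map_smul' := fun a b => by
        exact ((koszulFormAt x X m (chartDeriv E x m v)).comp (chartDeriv E x m)).map_smul a b }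
  have h1 : Λ w = ∑ i, inner ℝ (e i) w * Λ (e i) := by
    conv_lhs => rw [← e.sum_repr' w]
    rw [map_sum]
    exact Finset.sum_congr rfl fun i _ => by rw [map_smul, smul_eq_mul]
  simp only [leviCivita, hk, sum_inner, inner_smul_left]
  change ∑ i, _ = 1 / 2 * Λ w
  rw [h1, Finset.mul_sum]
  refine Finset.sum_congr rfl fun i _ => ?_
  change (1 / 2 * Λ (e i)) * inner ℝ (e i) w = _
  ring

/-- The quotient `|K(u, w)| / (2 |u| |w|)` of a bilinear form `K` and a metric `G`. For the Koszul form
its supremum is the norm of `∇X`; being homogeneous, it can be taken over the unit sphere of the model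
space, which does not move with the point. -/
def formQuotient (G K : E →L[ℝ] E →L[ℝ] ℝ) (u w : E) : ℝ :=
  |K u w| / (2 * √(G u u) * √(G w w))

omit [FiniteDimensional ℝ E] [IsContMDiffRiemannianBundle 𝓘(ℝ, E) ∞ E (fun m : M => TangentSpace 𝓘(ℝ, E) m)] in
theorem sqrt_metricInChart (hm : m ∈ (chartAt E x).source) (v : TangentSpace 𝓘(ℝ, E) m) :
    √(metricInChart x (extChartAt 𝓘(ℝ, E) x m) (chartDeriv E x m v) (chartDeriv E x m v)) = ‖v‖ := by
  rw [metricInChart_extChartAt hm, real_inner_self_eq_norm_sq, Real.sqrt_sq (norm_nonneg v)]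

omit [FiniteDimensional ℝ E] in
theorem formQuotient_smul (G K : E →L[ℝ] E →L[ℝ] ℝ) {a b : ℝ} (ha : a ≠ 0) (hb : b ≠ 0) (u w : E) :
    formQuotient G K (a • u) (b • w) = formQuotient G K u w := by
  have h1 : ∀ (c : ℝ) (z : E), √(G (c • z) (c • z)) = |c| * √(G z z) := fun c z => by
    simp only [map_smul, smul_apply, smul_eq_mul]
    rw [← mul_assoc, ← sq, Real.sqrt_mul (sq_nonneg c), Real.sqrt_sq_eq_abs]
  have h2 : |K (a • u) (b • w)| = |a| * |b| * |K u w| := by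
    simp only [map_smul, smul_apply, smul_eq_mul, abs_mul]
    ring
  have ha' : |a| ≠ 0 := abs_ne_zero.2 ha
  have hb' : |b| ≠ 0 := abs_ne_zero.2 hb
  rw [formQuotient, formQuotient, h1, h1, h2]
  have h3 : 2 * (|a| * √(G u u)) * (|b| * √(G w w)) = |a| * |b| * (2 * √(G u u) * √(G w w)) := by ring
  rw [h3, mul_div_mul_left _ _ (mul_ne_zero ha' hb')]

/-- `|⟨∇_v X, w⟩|` in terms of the quotient of the Koszul form. -/
theorem abs_inner_leviCivita (hm : m ∈ (chartAt E x).source)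
    (hX : MDifferentiableAt 𝓘(ℝ, E) 𝓘(ℝ, E).tangent
      (fun m : M => (⟨m, X m⟩ : TangentBundle 𝓘(ℝ, E) M)) m) (v w : TangentSpace 𝓘(ℝ, E) m) :
    |inner ℝ (leviCivita X m v) w| = formQuotient (metricInChart x (extChartAt 𝓘(ℝ, E) x m))
      (koszulFormAt x X m) (chartDeriv E x m v) (chartDeriv E x m w) * ‖v‖ * ‖w‖ := by
  rw [inner_leviCivita hm hX, formQuotient, sqrt_metricInChart hm, sqrt_metricInChart hm, abs_mul]
  by_cases hv : ‖v‖ = 0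
  · have h1 : v = 0 := norm_eq_zero.1 hv
    have h2 : chartDeriv E x m v = 0 := by
      rw [h1]; exact map_zero (chartDeriv E x m)
    rw [h2]
    simp
  by_cases hw : ‖w‖ = 0
  · have h1 : w = 0 := norm_eq_zero.1 hw
    have h2 : chartDeriv E x m w = 0 := by
      rw [h1]; exact map_zero (chartDeriv E x m)
    rw [h2]
    simp
  field_simp
  norm_num

omit [FiniteDimensional ℝ E] in
theorem continuous_formQuotient {P : Type*} [TopologicalSpace P] {G K : P → E →L[ℝ] E →L[ℝ] ℝ}
    (hG : Continuous G) (hK : Continuous fun q : P × (E × E) => K q.1 q.2.1 q.2.2)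
    (hpos : ∀ p, ∀ u : E, u ≠ 0 → 0 < G p u u) :
    Continuous fun q : P × (Metric.sphere (0 : E) 1 × Metric.sphere (0 : E) 1) =>
      formQuotient (G q.1) (K q.1) q.2.1 q.2.2 := by
  have hne : ∀ (p : P) (u : Metric.sphere (0 : E) 1), √(G p u u) ≠ 0 := fun p u =>
    (Real.sqrt_pos.2 (hpos p u (ne_zero_of_mem_unit_sphere u))).ne'
  refine Continuous.div ?_ ?_ fun q => by
    have h1 := hne q.1 q.2.1
    have h2 := hne q.1 q.2.2
    positivity
  · have h : Continuous fun q : P × (Metric.sphere (0 : E) 1 × Metric.sphere (0 : E) 1) =>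
        (q.1, ((q.2.1 : E), (q.2.2 : E))) := by fun_prop
    exact (hK.comp h).abs
  · fun_prop

theorem continuous_sSup_formQuotient {P : Type*} [TopologicalSpace P] {G K : P → E →L[ℝ] E →L[ℝ] ℝ}
    (hG : Continuous G) (hK : Continuous fun q : P × (E × E) => K q.1 q.2.1 q.2.2)
    (hpos : ∀ p, ∀ u : E, u ≠ 0 → 0 < G p u u) :
    Continuous fun p => sSup (range fun q : Metric.sphere (0 : E) 1 × Metric.sphere (0 : E) 1 =>
      formQuotient (G p) (K p) q.1 q.2) := by
  have h := IsCompact.continuous_sSup (isCompact_univ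
    (X := Metric.sphere (0 : E) 1 × Metric.sphere (0 : E) 1))
    (f := fun p (q : Metric.sphere (0 : E) 1 × Metric.sphere (0 : E) 1) =>
      formQuotient (G p) (K p) q.1 q.2) (continuous_formQuotient hG hK hpos)
  simpa only [image_univ] using h

omit [FiniteDimensional ℝ E]
  [IsContMDiffRiemannianBundle 𝓘(ℝ, E) ∞ E (fun m : M => TangentSpace 𝓘(ℝ, E) m)] in
theorem metricInChart_pos (hm : m ∈ (chartAt E x).source) {u : E} (hu : u ≠ 0) :
    0 < metricInChart x (extChartAt 𝓘(ℝ, E) x m) u u := by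
  have h1 := chartDeriv_inverse_apply hm u
  let v : TangentSpace 𝓘(ℝ, E) m := chartInv x m u
  have h2 : chartDeriv E x m v = u := h1
  have h3 := metricInChart_extChartAt hm v v
  rw [h2, real_inner_self_eq_norm_sq] at h3
  rw [h3]
  have hv : v ≠ 0 := fun h => hu (by rw [← h2, h]; exact map_zero (chartDeriv E x m))
  have := norm_pos_iff.2 hv
  positivity

omit [IsContMDiffRiemannianBundle 𝓘(ℝ, E) ∞ E (fun m : M => TangentSpace 𝓘(ℝ, E) m)] in
theorem bddAbove_formQuotient (hm : m ∈ (chartAt E x).source) (K : E →L[ℝ] E →L[ℝ] ℝ) :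
    BddAbove (range fun q : Metric.sphere (0 : E) 1 × Metric.sphere (0 : E) 1 =>
      formQuotient (metricInChart x (extChartAt 𝓘(ℝ, E) x m)) K q.1 q.2) := by
  have h := continuous_formQuotient (P := Unit) (G := fun _ => metricInChart x (extChartAt 𝓘(ℝ, E) x m))
    (K := fun _ => K) continuous_const (by fun_prop) fun _ u hu => metricInChart_pos hm hu
  exact (isCompact_range (h.comp (Continuous.prodMk_right ()))).bddAbove

theorem abs_inner_leviCivita_le_sSup (hm : m ∈ (chartAt E x).source)
    (hX : MDifferentiableAt 𝓘(ℝ, E) 𝓘(ℝ, E).tangent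
      (fun m : M => (⟨m, X m⟩ : TangentBundle 𝓘(ℝ, E) M)) m) (v w : TangentSpace 𝓘(ℝ, E) m) :
    |inner ℝ (leviCivita X m v) w| ≤
      sSup (range fun q : Metric.sphere (0 : E) 1 × Metric.sphere (0 : E) 1 =>
        formQuotient (metricInChart x (extChartAt 𝓘(ℝ, E) x m)) (koszulFormAt x X m) q.1 q.2)
        * ‖v‖ * ‖w‖ := by
  rw [abs_inner_leviCivita hm hX]
  have hinj : ∀ v : TangentSpace 𝓘(ℝ, E) m, v ≠ 0 → chartDeriv E x m v ≠ 0 := fun v hv h => by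
    refine hv ?_
    have h1 := inverse_chartDeriv_apply hm v
    rw [h, map_zero] at h1
    exact h1.symm
  by_cases hv : v = 0
  · simp [hv]
  by_cases hw : w = 0
  · simp [hw]
  gcongr
  have hu := norm_ne_zero_iff.2 (hinj v hv)
  have hz := norm_ne_zero_iff.2 (hinj w hw)
  rw [← formQuotient_smul _ _ (inv_ne_zero hu) (inv_ne_zero hz)]
  refine le_csSup (bddAbove_formQuotient hm _) ⟨(⟨_, ?_⟩, ⟨_, ?_⟩), rfl⟩
  · rw [mem_sphere_zero_iff_norm, norm_smul, norm_inv, norm_norm, inv_mul_cancel₀ hu]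
  · rw [mem_sphere_zero_iff_norm, norm_smul, norm_inv, norm_norm, inv_mul_cancel₀ hz]

/-- The bound on the norm, from pairing `∇_v X` with itself. -/
theorem norm_leviCivita_le_sSup (hm : m ∈ (chartAt E x).source)
    (hX : MDifferentiableAt 𝓘(ℝ, E) 𝓘(ℝ, E).tangent
      (fun m : M => (⟨m, X m⟩ : TangentBundle 𝓘(ℝ, E) M)) m) (v : TangentSpace 𝓘(ℝ, E) m) :
    ‖leviCivita X m v‖ ≤
      sSup (range fun q : Metric.sphere (0 : E) 1 × Metric.sphere (0 : E) 1 =>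
        formQuotient (metricInChart x (extChartAt 𝓘(ℝ, E) x m)) (koszulFormAt x X m) q.1 q.2)
        * ‖v‖ := by
  have h := abs_inner_leviCivita_le_sSup hm hX v (leviCivita X m v)
  rw [real_inner_self_eq_norm_sq, abs_of_nonneg (sq_nonneg _), sq] at h
  by_cases h0 : ‖leviCivita X m v‖ = 0
  · rw [h0]
    refine mul_nonneg (Real.sSup_nonneg ?_) (norm_nonneg v)
    rintro _ ⟨q, rfl⟩
    simp only [formQuotient]
    positivity
  · exact le_of_mul_le_mul_right h (lt_of_le_of_ne (norm_nonneg _) (Ne.symm h0))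

/-- The norm of `∇X` as the supremum of a continuous function over a fixed compact set. -/
theorem normNabla_eq_sSup (hm : m ∈ (chartAt E x).source)
    (hX : MDifferentiableAt 𝓘(ℝ, E) 𝓘(ℝ, E).tangent
      (fun m : M => (⟨m, X m⟩ : TangentBundle 𝓘(ℝ, E) M)) m) :
    normNabla X m =
      sSup (range fun q : Metric.sphere (0 : E) 1 × Metric.sphere (0 : E) 1 =>
        formQuotient (metricInChart x (extChartAt 𝓘(ℝ, E) x m)) (koszulFormAt x X m) q.1 q.2) := by
  have hnn : ∀ q : Metric.sphere (0 : E) 1 × Metric.sphere (0 : E) 1,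
      0 ≤ formQuotient (metricInChart x (extChartAt 𝓘(ℝ, E) x m)) (koszulFormAt x X m) q.1 q.2 :=
    fun q => by simp only [formQuotient]; positivity
  have hle : ∀ v : Metric.sphere (0 : TangentSpace 𝓘(ℝ, E) m) 1, ‖leviCivita X m v‖ ≤
      sSup (range fun q : Metric.sphere (0 : E) 1 × Metric.sphere (0 : E) 1 =>
        formQuotient (metricInChart x (extChartAt 𝓘(ℝ, E) x m)) (koszulFormAt x X m) q.1 q.2) :=
    fun v => by
      have h := norm_leviCivita_le_sSup hm hX (v : TangentSpace 𝓘(ℝ, E) m)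
      rwa [norm_eq_of_mem_sphere, mul_one] at h
  refine le_antisymm (Real.iSup_le hle (Real.sSup_nonneg ?_)) (Real.sSup_le ?_ ?_)
  · rintro _ ⟨q, rfl⟩
    exact hnn q
  · rintro _ ⟨⟨⟨u, hu⟩, ⟨w, hw⟩⟩, rfl⟩
    simp only
    let v : TangentSpace 𝓘(ℝ, E) m := chartInv x m u
    let z : TangentSpace 𝓘(ℝ, E) m := chartInv x m w
    have hv : chartDeriv E x m v = u := chartDeriv_inverse_apply hm u
    have hz : chartDeriv E x m z = w := chartDeriv_inverse_apply hm w
    have hne : ∀ u ∈ Metric.sphere (0 : E) 1, chartInv x m u ≠ 0 := fun u hu h => by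
      have h1 : chartDeriv E x m (chartInv x m u) = u := chartDeriv_inverse_apply hm u
      rw [h] at h1
      have h2 : u = 0 := h1.symm.trans (map_zero (chartDeriv E x m))
      rw [h2] at hu
      simp at hu
    have hv0 : ‖v‖ ≠ 0 := norm_ne_zero_iff.2 (hne u hu)
    have hz0 : ‖z‖ ≠ 0 := norm_ne_zero_iff.2 (hne w hw)
    have h1 := abs_inner_leviCivita hm hX (‖v‖⁻¹ • v) (‖z‖⁻¹ • z)
    have h2 : chartDeriv E x m (‖v‖⁻¹ • v) = ‖v‖⁻¹ • u := by
      rw [← hv]; exact map_smul (chartDeriv E x m) _ _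
    have h3 : chartDeriv E x m (‖z‖⁻¹ • z) = ‖z‖⁻¹ • w := by
      rw [← hz]; exact map_smul (chartDeriv E x m) _ _
    have h4 : ‖‖v‖⁻¹ • v‖ = 1 := by rw [norm_smul, norm_inv, norm_norm, inv_mul_cancel₀ hv0]
    have h5 : ‖‖z‖⁻¹ • z‖ = 1 := by rw [norm_smul, norm_inv, norm_norm, inv_mul_cancel₀ hz0]
    rw [h2, h3, formQuotient_smul _ _ (inv_ne_zero hv0) (inv_ne_zero hz0), h4, h5, mul_one, mul_one] at h1
    rw [← h1]
    refine (abs_real_inner_le_norm _ _).trans ?_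
    rw [h5, mul_one]
    exact le_ciSup (f := fun v : Metric.sphere (0 : TangentSpace 𝓘(ℝ, E) m) 1 => ‖leviCivita X m v‖)
      ⟨_, by rintro _ ⟨v, rfl⟩; exact hle v⟩ ⟨‖v‖⁻¹ • v, by rw [mem_sphere_zero_iff_norm, h4]⟩
  · exact Real.iSup_nonneg fun v => norm_nonneg _

theorem inner_leviCivita_self_le (hX : MDifferentiableAt 𝓘(ℝ, E) 𝓘(ℝ, E).tangent
      (fun m : M => (⟨m, X m⟩ : TangentBundle 𝓘(ℝ, E) M)) m) (v : TangentSpace 𝓘(ℝ, E) m) :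
    inner ℝ (leviCivita X m v) v ≤ normNabla X m * ‖v‖ ^ 2 := by
  have hm := mem_chart_source E m
  have h := (le_abs_self _).trans (abs_inner_leviCivita_le_sSup hm hX v v)
  rwa [← normNabla_eq_sSup hm hX, mul_assoc, ← sq] at h

omit [FiniteDimensional ℝ E] [RiemannianBundle (fun m : M => TangentSpace 𝓘(ℝ, E) m)]
  [IsContMDiffRiemannianBundle 𝓘(ℝ, E) ∞ E (fun m : M => TangentSpace 𝓘(ℝ, E) m)] in
/-- The spatial derivative of a time dependent field in a chart. -/
theorem IsSmoothTimeField.fderiv_chartRep {J : Set ℝ} {Y : ℝ → ∀ m : M, TangentSpace 𝓘(ℝ, E) m}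
    (hY : IsSmoothTimeField J Y) {t : ℝ} (ht : t ∈ J) {y : E}
    (hy : y ∈ (extChartAt 𝓘(ℝ, E) x).target) :
    HasFDerivAt (chartRep x (Y t)) ((fderivWithin ℝ (fieldInChart x Y)
      (J ×ˢ (extChartAt 𝓘(ℝ, E) x).target) (t, y)).comp (ContinuousLinearMap.inr ℝ ℝ E)) y := by
  have h1 := ((hY.contDiffOn_fieldInChart x).differentiableOn (by simp) (t, y)
    ⟨ht, hy⟩).hasFDerivWithinAt
  have h2 : HasFDerivWithinAt (fun z : E => ((t, z) : ℝ × E)) (ContinuousLinearMap.inr ℝ ℝ E)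
      (extChartAt 𝓘(ℝ, E) x).target y := (hasFDerivAt_prodMk_right t y).hasFDerivWithinAt
  have hmaps : MapsTo (fun z : E => ((t, z) : ℝ × E)) (extChartAt 𝓘(ℝ, E) x).target
      (J ×ˢ (extChartAt 𝓘(ℝ, E) x).target) := fun z hz => ⟨ht, hz⟩
  exact (h1.comp y h2 hmaps).hasFDerivAt ((isOpen_extChartAt_target x).mem_nhds hy)

theorem continuousOn_fderiv_metricInChart (x : M) :
    ContinuousOn (fun p : E × E => fderiv ℝ (metricInChart (E := E) x) p.1 p.2)
      ((extChartAt 𝓘(ℝ, E) x).target ×ˢ univ) := by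
  have ho := isOpen_extChartAt_target (I := 𝓘(ℝ, E)) x
  refine ((contDiffOn_metricInChart x).continuousOn_fderivWithin_apply ho.uniqueDiffOn
    (by simp)).congr fun p hp => ?_
  exact congrArg (fun L : E →L[ℝ] E →L[ℝ] E →L[ℝ] ℝ => L p.2) (fderivWithin_of_isOpen ho hp.1).symm

/-- The Koszul form of a time dependent field is jointly continuous in time, position and the two
vectors. -/
theorem IsSmoothTimeField.continuous_koszulFormAt {J : Set ℝ} (hJ : UniqueDiffOn ℝ J)
    {Y : ℝ → ∀ m : M, TangentSpace 𝓘(ℝ, E) m} (hY : IsSmoothTimeField J Y) (x : M) :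
    Continuous fun q : ↥(J ×ˢ (chartAt E x).source) × (E × E) =>
      koszulFormAt x (Y q.1.1.1) q.1.1.2 q.2.1 q.2.2 := by
  let y : ↥(J ×ˢ (chartAt E x).source) × (E × E) → E := fun q => extChartAt 𝓘(ℝ, E) x q.1.1.2
  have hsrc : ∀ q : ↥(J ×ˢ (chartAt E x).source) × (E × E), q.1.1.2 ∈ (extChartAt 𝓘(ℝ, E) x).source :=
    fun q => by rw [extChartAt_source]; exact q.1.2.2
  have hmem : ∀ q : ↥(J ×ˢ (chartAt E x).source) × (E × E), y q ∈ (extChartAt 𝓘(ℝ, E) x).target :=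
    fun q => (extChartAt 𝓘(ℝ, E) x).map_source (hsrc q)
  have hy : Continuous y := (continuousOn_extChartAt x).comp_continuous (by fun_prop) hsrc
  have hty : Continuous fun q : ↥(J ×ˢ (chartAt E x).source) × (E × E) =>
      ((q.1.1.1, y q) : ℝ × E) :=
    Continuous.prodMk (by fun_prop) hy
  have hmem' : ∀ q : ↥(J ×ˢ (chartAt E x).source) × (E × E),
      ((q.1.1.1, y q) : ℝ × E) ∈ J ×ˢ (extChartAt 𝓘(ℝ, E) x).target :=
    fun q => ⟨q.1.2.1, hmem q⟩
  have hf : Continuous fun q : ↥(J ×ˢ (chartAt E x).source) × (E × E) =>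
      fieldInChart x Y (q.1.1.1, y q) :=
    (hY.contDiffOn_fieldInChart x).continuousOn.comp_continuous hty hmem'
  have hDf : Continuous fun q : ↥(J ×ˢ (chartAt E x).source) × (E × E) =>
      fderivWithin ℝ (fieldInChart x Y) (J ×ˢ (extChartAt 𝓘(ℝ, E) x).target) (q.1.1.1, y q) :=
    ((hY.contDiffOn_fieldInChart x).continuousOn_fderivWithin
      (hJ.prod (isOpen_extChartAt_target x).uniqueDiffOn) (by simp)).comp_continuous hty hmem'
  have hG : Continuous fun q : ↥(J ×ˢ (chartAt E x).source) × (E × E) =>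
      metricInChart (E := E) x (y q) :=
    (contDiffOn_metricInChart x).continuousOn.comp_continuous hy hmem
  have hDG : ∀ {a : ↥(J ×ˢ (chartAt E x).source) × (E × E) → E}, Continuous a →
      Continuous fun q : ↥(J ×ˢ (chartAt E x).source) × (E × E) =>
      fderiv ℝ (metricInChart (E := E) x) (y q) (a q) := fun ha =>
    (continuousOn_fderiv_metricInChart x).comp_continuous (hy.prodMk ha) fun q =>
      ⟨hmem q, mem_univ _⟩
  have hu : Continuous fun q : ↥(J ×ˢ (chartAt E x).source) × (E × E) => q.2.1 :=
    continuous_fst.comp continuous_snd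
  have hw : Continuous fun q : ↥(J ×ˢ (chartAt E x).source) × (E × E) => q.2.2 :=
    continuous_snd.comp continuous_snd
  have hinr : Continuous fun q : ↥(J ×ˢ (chartAt E x).source) × (E × E) =>
      ContinuousLinearMap.inr ℝ ℝ E q.2.1 :=
    (ContinuousLinearMap.inr ℝ ℝ E).continuous.comp hu
  have h := ((((hDG hu).clm_apply hf).clm_apply hw).add (((hDG hf).clm_apply hu).clm_apply hw)).sub
    (((hDG hw).clm_apply hf).clm_apply hu) |>.add
    (((hG.clm_apply (hDf.clm_apply hinr)).clm_apply hw).const_mul 2)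
  refine h.congr fun q => ?_
  have h1 := fieldInChart_extChartAt q.1.2.2 Y q.1.1.1
  have h2 : chartDeriv E x q.1.1.2 (Y q.1.1.1 q.1.1.2) = fieldInChart x Y (q.1.1.1, y q) := h1.symm
  rw [koszulFormAt, (hY.fderiv_chartRep q.1.2.1 (hmem q)).fderiv, koszulInChart_apply, h2]
  rfl

/-- `|∇X_t|` is jointly continuous in time and position. -/
theorem IsSmoothTimeField.continuousOn_normNabla {J : Set ℝ} (hJ : UniqueDiffOn ℝ J)
    {Y : ℝ → ∀ m : M, TangentSpace 𝓘(ℝ, E) m} (hY : IsSmoothTimeField J Y) :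
    ContinuousOn (fun p : ℝ × M => normNabla (Y p.1) p.2) (J ×ˢ univ) := by
  rintro ⟨t, x⟩ ⟨ht, -⟩
  let P := ↥(J ×ˢ (chartAt E x).source)
  have hsrc : ∀ p : P, p.1.2 ∈ (extChartAt 𝓘(ℝ, E) x).source := fun p => by
    rw [extChartAt_source]; exact p.2.2
  have hy : Continuous fun p : P => extChartAt 𝓘(ℝ, E) x p.1.2 :=
    (continuousOn_extChartAt x).comp_continuous (by fun_prop) hsrc
  let G : P → E →L[ℝ] E →L[ℝ] ℝ := fun p => metricInChart x (extChartAt 𝓘(ℝ, E) x p.1.2)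
  let K : P → E →L[ℝ] E →L[ℝ] ℝ := fun p => koszulFormAt x (Y p.1.1) p.1.2
  have hG : Continuous G :=
    (contDiffOn_metricInChart x).continuousOn.comp_continuous hy fun p =>
      (extChartAt 𝓘(ℝ, E) x).map_source (hsrc p)
  have hs := continuous_sSup_formQuotient (G := G) (K := K) hG (hY.continuous_koszulFormAt hJ x)
    fun p u hu => metricInChart_pos p.2.2 hu
  have h5 : ContinuousOn (fun p : ℝ × M => normNabla (Y p.1) p.2) (J ×ˢ (chartAt E x).source) := by
    rw [continuousOn_iff_continuous_domRestrict]
    refine hs.congr fun p => ?_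
    exact (normNabla_eq_sSup p.2.2 ((hY.isSmoothField p.2.1).mdifferentiable (by simp) _)).symm
  refine (h5 (t, x) ⟨ht, mem_chart_source E x⟩).mono_of_mem_nhdsWithin ?_
  filter_upwards [self_mem_nhdsWithin, nhdsWithin_le_nhds (continuousAt_snd.eventually
    ((chartAt E x).open_source.mem_nhds (mem_chart_source E x)))] with p hp1 hp2
  exact ⟨hp1.1, hp2⟩

end NormNabla

/-! ### The differential of the flow -/

section VariationOfFlow
universe u
variable {E : Type u} [NormedAddCommGroup E] [NormedSpace ℝ E]

/-- The linearised equation: if `∂_σ F = f ∘ F` at time `σ₀`, then the derivative `V` of `F` in a space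
direction satisfies `V' = Df V` there, because the second derivative of `F` is symmetric. -/
theorem hasDerivAt_fderiv_of_flow {F : ℝ × E → E} {f : E → E} {σ₀ : ℝ} {y₀ : E}
    (hF : ContDiffAt ℝ 2 F (σ₀, y₀)) (hf : DifferentiableAt ℝ f (F (σ₀, y₀)))
    (hFf : ∀ᶠ y in 𝓝 y₀, HasDerivAt (fun σ => F (σ, y)) (f (F (σ₀, y))) σ₀) (u : E) :
    HasDerivAt (fun σ => fderiv ℝ F (σ, y₀) (0, u))
      (fderiv ℝ f (F (σ₀, y₀)) (fderiv ℝ F (σ₀, y₀) (0, u))) σ₀ := by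
  have hF1 : DifferentiableAt ℝ F (σ₀, y₀) := hF.differentiableAt (by simp)
  have hF2 : DifferentiableAt ℝ (fderiv ℝ F) (σ₀, y₀) :=
    (hF.fderiv_right (m := 1) (by norm_num)).differentiableAt (by simp)
  have hev : ∀ᶠ p in 𝓝 ((σ₀, y₀) : ℝ × E), DifferentiableAt ℝ F p := by
    filter_upwards [hF.eventually (by simp)] with p hp using hp.differentiableAt (by simp)
  have hsymm := (hF.isSymmSndFDerivAt (by simp)).eq (1, 0) (0, u)
  have hσ : HasDerivAt (fun σ => fderiv ℝ F (σ, y₀)) (fderiv ℝ (fderiv ℝ F) (σ₀, y₀) (1, 0)) σ₀ := by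
    have h : HasDerivAt (fun σ : ℝ => (σ, y₀)) ((1, 0) : ℝ × E) σ₀ :=
      (hasDerivAt_id σ₀).prodMk (hasDerivAt_const σ₀ y₀)
    exact hF2.hasFDerivAt.comp_hasDerivAt σ₀ h
  have hy : HasFDerivAt (fun y : E => ((σ₀, y) : ℝ × E)) (ContinuousLinearMap.inr ℝ ℝ E) y₀ :=
    hasFDerivAt_prodMk_right σ₀ y₀
  have h1 : HasFDerivAt (fun y => fderiv ℝ F (σ₀, y) (1, 0))
      ((fderiv ℝ f (F (σ₀, y₀))).comp ((fderiv ℝ F (σ₀, y₀)).comp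
        (ContinuousLinearMap.inr ℝ ℝ E))) y₀ := by
    refine (hf.hasFDerivAt.comp y₀ (hF1.hasFDerivAt.comp y₀ hy)).congr_of_eventuallyEq ?_
    filter_upwards [hFf, (Continuous.prodMk_right σ₀).continuousAt.eventually hev] with y h2 h3
    have h4 : HasDerivAt (fun σ : ℝ => (σ, y)) ((1, 0) : ℝ × E) σ₀ :=
      (hasDerivAt_id σ₀).prodMk (hasDerivAt_const σ₀ y)
    exact (h3.hasFDerivAt.comp_hasDerivAt σ₀ h4).unique h2
  have h2 : HasFDerivAt (fun y => fderiv ℝ F (σ₀, y) (1, 0))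
      (((ContinuousLinearMap.apply ℝ E ((1, 0) : ℝ × E)).comp
        (fderiv ℝ (fderiv ℝ F) (σ₀, y₀))).comp (ContinuousLinearMap.inr ℝ ℝ E)) y₀ :=
    ((ContinuousLinearMap.apply ℝ E ((1, 0) : ℝ × E)).hasFDerivAt.comp _
      hF2.hasFDerivAt).comp y₀ hy
  have h3 := congrArg (fun L : E →L[ℝ] E => L u) (h1.unique h2)
  have h4 : fderiv ℝ (fderiv ℝ F) (σ₀, y₀) (1, 0) (0, u) =
      fderiv ℝ f (F (σ₀, y₀)) (fderiv ℝ F (σ₀, y₀) (0, u)) := by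
    rw [hsymm]
    exact h3.symm
  rw [← h4]
  exact hσ.clm_apply (hasDerivAt_const σ₀ ((0, u) : ℝ × E)) |>.congr_deriv (by simp)

theorem hasDerivAt_comp_fderiv {B : Type*} [NormedAddCommGroup B] [NormedSpace ℝ B] {G : E → B}
    {c : ℝ → E} {c' : E} {σ₀ : ℝ} (hG : DifferentiableAt ℝ G (c σ₀)) (hc : HasDerivAt c c' σ₀) :
    HasDerivAt (fun σ => G (c σ)) (fderiv ℝ G (c σ₀) c') σ₀ :=
  hG.hasFDerivAt.comp_hasDerivAt σ₀ hc

theorem hasDerivAt_bilinear_apply {g : ℝ → E →L[ℝ] E →L[ℝ] ℝ} {g' : E →L[ℝ] E →L[ℝ] ℝ} {V : ℝ → E}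
    {V' : E} {σ₀ : ℝ} (hg : HasDerivAt g g' σ₀) (hV : HasDerivAt V V' σ₀) :
    HasDerivAt (fun σ => g σ (V σ) (V σ))
      (g' (V σ₀) (V σ₀) + g σ₀ V' (V σ₀) + g σ₀ (V σ₀) V') σ₀ := by
  have h1 : HasDerivAt (fun σ => g σ (V σ)) (g' (V σ₀) + g σ₀ V') σ₀ := hg.clm_apply hV
  exact h1.clm_apply hV

theorem hasDerivAt_bilinear_curve {G : E → E →L[ℝ] E →L[ℝ] ℝ} {c V : ℝ → E} {c' V' : E} {σ₀ : ℝ}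
    (hG : DifferentiableAt ℝ G (c σ₀)) (hc : HasDerivAt c c' σ₀) (hV : HasDerivAt V V' σ₀) :
    HasDerivAt (fun σ => G (c σ) (V σ) (V σ))
      (fderiv ℝ G (c σ₀) c' (V σ₀) (V σ₀) + G (c σ₀) V' (V σ₀) + G (c σ₀) (V σ₀) V') σ₀ :=
  hasDerivAt_bilinear_apply (hasDerivAt_comp_fderiv (B := E →L[ℝ] E →L[ℝ] ℝ) (G := G) hG hc) hV

variable {M : Type*} [TopologicalSpace M] [ChartedSpace E M] [IsManifold 𝓘(ℝ, E) ∞ M]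

/-- The derivative in the manifold variable, read in charts. -/
theorem chartDeriv_mfderiv_slice {Φ : ℝ × M → M} {σ : ℝ} {x m : M}
    (hΦ : ContMDiffAt (𝓘(ℝ, ℝ).prod 𝓘(ℝ, E)) 𝓘(ℝ, E) 2 Φ (σ, x))
    (hm : Φ (σ, x) ∈ (chartAt E m).source)
    (hF : DifferentiableAt ℝ (fun p : ℝ × E => extChartAt 𝓘(ℝ, E) m
      (Φ (p.1, (extChartAt 𝓘(ℝ, E) x).symm p.2))) (σ, extChartAt 𝓘(ℝ, E) x x))
    (v : TangentSpace 𝓘(ℝ, E) x) :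
    chartDeriv E m (Φ (σ, x)) (mfderiv 𝓘(ℝ, E) 𝓘(ℝ, E) (fun y => Φ (σ, y)) x v) =
      fderiv ℝ (fun p : ℝ × E => extChartAt 𝓘(ℝ, E) m
      (Φ (p.1, (extChartAt 𝓘(ℝ, E) x).symm p.2))) (σ, extChartAt 𝓘(ℝ, E) x x)
        (0, chartDeriv E x x v) := by
  have : IsManifold 𝓘(ℝ, E) 1 M := .of_le (n := ∞) (by simp)
  have hs : MDifferentiableAt 𝓘(ℝ, E) 𝓘(ℝ, E) (fun y => Φ (σ, y)) x :=
    (hΦ.comp x (contMDiffAt_const.prodMk contMDiffAt_id)).mdifferentiableAt (by simp)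
  have h1 := (mdifferentiableAt_extChartAt (I := 𝓘(ℝ, E)) hm).hasMFDerivAt.comp x hs.hasMFDerivAt
  have hy : HasFDerivAt (fun y : E => ((σ, y) : ℝ × E)) (ContinuousLinearMap.inr ℝ ℝ E)
      (extChartAt 𝓘(ℝ, E) x x) := hasFDerivAt_prodMk_right σ _
  have h2 := (hF.hasFDerivAt.comp _ hy).hasMFDerivAt.comp x
    (mdifferentiableAt_extChartAt (I := 𝓘(ℝ, E)) (mem_chart_source E x)).hasMFDerivAt
  have h3 := h2.congr_of_eventuallyEq (f₁ := fun y => extChartAt 𝓘(ℝ, E) m (Φ (σ, y))) (by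
    filter_upwards [(chartAt E x).open_source.mem_nhds (mem_chart_source E x)] with y hy
    have h4 := (extChartAt 𝓘(ℝ, E) x).left_inv (by rwa [extChartAt_source])
    simp only [Function.comp_apply]
    rw [h4])
  exact congrFun (congrArg DFunLike.coe (hasMFDerivAt_unique h1 h3)) v

variable [FiniteDimensional ℝ E] [RiemannianBundle (fun m : M => TangentSpace 𝓘(ℝ, E) m)]
  [IsContMDiffRiemannianBundle 𝓘(ℝ, E) ∞ E (fun m : M => TangentSpace 𝓘(ℝ, E) m)]

omit [FiniteDimensional ℝ E] in
/-- Inner products of continuous fields along a curve are continuous. -/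
theorem continuousOn_inner_curve {J : Set ℝ} {σ : ℝ → M}
    {v w : ∀ t, TangentSpace 𝓘(ℝ, E) (σ t)}
    (hv : ContinuousOn (fun t => (⟨σ t, v t⟩ : TangentBundle 𝓘(ℝ, E) M)) J)
    (hw : ContinuousOn (fun t => (⟨σ t, w t⟩ : TangentBundle 𝓘(ℝ, E) M)) J) :
    ContinuousOn (fun t => inner ℝ (v t) (w t)) J := by
  have : IsContinuousRiemannianBundle E (fun m : M => TangentSpace 𝓘(ℝ, E) m) := by
    obtain ⟨g, hg, h⟩ := IsContMDiffRiemannianBundle.exists_contMDiff (IB := 𝓘(ℝ, E)) (n := ∞)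
      (F := E) (E := fun m : M => TangentSpace 𝓘(ℝ, E) m)
    exact ⟨g, hg.continuous, h⟩
  exact ContinuousOn.inner_bundle (F := E) (E := fun m : M => TangentSpace 𝓘(ℝ, E) m) hv hw

/-- Along a family of flow lines, the variation field `V` satisfies `(|V|²)' = 2⟨∇_V Y, V⟩`. Only the
velocities at the time `σ₀` enter. -/
theorem hasDerivAt_normSq_mfderiv {Φ : ℝ × M → M} {σ₀ : ℝ} {x : M}
    {Y : ∀ m : M, TangentSpace 𝓘(ℝ, E) m}
    (hΦ : ContMDiffAt (𝓘(ℝ, ℝ).prod 𝓘(ℝ, E)) 𝓘(ℝ, E) 2 Φ (σ₀, x))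
    (hY : MDifferentiableAt 𝓘(ℝ, E) 𝓘(ℝ, E).tangent
      (fun m : M => (⟨m, Y m⟩ : TangentBundle 𝓘(ℝ, E) M)) (Φ (σ₀, x)))
    (hΦY : ∀ y, HasVelocityWithin univ (fun σ => Φ (σ, y)) σ₀ (Y (Φ (σ₀, y))))
    (v : TangentSpace 𝓘(ℝ, E) x) :
    HasDerivAt (fun σ => ‖(mfderiv 𝓘(ℝ, E) 𝓘(ℝ, E) (fun y => Φ (σ, y)) x v :
        TangentSpace 𝓘(ℝ, E) (Φ (σ, x)))‖ ^ 2)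
      (2 * inner ℝ (leviCivita Y (Φ (σ₀, x)) (mfderiv 𝓘(ℝ, E) 𝓘(ℝ, E) (fun y => Φ (σ₀, y)) x v))
        (mfderiv 𝓘(ℝ, E) 𝓘(ℝ, E) (fun y => Φ (σ₀, y)) x v : TangentSpace 𝓘(ℝ, E) (Φ (σ₀, x))))
      σ₀ := by
  set m := Φ (σ₀, x) with hm
  have hms : m ∈ (chartAt E m).source := mem_chart_source E m
  let F : ℝ × E → E := fun p => extChartAt 𝓘(ℝ, E) m (Φ (p.1, (extChartAt 𝓘(ℝ, E) x).symm p.2))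
  let y₀ := extChartAt 𝓘(ℝ, E) x x
  have hxy : (extChartAt 𝓘(ℝ, E) x).symm y₀ = x := extChartAt_to_inv x
  have htn : (extChartAt 𝓘(ℝ, E) x).target ∈ 𝓝 y₀ := extChartAt_target_mem_nhds x
  have hF : ContDiffAt ℝ 2 F (σ₀, y₀) := by
    have h1 : ContMDiffAt (𝓘(ℝ, ℝ).prod 𝓘(ℝ, E)) (𝓘(ℝ, ℝ).prod 𝓘(ℝ, E)) 2
        (fun p : ℝ × E => ((p.1, (extChartAt 𝓘(ℝ, E) x).symm p.2) : ℝ × M)) (σ₀, y₀) :=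
      contMDiffAt_fst.prodMk
        (((contMDiffOn_extChartAt_symm x).contMDiffAt htn).comp (σ₀, y₀) contMDiffAt_snd)
    have h2 : ContMDiffAt (𝓘(ℝ, ℝ).prod 𝓘(ℝ, E)) 𝓘(ℝ, E) 2
        (fun p : ℝ × E => Φ (p.1, (extChartAt 𝓘(ℝ, E) x).symm p.2)) (σ₀, y₀) :=
      ContMDiffAt.comp_of_eq hΦ h1 (by rw [hxy])
    have h3 : ContMDiffAt (𝓘(ℝ, ℝ).prod 𝓘(ℝ, E)) 𝓘(ℝ, E) 2 F (σ₀, y₀) :=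
      ContMDiffAt.comp_of_eq (contMDiffAt_extChartAt (x := m)) h2 (by simp only [hxy]; rfl)
    rw [← modelWithCornersSelf_prod, chartedSpaceSelf_prod] at h3
    exact h3.contDiffAt
  have hFx : ∀ σ, F (σ, y₀) = extChartAt 𝓘(ℝ, E) m (Φ (σ, x)) := fun σ => by
    simp only [F, hxy]
  have hF0 : F (σ₀, y₀) = extChartAt 𝓘(ℝ, E) m m := hFx σ₀
  have hσ : Filter.Tendsto (fun σ : ℝ => (σ, y₀)) (𝓝 σ₀) (𝓝 (σ₀, y₀)) :=
    (Continuous.prodMk_left y₀).continuousAt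
  have hσ' : Filter.Tendsto (fun σ : ℝ => (σ, x)) (𝓝 σ₀) (𝓝 (σ₀, x)) :=
    (Continuous.prodMk_left x).continuousAt
  let V : ℝ → E := fun σ => fderiv ℝ F (σ, y₀) (0, chartDeriv E x x v)
  let w : ∀ σ, TangentSpace 𝓘(ℝ, E) (Φ (σ, x)) := fun σ =>
    mfderiv 𝓘(ℝ, E) 𝓘(ℝ, E) (fun y => Φ (σ, y)) x v
  have hsrc : ∀ᶠ σ in 𝓝 σ₀, Φ (σ, x) ∈ (chartAt E m).source :=
    hσ'.eventually (hΦ.continuousAt.eventually ((chartAt E m).open_source.mem_nhds hms))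
  have hVw : ∀ᶠ σ in 𝓝 σ₀, chartDeriv E m (Φ (σ, x)) (w σ) = V σ := by
    filter_upwards [hsrc, hσ'.eventually ((contMDiffAt_iff_contMDiffAt_nhds (by simp)).1 hΦ),
      hσ.eventually (hF.eventually (by simp))] with σ h1 h2 h3
    exact chartDeriv_mfderiv_slice h2 h1 (h3.differentiableAt (by simp)) v
  have hV0 : chartDeriv E m m (w σ₀) = V σ₀ := hVw.self_of_nhds
  have hNV : (fun σ => ‖w σ‖ ^ 2) =ᶠ[𝓝 σ₀] fun σ => metricInChart m (F (σ, y₀)) (V σ) (V σ) := by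
    filter_upwards [hVw, hsrc] with σ h1 h2
    rw [← h1, hFx, metricInChart_extChartAt h2, real_inner_self_eq_norm_sq]
  have hFd : ∀ y ∈ (extChartAt 𝓘(ℝ, E) x).target,
      Φ (σ₀, (extChartAt 𝓘(ℝ, E) x).symm y) ∈ (chartAt E m).source →
      HasDerivAt (fun σ => F (σ, y)) (chartRep m Y (F (σ₀, y))) σ₀ := by
    intro y hy h
    have h1 := (hΦY ((extChartAt 𝓘(ℝ, E) x).symm y)).hasDerivWithinAt_extChartAt h
    have h2 := (chartRep_extChartAt h Y).symm
    exact (h1.hasDerivAt Filter.univ_mem).congr_deriv h2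
  have hFf : ∀ᶠ y in 𝓝 y₀, HasDerivAt (fun σ => F (σ, y)) (chartRep m Y (F (σ₀, y))) σ₀ := by
    have h1 : ContinuousAt (fun y => Φ (σ₀, (extChartAt 𝓘(ℝ, E) x).symm y)) y₀ := by
      refine ContinuousAt.comp (g := Φ) (f := fun y => (σ₀, (extChartAt 𝓘(ℝ, E) x).symm y)) ?_
        (continuousAt_const.prodMk (continuousAt_extChartAt_symm x))
      rw [hxy]
      exact hΦ.continuousAt
    have h2 : (chartAt E m).source ∈ 𝓝 (Φ (σ₀, (extChartAt 𝓘(ℝ, E) x).symm y₀)) := by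
      rw [hxy]; exact (chartAt E m).open_source.mem_nhds hms
    filter_upwards [htn, h1.eventually h2] with y hy1 hy2
    exact hFd y hy1 hy2
  have hrep : chartRep m Y (F (σ₀, y₀)) = chartDeriv E m m (Y m) := by
    rw [hF0]; exact chartRep_extChartAt hms Y
  have hYd : DifferentiableAt ℝ (chartRep m Y) (F (σ₀, y₀)) := by
    rw [hF0]; exact differentiableAt_chartRep hms hY
  have hV := hasDerivAt_fderiv_of_flow hF hYd hFf (chartDeriv E x x v)
  have hG : DifferentiableAt ℝ (metricInChart (E := E) m) (F (σ₀, y₀)) := by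
    rw [hF0]; exact (contDiffAt_metricInChart hms).differentiableAt (by simp)
  refine HasDerivAt.congr_of_eventuallyEq ?_ hNV
  refine (hasDerivAt_bilinear_curve hG hFf.self_of_nhds hV).congr_deriv ?_
  have h5 := congrArg (fun r : ℝ => 2 * r) (inner_leviCivita hms hY (w σ₀) (w σ₀))
  refine Eq.trans ?_ h5.symm
  have hsymm : ∀ a b : E, metricInChart m (F (σ₀, y₀)) a b = metricInChart m (F (σ₀, y₀)) b a :=
    fun a b => by rw [metricInChart_apply, metricInChart_apply, real_inner_comm]
  -- the two terms of the Koszul form that differ by a swap cancel on the diagonal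
  have h6 : koszulFormAt m Y m (chartDeriv E m m (w σ₀)) (chartDeriv E m m (w σ₀)) =
      koszulInChart m (F (σ₀, y₀)) (chartRep m Y (F (σ₀, y₀)))
        (fderiv ℝ (chartRep m Y) (F (σ₀, y₀))) (V σ₀) (V σ₀) := by
    rw [hV0, hrep, hF0]; rfl
  refine Eq.trans ?_ (congrArg (fun r : ℝ => 2 * (1 / 2 * r)) h6.symm)
  rw [koszulInChart_apply, hsymm (V σ₀)]
  ring

/-- The differential of a flow is bounded by the exponential of the integral of `|∇X|` along the flow
line, by Grönwall's argument for `|V|²`. The time `s` is not an endpoint, so that the flow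
is `C^2` at the times where it is differentiated. -/
theorem norm_mfderiv_flow_le [T2Space M] {T : ℝ} (hT : 0 < T)
    {X : ℝ → ∀ m : M, TangentSpace 𝓘(ℝ, E) m} (hX : IsSmoothTimeField (Icc 0 T) X)
    (hXc : IsCompleteField (Icc 0 T) X) {s t : ℝ} (hs : s ∈ Ioo 0 T) (hst : s ≤ t) (htT : t ≤ T)
    (x : M) (v : TangentSpace 𝓘(ℝ, E) x) :
    ‖(mfderiv 𝓘(ℝ, E) 𝓘(ℝ, E) (flow (Icc 0 T) X t s) x v :
        TangentSpace 𝓘(ℝ, E) (flow (Icc 0 T) X t s x))‖ ≤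
      Real.exp (∫ σ in s..t, normNabla (X σ) (flow (Icc 0 T) X σ s x)) * ‖v‖ := by
  have hsT : s ∈ Icc 0 T := ⟨hs.1.le, hs.2.le⟩
  have hI : Icc s t ⊆ Icc 0 T := Icc_subset_Icc hs.1.le htT
  let w : ∀ σ, TangentSpace 𝓘(ℝ, E) (flow (Icc 0 T) X σ s x) := fun σ =>
    mfderiv 𝓘(ℝ, E) 𝓘(ℝ, E) (flow (Icc 0 T) X σ s) x v
  let ν : ℝ → ℝ := fun σ => normNabla (X σ) (flow (Icc 0 T) X σ s x)
  have hflow : ContinuousOn (fun σ => flow (Icc 0 T) X σ s x) (Icc 0 T) := fun σ hσ =>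
    ((hXc.isFlowLine_flow hsT x).2 σ hσ).continuousWithinAt
  have hν : ContinuousOn ν (Icc s t) := by
    have hmaps : MapsTo (fun σ => (σ, flow (Icc 0 T) X σ s x)) (Icc 0 T)
        (Icc (0 : ℝ) T ×ˢ (univ : Set M)) := fun σ hσ => ⟨hσ, mem_univ _⟩
    exact ((hX.continuousOn_normNabla (uniqueDiffOn_Icc hT)).comp
      (continuousOn_id.prodMk hflow) hmaps).mono hI
  have hw : ContinuousOn (fun σ => ‖w σ‖ ^ 2) (Icc s t) := by
    have h1 : ContMDiffOn (𝓘(ℝ, ℝ).prod 𝓘(ℝ, E)) 𝓘(ℝ, E) 1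
        (fun q : ℝ × M => flow (Icc 0 T) X q.1 s q.2) (Icc 0 T ×ˢ univ) := by
      have hmaps : MapsTo (fun q : ℝ × M => (q.1, (s, q.2))) (Icc 0 T ×ˢ (univ : Set M))
          (Icc 0 T ×ˢ (Icc 0 T ×ˢ univ)) := fun q hq => ⟨hq.1, hsT, mem_univ _⟩
      exact ContMDiffOn.comp (contMDiffOn_flow (n := 1) one_ne_zero hXc (convex_Icc 0 T)
        (convex_Icc 0 T) subset_rfl (hX.hasLocalExtensions_Icc hT))
        (contMDiff_fst.prodMk (contMDiff_const.prodMk contMDiff_snd)).contMDiffOn hmaps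
    have h2 := (contMDiffOn_tangentMap_slice (k := 0) (uniqueDiffOn_Icc hT) h1
      (by norm_num)).continuousOn
    have hmaps : MapsTo (fun σ : ℝ => (σ, (⟨x, v⟩ : TangentBundle 𝓘(ℝ, E) M))) (Icc s t)
        (Icc 0 T ×ˢ univ) := fun σ hσ => ⟨hI hσ, mem_univ _⟩
    have h3 : ContinuousOn (fun σ => (⟨flow (Icc 0 T) X σ s x, w σ⟩ : TangentBundle 𝓘(ℝ, E) M))
        (Icc s t) := h2.comp (by fun_prop) hmaps
    refine (continuousOn_inner_curve h3 h3).congr fun σ _ => ?_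
    exact (real_inner_self_eq_norm_sq _).symm
  have hder : ∀ σ ∈ Ioo s t, HasDerivAt (fun σ => ‖w σ‖ ^ 2)
      (2 * inner ℝ (leviCivita (X σ) (flow (Icc 0 T) X σ s x) (w σ)) (w σ)) σ := by
    intro σ hσ
    have hσT : σ ∈ Ioo 0 T := ⟨hs.1.trans hσ.1, hσ.2.trans_le htT⟩
    have hsmooth := contMDiffOn_flow (n := 2) two_ne_zero hXc (convex_Icc 0 T) (convex_Ioo 0 T)
      Ioo_subset_Icc_self
      ((hX.mono Ioo_subset_Icc_self).hasLocalExtensions_of_isOpen 2 isOpen_Ioo)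
    have hΦ : ContMDiffAt (𝓘(ℝ, ℝ).prod 𝓘(ℝ, E)) 𝓘(ℝ, E) 2
        (fun q : ℝ × M => flow (Icc 0 T) X q.1 s q.2) (σ, x) := by
      have h1 : ContMDiffAt (𝓘(ℝ, ℝ).prod (𝓘(ℝ, ℝ).prod 𝓘(ℝ, E))) 𝓘(ℝ, E) 2
          (fun q : ℝ × (ℝ × M) => flow (Icc 0 T) X q.1 q.2.1 q.2.2) (σ, (s, x)) :=
        hsmooth.contMDiffAt (prod_mem_nhds (isOpen_Ioo.mem_nhds hσT)
          (prod_mem_nhds (isOpen_Ioo.mem_nhds hs) Filter.univ_mem))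
      exact ContMDiffAt.comp (g := fun q : ℝ × (ℝ × M) => flow (Icc 0 T) X q.1 q.2.1 q.2.2)
        (f := fun q : ℝ × M => (q.1, (s, q.2))) (σ, x) h1
        (contMDiffAt_fst.prodMk (contMDiffAt_const.prodMk contMDiffAt_snd))
    refine hasDerivAt_normSq_mfderiv hΦ
      ((hX.isSmoothField (Ioo_subset_Icc_self hσT)).mdifferentiable (by simp) _) (fun y => ?_) v
    exact HasMFDerivAt.hasMFDerivWithinAt (HasMFDerivWithinAt.hasMFDerivAt
      ((hXc.isFlowLine_flow hsT y).2 σ (Ioo_subset_Icc_self hσT)) (Icc_mem_nhds hσT.1 hσT.2))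
  let P : ℝ → ℝ := fun σ => ∫ r in s..σ, ν r
  have hint : ∀ σ ∈ Icc s t, IntervalIntegrable ν volume s σ := fun σ hσ =>
    (hν.mono (Icc_subset_Icc_right hσ.2)).intervalIntegrable_of_Icc hσ.1
  have hPc : ContinuousOn P (Icc s t) := by
    have h1 := intervalIntegral.continuousOn_primitive_interval (μ := volume) (f := ν) (a := s)
      (b := t) ((hν.integrableOn_Icc).mono_set (by rw [uIcc_of_le hst]))
    rwa [uIcc_of_le hst] at h1
  have hPd : ∀ σ ∈ Ioo s t, HasDerivAt P (ν σ) σ := fun σ hσ =>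
    intervalIntegral.integral_hasDerivAt_right (hint σ ⟨hσ.1.le, hσ.2.le⟩)
      ((hν.mono Ioo_subset_Icc_self).stronglyMeasurableAtFilter isOpen_Ioo σ hσ)
      (hν.continuousAt (Icc_mem_nhds hσ.1 hσ.2))
  -- the quantity that decreases
  have hanti : AntitoneOn (fun σ => ‖w σ‖ ^ 2 * Real.exp (-(2 * P σ))) (Icc s t) := by
    refine antitoneOn_of_hasDerivWithinAt_nonpos (convex_Icc s t)
      (f' := fun σ => 2 * inner ℝ (leviCivita (X σ) (flow (Icc 0 T) X σ s x) (w σ)) (w σ) *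
        Real.exp (-(2 * P σ)) + ‖w σ‖ ^ 2 * (Real.exp (-(2 * P σ)) * (-(2 * ν σ))))
      (hw.mul (Real.continuous_exp.comp_continuousOn (hPc.const_mul 2).neg)) ?_ ?_
    · rw [interior_Icc]
      intro σ hσ
      exact ((hder σ hσ).mul ((hPd σ hσ).const_mul 2).neg.exp).hasDerivWithinAt
    · rw [interior_Icc]
      intro σ hσ
      have hσT : σ ∈ Icc 0 T := hI ⟨hσ.1.le, hσ.2.le⟩
      have h1 := inner_leviCivita_self_le
        ((hX.isSmoothField hσT).mdifferentiable (by simp) _) (w σ)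
      have h2 : 2 * inner ℝ (leviCivita (X σ) (flow (Icc 0 T) X σ s x) (w σ)) (w σ) *
          Real.exp (-(2 * P σ)) + ‖w σ‖ ^ 2 * (Real.exp (-(2 * P σ)) * (-(2 * ν σ))) =
          2 * Real.exp (-(2 * P σ)) *
            (inner ℝ (leviCivita (X σ) (flow (Icc 0 T) X σ s x) (w σ)) (w σ) - ν σ * ‖w σ‖ ^ 2) := by
        ring
      rw [h2]
      exact mul_nonpos_of_nonneg_of_nonpos (by positivity) (sub_nonpos.2 h1)
  have hle := hanti (left_mem_Icc.2 hst) (right_mem_Icc.2 hst) hst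
  have hws : ‖w s‖ = ‖v‖ := by
    have aux : ∀ φ : M → M, φ = id →
        ‖(mfderiv 𝓘(ℝ, E) 𝓘(ℝ, E) φ x v : TangentSpace 𝓘(ℝ, E) (φ x))‖ = ‖v‖ := by
      rintro _ rfl
      rw [mfderiv_id]
      rfl
    exact aux _ (funext fun y => flow_self hXc hsT y)
  have hPs : P s = 0 := intervalIntegral.integral_same
  simp only [hws, hPs, mul_zero, neg_zero, Real.exp_zero, mul_one] at hle
  have h3 : ‖w t‖ ^ 2 ≤ (Real.exp (P t) * ‖v‖) ^ 2 := by
    have h4 : Real.exp (-(2 * P t)) * Real.exp (P t) ^ 2 = 1 := by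
      rw [sq, ← Real.exp_add, ← Real.exp_add]
      simp [two_mul]
    calc ‖w t‖ ^ 2 = ‖w t‖ ^ 2 * Real.exp (-(2 * P t)) * Real.exp (P t) ^ 2 := by
          rw [mul_assoc, h4, mul_one]
      _ ≤ ‖v‖ ^ 2 * Real.exp (P t) ^ 2 := by gcongr
      _ = _ := by ring
  exact le_of_sq_le_sq h3 (by positivity)

end VariationOfFlow

/-! ### The distance estimate -/

section DistanceEstimate
universe u
variable {E : Type u} [NormedAddCommGroup E] [NormedSpace ℝ E] [FiniteDimensional ℝ E]
  {M : Type*} [TopologicalSpace M] [T2Space M] [ChartedSpace E M] [IsManifold 𝓘(ℝ, E) ∞ M]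

/-- The zero field has the identity as its flow. -/
theorem expFlow_eq_self {Z : ∀ m : M, TangentSpace 𝓘(ℝ, E) m} (hZ : IsSmoothField Z)
    (hc : IsCompleteField univ fun _ => Z) (hZ0 : ∀ m, Z m = 0) (s : ℝ) (m : M) :
    expFlow s Z m = m := by
  refine (IsFlowLine.eq_flow convex_univ (hZ.hasLocalExtensions 1) hc (mem_univ 0)
    (σ := fun _ => m) ⟨rfl, fun t _ => ?_⟩ (mem_univ s)).symm
  refine HasMFDerivWithinAt.congr_mfderiv
    (hasMFDerivWithinAt_const (I := 𝓘(ℝ, ℝ)) (I' := 𝓘(ℝ, E)) m univ t) ?_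
  ext
  change (0 : E) = (1 : ℝ) • (Z m : E)
  rw [one_smul]
  exact (hZ0 m).symm

omit [FiniteDimensional ℝ E] [T2Space M] [IsManifold 𝓘(ℝ, E) ∞ M] in
theorem HasVelocityWithin.mfderiv_one {σ : ℝ → M} {t : ℝ} {v : TangentSpace 𝓘(ℝ, E) (σ t)}
    (h : HasVelocityWithin univ σ t v) :
    (mfderiv 𝓘(ℝ, ℝ) 𝓘(ℝ, E) σ t (1 : ℝ) : TangentSpace 𝓘(ℝ, E) (σ t)) = v := by
  rw [(h.hasMFDerivAt Filter.univ_mem).mfderiv]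
  exact one_smul ℝ (v : E)

omit [FiniteDimensional ℝ E] [T2Space M] in
/-- The velocity of a `C¹` curve is continuous. -/
theorem continuousOn_velocity {J : Set ℝ} (hJ : UniqueDiffOn ℝ J) {σ : ℝ → M}
    (hσ : ContMDiffOn 𝓘(ℝ, ℝ) 𝓘(ℝ, E) 1 σ J) {w : ∀ t, TangentSpace 𝓘(ℝ, E) (σ t)}
    (hw : ∀ t ∈ J, HasVelocityWithin J σ t (w t)) :
    ContinuousOn (fun t => (⟨σ t, w t⟩ : TangentBundle 𝓘(ℝ, E) M)) J := by
  have : IsManifold 𝓘(ℝ, E) 1 M := .of_le (n := ∞) (by simp)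
  have h1 := hσ.continuousOn_tangentMapWithin le_rfl hJ.uniqueMDiffOn
  have h2 : Continuous fun t : ℝ => (⟨t, (1 : ℝ)⟩ : TangentBundle 𝓘(ℝ, ℝ) ℝ) :=
    (tangentBundleModelSpaceHomeomorph 𝓘(ℝ, ℝ)).symm.continuous.comp
      (continuous_id.prodMk continuous_const : Continuous fun t : ℝ => (t, (1 : ℝ)))
  refine (h1.comp h2.continuousOn fun t ht => ht).congr fun t ht => ?_
  have h3 := HasMFDerivWithinAt.mfderivWithin (hw t ht) (hJ.uniqueMDiffOn t ht)
  have h4 : (mfderivWithin 𝓘(ℝ, ℝ) 𝓘(ℝ, E) σ J t (1 : ℝ) : E) = w t :=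
    (congrArg (fun A : ℝ →L[ℝ] E => A 1) h3).trans (one_smul ℝ (w t : E))
  exact congrArg (fun v : E => (⟨σ t, v⟩ : TangentBundle 𝓘(ℝ, E) M)) h4.symm

/-- The derivative of `s ↦ μ_{t,s}(p(s))`: the flow transports the defect of the curve `p` from being
a flow line. -/
theorem hasVelocityWithin_flow_curve {T : ℝ} (hT : 0 < T)
    {X : ℝ → ∀ m : M, TangentSpace 𝓘(ℝ, E) m} (hX : IsSmoothTimeField (Icc 0 T) X)
    (hXc : IsCompleteField (Icc 0 T) X) {s t : ℝ} (hs : s ∈ Ioo 0 T) (ht : t ∈ Icc 0 T)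
    {p : ℝ → M} {w : TangentSpace 𝓘(ℝ, E) (p s)} (hp : HasVelocityWithin (Icc 0 T) p s w) :
    HasVelocityWithin univ (fun r => flow (Icc 0 T) X t r (p r)) s
      (mfderiv 𝓘(ℝ, E) 𝓘(ℝ, E) (flow (Icc 0 T) X t s) (p s) (w - X s (p s))) := by
  have hsT : s ∈ Icc 0 T := Ioo_subset_Icc_self hs
  have hn : Icc 0 T ∈ 𝓝 s := Icc_mem_nhds hs.1 hs.2
  have hext := hX.hasLocalExtensions_Icc hT
  have huniv : ∀ {σ : ℝ → M} {v : TangentSpace 𝓘(ℝ, E) (σ s)}, HasVelocityWithin (Icc 0 T) σ s v →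
      HasVelocityWithin univ σ s v := fun h =>
    HasMFDerivAt.hasMFDerivWithinAt (HasMFDerivWithinAt.hasMFDerivAt h hn)
  have hΦ : MDifferentiableAt (𝓘(ℝ, ℝ).prod 𝓘(ℝ, E)) 𝓘(ℝ, E)
      (fun q : ℝ × M => flow (Icc 0 T) X t q.1 q.2) (s, p s) := by
    have hmaps : MapsTo (fun q : ℝ × M => (t, (q.1, q.2))) (Icc 0 T ×ˢ (univ : Set M))
        (Icc 0 T ×ˢ (Icc 0 T ×ˢ univ)) := fun q hq => ⟨ht, hq.1, mem_univ _⟩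
    have h1 : ContMDiffOn (𝓘(ℝ, ℝ).prod 𝓘(ℝ, E)) 𝓘(ℝ, E) 1
        (fun q : ℝ × M => flow (Icc 0 T) X t q.1 q.2) (Icc 0 T ×ˢ univ) :=
      ContMDiffOn.comp (contMDiffOn_flow (n := 1) one_ne_zero hXc (convex_Icc 0 T)
        (convex_Icc 0 T) subset_rfl hext)
        (contMDiff_const.prodMk (contMDiff_fst.prodMk contMDiff_snd)).contMDiffOn hmaps
    exact (h1.contMDiffAt (prod_mem_nhds hn Filter.univ_mem)).mdifferentiableAt (by simp)
  have hη : HasVelocityWithin (E := E) univ (fun r => flow (Icc 0 T) X r s (p s)) s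
      (X s (p s) : E) := by
    refine HasVelocityWithin.cast (huniv ((hXc.isFlowLine_flow hsT (p s)).2 s hsT)) rfl ?_
    exact congrArg (fun q : M => (X s q : E)) (flow_self hXc hsT (p s))
  refine HasVelocityWithin.comp_prod_of_const hΦ (g := id) (h := id) (t' := s)
    (hasDerivAt_id s).hasDerivWithinAt (huniv hp) (hasDerivAt_id s) hη rfl
    (flow_self hXc hsT (p s)) ?_
  filter_upwards [hn] with r hr
  simp only [id]
  rw [flow_flow (convex_Icc 0 T) hext hXc ht hr hsT, flow_flow (convex_Icc 0 T) hext hXc ht hsT hsT]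

variable [RiemannianBundle (fun m : M => TangentSpace 𝓘(ℝ, E) m)]
  [IsContMDiffRiemannianBundle 𝓘(ℝ, E) ∞ E (fun m : M => TangentSpace 𝓘(ℝ, E) m)]

omit [FiniteDimensional ℝ E] [T2Space M] in
theorem continuousOn_norm_sub {J : Set ℝ} {σ : ℝ → M} {v w : ∀ t, TangentSpace 𝓘(ℝ, E) (σ t)}
    (hv : ContinuousOn (fun t => (⟨σ t, v t⟩ : TangentBundle 𝓘(ℝ, E) M)) J)
    (hw : ContinuousOn (fun t => (⟨σ t, w t⟩ : TangentBundle 𝓘(ℝ, E) M)) J) :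
    ContinuousOn (fun t => ‖v t - w t‖) J := by
  have h : ∀ {a b : ∀ t, TangentSpace 𝓘(ℝ, E) (σ t)},
      ContinuousOn (fun t => (⟨σ t, a t⟩ : TangentBundle 𝓘(ℝ, E) M)) J →
      ContinuousOn (fun t => (⟨σ t, b t⟩ : TangentBundle 𝓘(ℝ, E) M)) J →
      ContinuousOn (fun t => inner ℝ (a t) (b t)) J := fun ha hb =>
    continuousOn_inner_curve ha hb
  refine (((h hv hv).sub ((h hv hw).const_mul 2)).add (h hw hw)).sqrt.congr fun t _ => ?_
  simp only [Pi.add_apply, Pi.sub_apply]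
  rw [real_inner_self_eq_norm_sq, real_inner_self_eq_norm_sq, ← norm_sub_sq_real,
    Real.sqrt_sq (norm_nonneg _)]

/-- Continuity of `s ↦ ∫_s^t ν(s, σ) dσ`. -/
theorem continuousOn_integral_of_continuousOn_prod {ν : ℝ → ℝ → ℝ} {t : ℝ} (ht : 0 ≤ t)
    (hν : ContinuousOn (fun q : ℝ × ℝ => ν q.1 q.2) (Icc 0 t ×ˢ Icc 0 t)) :
    ContinuousOn (fun s => ∫ σ in s..t, ν s σ) (Icc 0 t) := by
  -- clamping both variables to `[0, t]` gives a function that is continuous everywhere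
  let pr : ℝ → ℝ := fun r => projIcc 0 t ht r
  have hpr : Continuous pr := continuous_subtype_val.comp continuous_projIcc
  have hpr' : ∀ r ∈ Icc 0 t, pr r = r := fun r hr => by simp only [pr, projIcc_of_mem ht hr]
  have h1 : Continuous (Function.uncurry fun s σ => ν (pr s) (pr σ)) :=
    hν.comp_continuous ((hpr.comp continuous_fst).prodMk (hpr.comp continuous_snd)) fun q =>
      ⟨(projIcc 0 t ht q.1).2, (projIcc 0 t ht q.2).2⟩
  have h2 := (intervalIntegral.continuous_parametric_intervalIntegral_of_continuous (μ := volume)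
    (a₀ := t) h1 continuous_id).neg
  refine h2.continuousOn.congr fun s hs => ?_
  rw [intervalIntegral.integral_symm]
  refine congrArg Neg.neg ?_
  refine intervalIntegral.integral_congr fun σ hσ => ?_
  change σ ∈ uIcc t s at hσ
  rw [uIcc_of_ge hs.2] at hσ
  rw [hpr' s hs, hpr' σ ⟨hs.1.trans hσ.1, hσ.2⟩]

/-- `|∇X_σ|` at `μ_{σ,s}(p(s))` is jointly continuous in `s` and `σ`. -/
theorem continuousOn_normNabla_flow {T : ℝ} (hT : 0 < T)
    {X : ℝ → ∀ m : M, TangentSpace 𝓘(ℝ, E) m} (hX : IsSmoothTimeField (Icc 0 T) X)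
    (hXc : IsCompleteField (Icc 0 T) X) {p : ℝ → M} (hp : ContinuousOn p (Icc 0 T)) :
    ContinuousOn (fun q : ℝ × ℝ => normNabla (X q.2) (flow (Icc 0 T) X q.2 q.1 (p q.1)))
      (Icc 0 T ×ˢ Icc 0 T) := by
  have hflow := (contMDiffOn_flow (n := 1) one_ne_zero hXc (convex_Icc 0 T) (convex_Icc 0 T)
    subset_rfl (hX.hasLocalExtensions_Icc hT)).continuousOn
  have hmaps0 : MapsTo (fun q : ℝ × ℝ => q.1) (Icc 0 T ×ˢ Icc 0 T) (Icc 0 T) := fun q hq => hq.1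
  have hpc : ContinuousOn (fun q : ℝ × ℝ => p q.1) (Icc 0 T ×ˢ Icc 0 T) :=
    hp.comp continuousOn_fst hmaps0
  have hmaps1 : MapsTo (fun q : ℝ × ℝ => (q.2, (q.1, p q.1))) (Icc 0 T ×ˢ Icc 0 T)
      (Icc 0 T ×ˢ (Icc 0 T ×ˢ (univ : Set M))) := fun q hq => ⟨hq.2, hq.1, mem_univ _⟩
  have h1 : ContinuousOn (fun q : ℝ × ℝ => flow (Icc 0 T) X q.2 q.1 (p q.1))
      (Icc 0 T ×ˢ Icc 0 T) :=
    ContinuousOn.comp (g := fun q : ℝ × (ℝ × M) => flow (Icc 0 T) X q.1 q.2.1 q.2.2) hflow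
      (continuousOn_snd.prodMk (continuousOn_fst.prodMk hpc)) hmaps1
  have hmaps2 : MapsTo (fun q : ℝ × ℝ => (q.2, flow (Icc 0 T) X q.2 q.1 (p q.1)))
      (Icc 0 T ×ˢ Icc 0 T) (Icc 0 T ×ˢ (univ : Set M)) := fun q hq => ⟨hq.2, mem_univ _⟩
  have h2 := hX.continuousOn_normNabla (uniqueDiffOn_Icc hT)
  have h3 := h2.comp (continuousOn_snd.prodMk h1) hmaps2
  exact h3

/-- The distance estimate for a `C¹` curve `p`: the right hand side bounds the length of the curve
`s ↦ μ_{t,s}(p(s))`, which runs from `μ_{t,0}(p(0))` to `p(t)`. -/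
theorem riemannianEDist_flow_le {T : ℝ} (hT : 0 < T)
    {X : ℝ → ∀ m : M, TangentSpace 𝓘(ℝ, E) m} (hX : IsSmoothTimeField (Icc 0 T) X)
    (hXc : IsCompleteField (Icc 0 T) X) {t : ℝ} (ht : t ∈ Icc 0 T) {p : ℝ → M}
    (hp : ContMDiffOn 𝓘(ℝ, ℝ) 𝓘(ℝ, E) 1 p (Icc 0 T)) {w : ∀ s, TangentSpace 𝓘(ℝ, E) (p s)}
    (hw : ∀ s ∈ Icc 0 T, HasVelocityWithin (Icc 0 T) p s (w s)) :
    riemannianEDist 𝓘(ℝ, E) (flow (Icc 0 T) X t 0 (p 0)) (p t) ≤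
      ENNReal.ofReal (∫ s in (0 : ℝ)..t,
        Real.exp (∫ σ in s..t, normNabla (X σ) (flow (Icc 0 T) X σ s (p s))) *
          ‖w s - X s (p s)‖) := by
  have hI : Icc 0 t ⊆ Icc 0 T := Icc_subset_Icc_right ht.2
  have h0 : (0 : ℝ) ∈ Icc 0 T := ⟨le_rfl, hT.le⟩
  have hflow := contMDiffOn_flow (n := 1) one_ne_zero hXc (convex_Icc 0 T) (convex_Icc 0 T)
    subset_rfl (hX.hasLocalExtensions_Icc hT)
  let γ : ℝ → M := fun s => flow (Icc 0 T) X t s (p s)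
  let h : ℝ → ℝ := fun s => Real.exp (∫ σ in s..t, normNabla (X σ) (flow (Icc 0 T) X σ s (p s))) *
    ‖w s - X s (p s)‖
  have hγ : ContMDiffOn 𝓘(ℝ, ℝ) 𝓘(ℝ, E) 1 γ (Icc 0 t) := by
    have hmaps : MapsTo (fun s => (t, (s, p s))) (Icc 0 T)
        (Icc 0 T ×ˢ (Icc 0 T ×ˢ (univ : Set M))) := fun s hs => ⟨ht, hs, mem_univ _⟩
    exact (ContMDiffOn.comp hflow (contMDiffOn_const.prodMk (contMDiffOn_id.prodMk hp))
      hmaps).mono hI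
  have hexp : ContinuousOn
      (fun s => ∫ σ in s..t, normNabla (X σ) (flow (Icc 0 T) X σ s (p s))) (Icc 0 t) :=
    continuousOn_integral_of_continuousOn_prod ht.1
      ((continuousOn_normNabla_flow hT hX hXc hp.continuousOn).mono (prod_mono hI hI))
  have hXp : ContinuousOn (fun s => (⟨p s, X s (p s)⟩ : TangentBundle 𝓘(ℝ, E) M)) (Icc 0 T) := by
    have hmaps : MapsTo (fun s => (s, p s)) (Icc 0 T) (Icc 0 T ×ˢ (univ : Set M)) :=
      fun s hs => ⟨hs, mem_univ _⟩
    exact ContMDiffOn.continuousOn hX |>.comp (continuousOn_id.prodMk hp.continuousOn) hmaps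
  have hh : ContinuousOn h (Icc 0 t) :=
    (Real.continuous_exp.comp_continuousOn hexp).mul
      ((continuousOn_norm_sub (continuousOn_velocity (uniqueDiffOn_Icc hT) hp hw) hXp).mono hI)
  have hle := riemannianEDist_le_pathELength (I := 𝓘(ℝ, E)) hγ rfl rfl ht.1
  have hγt : γ t = p t := flow_self hXc ht (p t)
  rw [hγt] at hle
  refine hle.trans ?_
  rw [pathELength_eq_lintegral_mfderiv_Ioo, intervalIntegral.integral_of_le ht.1,
    integral_Ioc_eq_integral_Ioo, ofReal_integral_eq_lintegral_ofReal
      (hh.integrableOn_Icc.mono_set Ioo_subset_Icc_self)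
      (Filter.Eventually.of_forall fun s => by positivity)]
  refine setLIntegral_mono' measurableSet_Ioo fun s hs => ?_
  have hsT : s ∈ Ioo 0 T := ⟨hs.1, hs.2.trans_le ht.2⟩
  have h1 := (hasVelocityWithin_flow_curve hT hX hXc hsT ht
    (hw s (Ioo_subset_Icc_self hsT))).mfderiv_one
  have h2 := norm_mfderiv_flow_le hT hX hXc hsT hs.2.le ht.2 (p s) (w s - X s (p s))
  have h3 : ‖(mfderiv 𝓘(ℝ, ℝ) 𝓘(ℝ, E) γ s (1 : ℝ) : TangentSpace 𝓘(ℝ, E) (γ s))‖ ≤ h s :=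
    (congrArg norm h1).trans_le h2
  rw [← ofReal_norm]
  exact ENNReal.ofReal_le_ofReal h3

end DistanceEstimate

end

theorem proposition1p9 {E : Type*} [NormedAddCommGroup E] [NormedSpace ℝ E] [FiniteDimensional ℝ E]
    {M : Type*} [TopologicalSpace M] [T2Space M] [ConnectedSpace M] [ChartedSpace E M]
    [IsManifold 𝓘(ℝ, E) ∞ M]
    [RiemannianBundle (fun m : M => TangentSpace 𝓘(ℝ, E) m)]
    [IsContMDiffRiemannianBundle 𝓘(ℝ, E) ∞ E (fun m : M => TangentSpace 𝓘(ℝ, E) m)]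
    (T : ℝ) (hT : 0 < T) (X Z : ℝ → ∀ m : M, TangentSpace 𝓘(ℝ, E) m)
    (hX : IsSmoothTimeField (Icc 0 T) X) (hXc : IsCompleteField (Icc 0 T) X)
    (hZ : IsSmoothTimeField (Icc 0 T) Z)
    (hZc : ∀ t ∈ Icc 0 T, IsCompleteField univ (fun _ => Z t))
    (hZ0 : ∀ m, Z 0 m = 0) :
    (∀ t ∈ Icc 0 T, IsSmoothField (fieldW (Icc 0 T) Z t)) ∧
    (∀ m : M, ∀ t ∈ Icc 0 T, HasVelocityWithin (Icc 0 T) (fun τ => expFlow 1 (Z τ) m) t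
      (fieldW (Icc 0 T) Z t (expFlow 1 (Z t) m))) ∧
    ∀ t ∈ Icc 0 T, ∀ m : M,
      riemannianEDist 𝓘(ℝ, E) (flow (Icc 0 T) X t 0 m) (expFlow 1 (Z t) m) ≤
        ENNReal.ofReal (∫ s in (0 : ℝ)..t,
          Real.exp (∫ σ in s..t, normNabla (X σ) (flow (Icc 0 T) X σ s (expFlow 1 (Z s) m))) *
            ‖fieldW (Icc 0 T) Z s (expFlow 1 (Z s) m) - X s (expFlow 1 (Z s) m)‖) := by
  have hu : UniqueDiffOn ℝ (Icc 0 T) := uniqueDiffOn_Icc hT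
  have hvel : ∀ m : M, ∀ t ∈ Icc 0 T, HasVelocityWithin (Icc 0 T) (fun τ => expFlow 1 (Z τ) m) t
      (fieldW (Icc 0 T) Z t (expFlow 1 (Z t) m)) := fun m t ht =>
    hasVelocityWithin_expFlow_one (convex_Icc 0 T) hu hZ (hZ.hasLocalExtensions_Icc hT) hZc ht m
  refine ⟨fun t ht => isSmoothField_fieldW hu hZ ht (hZc t ht), hvel, fun t ht m => ?_⟩
  have h0 : (0 : ℝ) ∈ Icc 0 T := ⟨le_rfl, hT.le⟩
  have hp : ContMDiffOn 𝓘(ℝ, ℝ) 𝓘(ℝ, E) 1 (fun s => expFlow 1 (Z s) m) (Icc 0 T) := by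
    have hmaps : MapsTo (fun s : ℝ => (s, ((1 : ℝ), m))) (Icc 0 T)
        (Icc 0 T ×ˢ (univ : Set (ℝ × M))) := fun s hs => ⟨hs, mem_univ _⟩
    exact ContMDiffOn.comp (contMDiffOn_expFlow_family (n := 1) one_ne_zero
      (hZ.hasLocalExtensions_Icc hT) hZc) (contMDiffOn_id.prodMk contMDiffOn_const) hmaps
  have h := riemannianEDist_flow_le hT hX hXc ht hp (hvel m)
  rwa [expFlow_eq_self (hZ.isSmoothField h0) (hZc 0 h0) hZ0 1 m] at h
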